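/- Let $\ell:\mathbb R\to\mathbb R$ be one of the following losses, with the attached numbers $q_0,\mathbf q,\bar{\mathbf q}_0=2\lceil q_0\mathbf q/2\rceil$: the squared loss $\ell(t)=t^2$ ($q_0=2$, $\mathbf q=3/2$, $\bar{\mathbf q}_0=4$); the absolute loss $\ell(t)=|t|$ ($q_0=1$, $\mathbf q=0$, $\bar{\mathbf q}_0=0$); the Huber loss with fixed threshold $\eta>0$, $\ell(t)=t^2/2$ for $|t|\le\eta$ and $\ell(t)=\eta|t|-\eta^2/2$ for $|t|>\eta$ ($q_0=1$, $\mathbf q=0$, $\bar{\mathbf q}_0=0$). Put $q^*=2^{(\bar{\mathbf q}_0+4)/2}$. For every $n\ge1$ let $p=p_n\in\mathbb N$ with $\tau\le p/n\le1/\tau$, where $\tau\in(0,1)$ is fixed. Let $X_1,\dots,X_n$ be i.i.d. random vectors in $\mathbb R^p$ with $\mathbb E[X_i]=0$ and $\mathbb E[X_iX_i^\top]=\Sigma/n$ with $\Sigma=\Sigma_n$ positive definite, and let $G_1,\dots,G_n$ be i.i.d. with law $N(0,\Sigma/n)$; let $\mathbf X$, $\mathbf G$ be the design matrices with these rows. Let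 $\xi=(\xi_1,\dots,\xi_n)$ be a noise vector (random or deterministic) which is independent of $\mathbf X$ and independent of $\mathbf G$. Assume that, for a constant $M<\infty$ not depending on $n$, $\mathbb E[|\sqrt n\,X_{i,j}|^{q^*}]^{1/q^*}\le M$ for all $i,j$ and $\lambda_{\max}(\Sigma)\le M$. Assume that $X_i$ is $d$-block dependent with $d=d_n$: there are $k\le p$ and a partition of $\{1,\dots,p\}$ into cells $B_1,\dots,B_k$ with at most $d$ elements each such that the subvectors $(X_{i,j})_{j\in B_1},\dots,(X_{i,j})_{j\in B_k}$ are independent. With $\ell_i(x)=\ell(x-\xi_i)$, let $L_{\ell_i}\ge1$ be (possibly $\xi$-dependent) numbers with $\sup_{x}|\ell_i(x)|/(1+|x|^{q_0})\le L_{\ell_i}$, and assume $\frac1n\sum_{i=1}^nL_{\ell_i}^{\mathbf q}=O(1)$ (in probability, if $\xi$ is random). Let $R=R_n:\mathbb R^p\to\mathbb R$ be convex. For a design $\mathbf A$ with rows $A_i$ set $H_\ell(w,\mathbf A)=\frac1n\sum_{i=1}^n\ell_i(A_i^\top w)+R(w)$, and let $\hat w_{\mathbf X}$, $\hat w_{\mathbf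 G}$ be random vectors that almost surely minimize $H_\ell(\cdot,\mathbf X)$, $H_\ell(\cdot,\mathbf G)$ over $\mathbb R^p$. Let $\mathcal S_n\subset\mathbb R^p$ be measurable, $\varepsilon_n\in[0,1/4)$, $L_n\ge1$, $z=z_n\in\mathbb R$, and let $\rho_0>0$ be fixed, such that for all $n$ (i) $\max\{\Pr(\|\hat w_{\mathbf G}\|_\infty>L_n),\Pr(\|\hat w_{\mathbf X}\|_\infty>L_n)\}\le\varepsilon_n$; (ii) $\max\{\Pr(\inf_{w\in\mathbb R^p}H_\ell(w,\mathbf G)\ge z+\rho_0),\ \Pr(\inf_{w\in\mathcal S_n}H_\ell(w,\mathbf G)\le z+2\rho_0)\}\le\varepsilon_n$ (the infimum over the empty set being $+\infty$). Let $\alpha\in[0,1/(2\bar{\mathbf q}_0+6)]$ and $\kappa\ge0$, and suppose that, as $n\to\infty$, $L_n=O(n^\alpha\log^\kappa n)$ and $d=o\bigl(n^{1/4-(\bar{\mathbf q}_0+3)\alpha/2}/\log^{6+(2\bar{\mathbf q}_0+6)\kappa}n\bigr)$. Then, as $n\to\infty$, $$|\Pr(\hat w_{\mathbf X}\in\mathcal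 S_n)-\Pr(\hat w_{\mathbf G}\in\mathcal S_n)|\le4\varepsilon_n+o(1).$$ -/

import Mathlib

open MeasureTheory ProbabilityTheory Filter Topology Asymptotics

noncomputable section

namespace BlockUniversality

/-- The three loss functions: squared, absolute and Huber (with threshold `η > 0`). -/
inductive RegressionLoss : Type
  | squared : RegressionLoss
  | absolute : RegressionLoss
  | huber (η : ℝ) (hη : 0 < η) : RegressionLoss

namespace RegressionLoss

/-- The loss as a function of the residual `t`. -/
def fn : RegressionLoss → ℝ → ℝ
  | squared, t => t ^ 2
  | absolute, t => |t|
  | huber η _, t => if |t| ≤ η then t ^ 2 / 2 else η * |t| - η ^ 2 / 2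

/-- The growth exponent `q₀` of the loss. -/
def qZero : RegressionLoss → ℝ
  | squared => 2
  | absolute => 1
  | huber _ _ => 1

/-- The exponent `q₁` in the self-bounding property of the first derivative. -/
def qOne : RegressionLoss → ℝ
  | squared => 1 / 2
  | absolute => 0
  | huber _ _ => 0

/-- The exponent `q₂` in the self-bounding property of the second derivative. -/
def qTwo : RegressionLoss → ℝ
  | squared => 0
  | absolute => 0
  | huber _ _ => 0

/-- The exponent `q₃` in the self-bounding property of the third derivative. -/
def qThree : RegressionLoss → ℝ
  | squared => 0
  | absolute => 0
  | huber _ _ => 0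

/-- `𝐪 = max {3 q₁, q₁ + q₂, q₃}`. -/
def qBold (l : RegressionLoss) : ℝ :=
  max (3 * l.qOne) (max (l.qOne + l.qTwo) l.qThree)

/-- `q̄₀ = 2 ⌈q₀ 𝐪 / 2⌉`. -/
def qBar (l : RegressionLoss) : ℝ := 2 * (⌈l.qZero * l.qBold / 2⌉ : ℝ)

/-- The order `q* = 2 ^ ((q̄₀ + 4) / 2)` of the moments of the rescaled covariates. -/
def qStar (l : RegressionLoss) : ℝ := (2 : ℝ) ^ ((l.qBar + 4) / 2)

end RegressionLoss

/-- The empirical risk `H(w, A) = n⁻¹ ∑ᵢ ℓ(Aᵢᵀ w - ξᵢ) + R(w)` of a design `A` with rows `Aᵢ`. -/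
def risk {n p : ℕ} (l : RegressionLoss) (R : (Fin p → ℝ) → ℝ)
    (A : Fin n → Fin p → ℝ) (ξ : Fin n → ℝ) (w : Fin p → ℝ) : ℝ :=
  (1 / (n : ℝ)) * ∑ i, l.fn ((∑ j, A i j * w j) - ξ i) + R w

/-- The minimal value of the risk over `S`, in the extended reals
(so that it is `⊤` for empty `S`, and `⊥` if the risk is unbounded below on `S`). -/
def minRisk {n p : ℕ} (l : RegressionLoss) (R : (Fin p → ℝ) → ℝ)
    (A : Fin n → Fin p → ℝ) (ξ : Fin n → ℝ) (S : Set (Fin p → ℝ)) : EReal :=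
  ⨅ w ∈ S, ((risk l R A ξ w : ℝ) : EReal)

/-- `d`-block dependence of a random vector: the coordinates can be partitioned into at most `p`
cells, each of size at most `d`, such that the subvectors on the cells are independent. -/
def BlockDependent {Ω : Type*} [MeasurableSpace Ω] (P : Measure Ω) {p : ℕ}
    (Z : Ω → Fin p → ℝ) (d : ℕ) : Prop :=
  ∃ k : ℕ, k ≤ p ∧ ∃ B : Fin k → Finset (Fin p),
    Pairwise (fun a b => Disjoint (B a) (B b)) ∧
    (∀ j : Fin p, ∃ a, j ∈ B a) ∧
    (∀ a, (B a).card ≤ d) ∧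
    iIndepFun (fun (a : Fin k) (ω : Ω) (j : {j : Fin p // j ∈ B a}) => Z ω j) P

/-- The largest eigenvalue of a (symmetric) real matrix. -/
def lambdaMax {p : ℕ} (A : Matrix (Fin p) (Fin p) ℝ) : ℝ := sSup (spectrum ℝ A)

/-- The rows `Xᵢ` of a random design are i.i.d. random vectors with mean `0` and
`E[Xᵢ Xᵢᵀ] = Σ / n`. -/
structure IsDesign {Ω : Type*} [MeasurableSpace Ω] (P : Measure Ω) {n p : ℕ}
    (X : Ω → Fin n → Fin p → ℝ) (Sig : Matrix (Fin p) (Fin p) ℝ) : Prop where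
  measurable : Measurable X
  indep : iIndepFun (fun i ω => X ω i) P
  identDistrib : ∀ i i', IdentDistrib (fun ω => X ω i) (fun ω => X ω i') P P
  mean : ∀ i j, ∫ ω, X ω i j ∂P = 0
  cov : ∀ i j k, ∫ ω, X ω i j * X ω i k ∂P = Sig j k / n

/-- The rows `Gᵢ` of a random design are i.i.d. with law `N(0, Σ / n)`. -/
structure IsGaussianDesign {Ω : Type*} [MeasurableSpace Ω] (P : Measure Ω) {n p : ℕ}
    (G : Ω → Fin n → Fin p → ℝ) (Sig : Matrix (Fin p) (Fin p) ℝ) : Prop where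
  measurable : Measurable G
  indep : iIndepFun (fun i ω => G ω i) P
  law : ∀ i, P.map (fun ω => WithLp.toLp 2 (G ω i)) =
    multivariateGaussian 0 ((1 / (n : ℝ)) • Sig)

/-- A sequence of real random variables is `O(1)` in probability. -/
def BoundedInProbability {Ω : ℕ → Type*} [∀ n, MeasurableSpace (Ω n)]
    (P : ∀ n, Measure (Ω n)) (A : ∀ n, Ω n → ℝ) : Prop :=
  ∀ η : ℝ, 0 < η → ∃ K : ℝ, ∀ᶠ n in atTop, (P n).real {ω | K < |A n ω|} ≤ η

end BlockUniversality

end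

open MeasureTheory ProbabilityTheory Filter Topology Asymptotics

noncomputable section

namespace BlockUniversality

/-! ### Taylor expansion and derivatives of a sigmoid of a log-partition function -/

section Calculus

/-- Second order Taylor expansion on the unit interval, with a bound on the remainder. -/
lemma abs_taylor_two_le {f f₁ f₂ f₃ : ℝ → ℝ} {C : ℝ}
    (h₁ : ∀ s, HasDerivAt f (f₁ s) s) (h₂ : ∀ s, HasDerivAt f₁ (f₂ s) s)
    (h₃ : ∀ s, HasDerivAt f₂ (f₃ s) s) (hC : ∀ s ∈ Set.Icc (0 : ℝ) 1, |f₃ s| ≤ C) :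
    |f 1 - f 0 - f₁ 0 - f₂ 0 / 2| ≤ C := by
  have hC0 : 0 ≤ C := (abs_nonneg _).trans (hC 0 (by simp))
  -- The mean value inequality is applied three times, to successive Taylor remainders. This gives
  -- the constant C instead of C/6, which is enough.
  have key : ∀ (F F' : ℝ → ℝ), (∀ s, HasDerivAt F (F' s) s) →
      (∀ s ∈ Set.Icc (0 : ℝ) 1, |F' s| ≤ C) → ∀ s ∈ Set.Icc (0 : ℝ) 1, |F s - F 0| ≤ C := by
    intro F F' hF hF' s hs
    have := (convex_Icc (0 : ℝ) 1).norm_image_sub_le_of_norm_hasDerivWithin_le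
      (fun x _ => (hF x).hasDerivWithinAt) (fun x hx => by simpa using hF' x hx)
      (show (0 : ℝ) ∈ Set.Icc (0 : ℝ) 1 by simp) hs
    simp only [Real.norm_eq_abs, sub_zero] at this
    refine this.trans ?_
    rw [abs_of_nonneg hs.1]
    nlinarith [hs.2]
  have b2 := key f₂ f₃ h₃ hC
  have b1 := key (fun s => f₁ s - f₂ 0 * s) (fun s => f₂ s - f₂ 0)
    (fun s => ((h₂ s).sub ((hasDerivAt_id s).const_mul (f₂ 0))).congr_deriv (by ring)) b2
  have b0 := key (fun s => f s - f₁ 0 * s - f₂ 0 * s ^ 2 / 2)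
    (fun s => (fun s => f₁ s - f₂ 0 * s) s - (fun s => f₁ s - f₂ 0 * s) 0)
    (fun s => by
      have := ((h₁ s).sub ((hasDerivAt_id s).const_mul (f₁ 0))).sub
        ((((hasDerivAt_id s).pow 2).const_mul (f₂ 0)).div_const 2)
      refine this.congr_deriv ?_
      simp; ring) b1 1 (by simp)
  refine le_trans (le_of_eq ?_) b0
  congr 1
  ring

lemma hasDerivAt_sigmoid_affine (k m y : ℝ) :
    HasDerivAt (fun y => Real.sigmoid (k * y + m))
      (k * (Real.sigmoid (k * y + m) * (1 - Real.sigmoid (k * y + m)))) y := by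
  have h : HasDerivAt (fun y : ℝ => k * y + m) k y := by
    simpa using ((hasDerivAt_id y).const_mul k).add_const m
  exact ((Real.hasDerivAt_sigmoid (k * y + m)).comp y h).congr_deriv (mul_comm _ _)

/-- The logistic function of the logarithm of a partition function, along a line: three
derivatives. -/
lemma exists_derivs_sigmoid_log {Z Z₁ Z₂ Z₃ : ℝ → ℝ} (hpos : ∀ s, 0 < Z s) (k m : ℝ)
    (h₁ : ∀ s, HasDerivAt Z (Z₁ s) s) (h₂ : ∀ s, HasDerivAt Z₁ (Z₂ s) s)
    (h₃ : ∀ s, HasDerivAt Z₂ (Z₃ s) s) :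
    ∃ f₁ f₂ f₃ : ℝ → ℝ,
      (∀ s, HasDerivAt (fun s => Real.sigmoid (k * Real.log (Z s) + m)) (f₁ s) s) ∧
      (∀ s, HasDerivAt f₁ (f₂ s) s) ∧ (∀ s, HasDerivAt f₂ (f₃ s) s) ∧
      ∀ s, ∃ S : ℝ, S = Real.sigmoid (k * Real.log (Z s) + m) ∧
        f₁ s = k * (S * (1 - S)) * (Z₁ s / Z s) ∧
        f₂ s = k ^ 2 * (S * (1 - S) * (1 - 2 * S)) * (Z₁ s / Z s) ^ 2 +
          k * (S * (1 - S)) * (Z₂ s / Z s - (Z₁ s / Z s) ^ 2) ∧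
        f₃ s = k ^ 3 * (S * (1 - S) * (1 - 6 * S + 6 * S ^ 2)) * (Z₁ s / Z s) ^ 3 +
          3 * (k ^ 2 * (S * (1 - S) * (1 - 2 * S))) * (Z₁ s / Z s) *
            (Z₂ s / Z s - (Z₁ s / Z s) ^ 2) +
          k * (S * (1 - S)) *
            (Z₃ s / Z s - 3 * (Z₂ s / Z s) * (Z₁ s / Z s) + 2 * (Z₁ s / Z s) ^ 3) := by
  set Sg : ℝ → ℝ := fun s => Real.sigmoid (k * Real.log (Z s) + m) with hSg
  have hS : ∀ s, HasDerivAt Sg (k * (Sg s * (1 - Sg s)) * (Z₁ s / Z s)) s := by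
    intro s
    have h := HasDerivAt.comp (h₂ := fun y => Real.sigmoid (k * y + m)) s
      (hasDerivAt_sigmoid_affine k m (Real.log (Z s))) ((h₁ s).log (hpos s).ne')
    exact h
  have hA : ∀ s, HasDerivAt (fun s => Z₁ s / Z s) (Z₂ s / Z s - (Z₁ s / Z s) ^ 2) s := by
    intro s
    refine ((h₂ s).div (h₁ s) (hpos s).ne').congr_deriv ?_
    have := (hpos s).ne'
    field_simp
  have hE : ∀ s, HasDerivAt (fun s => Z₂ s / Z s)
      (Z₃ s / Z s - (Z₂ s / Z s) * (Z₁ s / Z s)) s := by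
    intro s
    refine ((h₃ s).div (h₁ s) (hpos s).ne').congr_deriv ?_
    have := (hpos s).ne'
    field_simp
  have hS' : ∀ s, HasDerivAt (fun s => k * (Sg s * (1 - Sg s)))
      (k ^ 2 * (Sg s * (1 - Sg s) * (1 - 2 * Sg s)) * (Z₁ s / Z s)) s := by
    intro s
    refine (((hS s).mul ((hS s).const_sub 1)).const_mul k).congr_deriv ?_
    ring
  have hS'' : ∀ s, HasDerivAt (fun s => k ^ 2 * (Sg s * (1 - Sg s) * (1 - 2 * Sg s)))
      (k ^ 3 * (Sg s * (1 - Sg s) * (1 - 6 * Sg s + 6 * Sg s ^ 2)) * (Z₁ s / Z s)) s := by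
    intro s
    refine ((((hS s).mul ((hS s).const_sub 1)).mul
      (((hS s).const_mul 2).const_sub 1)).const_mul (k ^ 2)).congr_deriv ?_
    simp only [Pi.mul_apply]
    ring
  refine ⟨_, _, _, hS, ?_, ?_, fun s => ⟨Sg s, rfl, rfl, rfl, rfl⟩⟩
  · intro s
    refine ((hS' s).mul (hA s)).congr_deriv ?_
    ring
  · intro s
    refine (((hS'' s).mul ((hA s).pow 2)).add
      ((hS' s).mul ((hE s).sub ((hA s).pow 2)))).congr_deriv ?_
    simp only [Pi.pow_apply, Pi.sub_apply]
    push_cast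
    ring

/-- Bound on the third derivative in terms of `Z₁ / Z`, `Z₂ / Z`, `Z₃ / Z`. -/
lemma abs_third_deriv_le {S k A E F q x x' m : ℝ} (hS0 : 0 ≤ S) (hS1 : S ≤ 1) (hk : |k| ≤ 1)
    (hq : 0 ≤ q) (hx : 0 ≤ x) (hA : |A| ≤ q * x) (hE : |E - A ^ 2| ≤ 3 * q ^ 2 * x')
    (hxm : x ^ 3 ≤ m) (hxm' : x * x' ≤ m)
    (hF : |F - 3 * E * A + 2 * A ^ 3| ≤ 13 * q ^ 3 * m) :
    |k ^ 3 * (S * (1 - S) * (1 - 6 * S + 6 * S ^ 2)) * A ^ 3 +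
      3 * (k ^ 2 * (S * (1 - S) * (1 - 2 * S))) * A * (E - A ^ 2) +
      k * (S * (1 - S)) * (F - 3 * E * A + 2 * A ^ 3)| ≤ 23 * |k| * (q ^ 3 * m) := by
  have hT : 0 ≤ S * (1 - S) := mul_nonneg hS0 (by linarith)
  have hT1 : S * (1 - S) ≤ 1 := by nlinarith
  have h1 : |S * (1 - S)| ≤ 1 := by rw [abs_of_nonneg hT]; exact hT1
  have h2 : |S * (1 - S) * (1 - 2 * S)| ≤ 1 := by
    rw [abs_mul]
    have : |1 - 2 * S| ≤ 1 := abs_le.2 ⟨by linarith, by linarith⟩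
    exact mul_le_one₀ h1 (abs_nonneg _) this
  have h3 : |S * (1 - S) * (1 - 6 * S + 6 * S ^ 2)| ≤ 1 := by
    rw [abs_mul]
    have : |1 - 6 * S + 6 * S ^ 2| ≤ 1 :=
      abs_le.2 ⟨by nlinarith [sq_nonneg (2 * S - 1)], by nlinarith⟩
    exact mul_le_one₀ h1 (abs_nonneg _) this
  have hk0 := abs_nonneg k
  -- With |k| ≤ 1 every power of k is reduced to a single |k|, the factor that later supplies
  -- 1/(θn).
  have hk2 : |k| ^ 2 ≤ |k| := by nlinarith
  have hk3 : |k| ^ 3 ≤ |k| := by nlinarith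
  have hm : 0 ≤ m := (pow_nonneg hx 3).trans hxm
  have hA3 : |A| ^ 3 ≤ q ^ 3 * m := by
    calc |A| ^ 3 ≤ (q * x) ^ 3 := pow_le_pow_left₀ (abs_nonneg _) hA 3
      _ = q ^ 3 * x ^ 3 := by ring
      _ ≤ _ := by gcongr
  have hAE : |A| * |E - A ^ 2| ≤ 3 * (q ^ 3 * m) := by
    calc |A| * |E - A ^ 2| ≤ (q * x) * (3 * q ^ 2 * x') := by gcongr
      _ = 3 * (q ^ 3 * (x * x')) := by ring
      _ ≤ _ := by gcongr
  have t1 : |k ^ 3 * (S * (1 - S) * (1 - 6 * S + 6 * S ^ 2)) * A ^ 3| ≤ |k| * (q ^ 3 * m) := by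
    rw [abs_mul, abs_mul, abs_pow, abs_pow]
    calc |k| ^ 3 * |S * (1 - S) * (1 - 6 * S + 6 * S ^ 2)| * |A| ^ 3
        ≤ |k| * 1 * (q ^ 3 * m) := by gcongr
      _ = _ := by ring
  have t2 : |3 * (k ^ 2 * (S * (1 - S) * (1 - 2 * S))) * A * (E - A ^ 2)| ≤
      9 * (|k| * (q ^ 3 * m)) := by
    rw [abs_mul, abs_mul, abs_mul, abs_mul, abs_pow, mul_assoc _ |A|]
    calc |3| * (|k| ^ 2 * |S * (1 - S) * (1 - 2 * S)|) * (|A| * |E - A ^ 2|)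
        ≤ 3 * (|k| * 1) * (3 * (q ^ 3 * m)) := by
          gcongr
          simp
      _ = _ := by ring
  have t3 : |k * (S * (1 - S)) * (F - 3 * E * A + 2 * A ^ 3)| ≤ 13 * (|k| * (q ^ 3 * m)) := by
    rw [abs_mul, abs_mul]
    calc |k| * |S * (1 - S)| * |F - 3 * E * A + 2 * A ^ 3|
        ≤ |k| * 1 * (13 * q ^ 3 * m) := by gcongr
      _ = _ := by ring
  -- The three terms contribute 1 + 9 + 13 = 23.
  refine (abs_add_le _ _).trans ?_
  refine (add_le_add ((abs_add_le _ _).trans (add_le_add t1 t2)) t3).trans (le_of_eq ?_)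
  ring

end Calculus

/-! ### Gibbs averages, Young and Chebyshev inequalities -/

section Gibbs

variable {κ : Type*}

/-- The partition function with energies `E`. -/
def partitionFn (s : Finset κ) (E : κ → ℝ) : ℝ := ∑ w ∈ s, Real.exp (-E w)

/-- The average of `φ` for the Gibbs measure with energies `E`. -/
def gibbs (s : Finset κ) (E φ : κ → ℝ) : ℝ :=
  (∑ w ∈ s, Real.exp (-E w) * φ w) / partitionFn s E

lemma partitionFn_pos {s : Finset κ} (hs : s.Nonempty) (E : κ → ℝ) : 0 < partitionFn s E :=
  Finset.sum_pos (fun _ _ => Real.exp_pos _) hs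

lemma gibbs_mono {s : Finset κ} (E : κ → ℝ) {φ ψ : κ → ℝ} (h : ∀ w ∈ s, φ w ≤ ψ w) :
    gibbs s E φ ≤ gibbs s E ψ := by
  unfold gibbs
  refine div_le_div_of_nonneg_right (Finset.sum_le_sum fun w hw => ?_)
    (Finset.sum_nonneg fun _ _ => (Real.exp_pos _).le)
  exact mul_le_mul_of_nonneg_left (h w hw) (Real.exp_pos _).le

lemma gibbs_add (s : Finset κ) (E φ ψ : κ → ℝ) :
    gibbs s E (fun w => φ w + ψ w) = gibbs s E φ + gibbs s E ψ := by
  simp only [gibbs, mul_add, Finset.sum_add_distrib, add_div]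

lemma gibbs_const_mul (s : Finset κ) (E φ : κ → ℝ) (c : ℝ) :
    gibbs s E (fun w => c * φ w) = c * gibbs s E φ := by
  simp only [gibbs, ← mul_div_assoc, Finset.mul_sum]
  congr 1
  exact Finset.sum_congr rfl fun _ _ => by ring

lemma gibbs_const {s : Finset κ} (hs : s.Nonempty) (E : κ → ℝ) (c : ℝ) :
    gibbs s E (fun _ => c) = c := by
  have := (partitionFn_pos hs E).ne'
  unfold gibbs
  rw [← Finset.sum_mul]
  change partitionFn s E * c / _ = c
  field_simp

lemma gibbs_nonneg {s : Finset κ} (E : κ → ℝ) {φ : κ → ℝ} (h : ∀ w ∈ s, 0 ≤ φ w) :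
    0 ≤ gibbs s E φ :=
  div_nonneg (Finset.sum_nonneg fun w hw => mul_nonneg (Real.exp_pos _).le (h w hw))
    (Finset.sum_nonneg fun _ _ => (Real.exp_pos _).le)

lemma abs_gibbs_le (s : Finset κ) (E φ : κ → ℝ) :
    |gibbs s E φ| ≤ gibbs s E (fun w => |φ w|) := by
  refine abs_le.2 ⟨?_, gibbs_mono E fun w _ => le_abs_self _⟩
  have := gibbs_const_mul s E φ (-1)
  have h2 : gibbs s E (fun w => -1 * φ w) ≤ gibbs s E (fun w => |φ w|) :=
    gibbs_mono E fun w _ => by rw [neg_one_mul]; exact neg_le_abs _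
  linarith

/-- Young's inequality for Gibbs averages. -/
lemma gibbs_mul_sq_le {s : Finset κ} (hs : s.Nonempty) (E : κ → ℝ) {V : κ → ℝ}
    (hV : ∀ w ∈ s, 0 ≤ V w) :
    gibbs s E V ^ 3 ≤ gibbs s E (fun w => V w ^ 3) ∧
      gibbs s E V * gibbs s E (fun w => V w ^ 2) ≤ gibbs s E (fun w => V w ^ 3) := by
  set x := gibbs s E V with hx
  have hx0 : 0 ≤ x := gibbs_nonneg E hV
  have h1 : x ^ 3 ≤ gibbs s E (fun w => V w ^ 3) := by
    -- The tangent line of the cube at x lies below it: V³ − 3x²V + 2x³ = (V − x)²(V + 2x).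
    have h : gibbs s E (fun w => 3 * x ^ 2 * V w + -2 * x ^ 3) ≤ gibbs s E (fun w => V w ^ 3) :=
      gibbs_mono E fun w hw => by
        have := hV w hw
        nlinarith [mul_nonneg (sq_nonneg (V w - x)) (add_nonneg this (mul_nonneg zero_le_two hx0))]
    rw [gibbs_add, gibbs_const_mul, gibbs_const hs, ← hx] at h
    linarith [h]
  refine ⟨h1, ?_⟩
  -- Pointwise, 2V³ + x³ − 3xV² = (V − x)²(2V + x); after averaging, x³ is absorbed by the first
  -- inequality.
  have h : gibbs s E (fun w => 3 * x * V w ^ 2) ≤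
      gibbs s E (fun w => 2 * V w ^ 3 + x ^ 3) :=
    gibbs_mono E fun w hw => by
      have := hV w hw
      nlinarith [mul_nonneg (sq_nonneg (V w - x)) (add_nonneg (mul_nonneg zero_le_two this) hx0)]
  rw [gibbs_add, gibbs_const_mul, gibbs_const_mul, gibbs_const hs] at h
  linarith

/-- Chebyshev's association inequality: adding an energy that increases with `V` decreases the
Gibbs average of `V`. -/
lemma gibbs_add_energy_le {s : Finset κ} (hs : s.Nonempty) (E F V : κ → ℝ)
    (h : ∀ w ∈ s, ∀ w' ∈ s, 0 ≤ (F w - F w') * (V w - V w')) :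
    gibbs s (fun w => E w + F w) V ≤ gibbs s E V := by
  unfold gibbs
  rw [div_le_div_iff₀ (partitionFn_pos hs _) (partitionFn_pos hs _)]
  unfold partitionFn
  rw [Finset.sum_mul_sum, Finset.sum_mul_sum]
  set a : κ → ℝ := fun w => Real.exp (-E w)
  set b : κ → ℝ := fun w => Real.exp (-F w)
  have hab : ∀ w, Real.exp (-(E w + F w)) = a w * b w := fun w => by
    rw [← Real.exp_add]; ring_nf
  simp_rw [hab]
  -- Symmetrization over pairs: exp(−F) and V are oppositely ordered, so each summand is
  -- nonnegative, and the double sum is twice the difference of the two sides.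
  have key : 0 ≤ ∑ w ∈ s, ∑ w' ∈ s, a w * a w' * ((b w' - b w) * (V w - V w')) := by
    refine Finset.sum_nonneg fun w hw => Finset.sum_nonneg fun w' hw' => ?_
    refine mul_nonneg (mul_nonneg (Real.exp_pos _).le (Real.exp_pos _).le) ?_
    have := h w hw w' hw'
    rcases lt_trichotomy (F w) (F w') with hlt | heq | hgt
    · have h1 : V w - V w' ≤ 0 := by nlinarith
      have h2 : b w' ≤ b w := Real.exp_le_exp.2 (by linarith)
      nlinarith
    · simp [b, heq]
    · have h1 : 0 ≤ V w - V w' := by nlinarith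
      have h2 : b w ≤ b w' := Real.exp_le_exp.2 (by linarith)
      exact mul_nonneg (by linarith) h1
  have e1 : ∑ w ∈ s, ∑ w' ∈ s, a w * a w' * ((b w' - b w) * (V w - V w')) =
      2 * (∑ w ∈ s, ∑ w' ∈ s, a w * V w * (a w' * b w')) -
      2 * (∑ w ∈ s, ∑ w' ∈ s, a w * b w * V w * a w') := by
    have c1 : ∑ w ∈ s, ∑ w' ∈ s, a w' * V w' * (a w * b w) =
        ∑ w ∈ s, ∑ w' ∈ s, a w * V w * (a w' * b w') := Finset.sum_comm
    have c2 : ∑ w ∈ s, ∑ w' ∈ s, a w' * b w' * V w' * a w =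
        ∑ w ∈ s, ∑ w' ∈ s, a w * b w * V w * a w' := Finset.sum_comm
    rw [two_mul, two_mul]
    nth_rewrite 2 [← c1]
    nth_rewrite 2 [← c2]
    simp only [← Finset.sum_add_distrib, ← Finset.sum_sub_distrib]
    exact Finset.sum_congr rfl fun w _ => Finset.sum_congr rfl fun w' _ => by ring
  linarith

end Gibbs

/-- A loss with three derivatives dominated by the powers of a weight `V`, where `V` increases with
the loss and `V ^ 3` grows at most like `1 + c |t| ^ 3`. -/
structure IsTame (g g₁ g₂ g₃ V : ℝ → ℝ) (c C : ℝ) : Prop where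
  deriv₁ : ∀ t, HasDerivAt g (g₁ t) t
  deriv₂ : ∀ t, HasDerivAt g₁ (g₂ t) t
  deriv₃ : ∀ t, HasDerivAt g₂ (g₃ t) t
  one_le : 1 ≤ C
  c_nonneg : 0 ≤ c
  V_nonneg : ∀ t, 0 ≤ V t
  bound₁ : ∀ t, |g₁ t| ≤ C * V t
  bound₂ : ∀ t, |g₂ t| ≤ C * V t ^ 2
  bound₃ : ∀ t, |g₃ t| ≤ C * V t ^ 3
  comono : ∀ s t, 0 ≤ (g s - g t) * (V s ^ 3 - V t ^ 3)
  growth : ∀ t, V t ^ 3 ≤ C * (1 + c * |t| ^ 3)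

/-! ### Third-order expansion in the contribution of one cell -/

section Expansion

variable {κ : Type*}

lemma abs_add_pow_three_le (a b : ℝ) : |a + b| ^ 3 ≤ 4 * (|a| ^ 3 + |b| ^ 3) := by
  have h := pow_le_pow_left₀ (abs_nonneg _) (abs_add_le a b) 3
  have ha := abs_nonneg a
  have hb := abs_nonneg b
  nlinarith [mul_nonneg (add_nonneg ha hb) (sq_nonneg (|a| - |b|))]

/-- Bound on the third derivative of a smooth function of a log-partition function. -/
lemma abs_third_deriv_gibbs_le {s : Finset κ} (hs : s.Nonempty) (E : κ → ℝ) {W x₁ x₂ x₃ : κ → ℝ}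
    {Q S k : ℝ} (hW0 : ∀ w ∈ s, 0 ≤ W w) (hQ0 : 0 ≤ Q)
    (hb1 : ∀ w ∈ s, |x₁ w| ≤ Q * W w) (hb2 : ∀ w ∈ s, |x₂ w| ≤ Q ^ 2 * W w ^ 2)
    (hb3 : ∀ w ∈ s, |x₃ w| ≤ Q ^ 3 * W w ^ 3) (hS0 : 0 ≤ S) (hS1 : S ≤ 1) (hk : |k| ≤ 1) :
    |k ^ 3 * (S * (1 - S) * (1 - 6 * S + 6 * S ^ 2)) * gibbs s E x₁ ^ 3 +
      3 * (k ^ 2 * (S * (1 - S) * (1 - 2 * S))) * gibbs s E x₁ *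
        (gibbs s E (fun w => x₁ w ^ 2 + x₂ w) - gibbs s E x₁ ^ 2) +
      k * (S * (1 - S)) * (gibbs s E (fun w => x₁ w ^ 3 + 3 * x₁ w * x₂ w + x₃ w) -
        3 * gibbs s E (fun w => x₁ w ^ 2 + x₂ w) * gibbs s E x₁ + 2 * gibbs s E x₁ ^ 3)| ≤
      23 * |k| * (Q ^ 3 * gibbs s E (fun w => W w ^ 3)) := by
  obtain ⟨j1, j2⟩ := gibbs_mul_sq_le hs E hW0
  have j3 : gibbs s E W ^ 2 ≤ gibbs s E (fun w => W w ^ 2) := by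
    have h : gibbs s E (fun w => 2 * gibbs s E W * W w + -gibbs s E W ^ 2) ≤
      gibbs s E (fun w => W w ^ 2) := gibbs_mono _ fun w _ => by
          nlinarith [sq_nonneg (W w - gibbs s E W)]
    rw [gibbs_add, gibbs_const_mul, gibbs_const hs] at h
    nlinarith
  have A1 : |gibbs s E x₁| ≤ Q * gibbs s E W :=
    (abs_gibbs_le s _ _).trans ((gibbs_mono _ hb1).trans (gibbs_const_mul _ _ _ _).le)
  -- The second moment costs 2, the third costs 1 + 3 + 1 = 5. The cumulants then cost 2 + 1 = 3 and
  -- 5 + 6 + 2 = 13, the constants of `abs_third_deriv_le`.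
  have E1 : |gibbs s E (fun w => x₁ w ^ 2 + x₂ w)| ≤ 2 * Q ^ 2 * gibbs s E (fun w => W w ^ 2) := by
    refine (abs_gibbs_le s _ _).trans ?_
    refine (gibbs_mono _ (ψ := fun w => 2 * Q ^ 2 * W w ^ 2) fun w hw => ?_).trans
      (gibbs_const_mul _ _ _ _).le
    have h1 := pow_le_pow_left₀ (abs_nonneg _) (hb1 w hw) 2
    have h2 := hb2 w hw
    refine (abs_add_le _ _).trans ?_
    rw [abs_pow]
    rw [mul_pow] at h1
    linarith
  have E2 : |gibbs s E (fun w => x₁ w ^ 3 + 3 * x₁ w * x₂ w + x₃ w)| ≤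
      5 * Q ^ 3 * gibbs s E (fun w => W w ^ 3) := by
    refine (abs_gibbs_le s _ _).trans ?_
    refine (gibbs_mono _ (ψ := fun w => 5 * Q ^ 3 * W w ^ 3) fun w hw => ?_).trans
      (gibbs_const_mul _ _ _ _).le
    have i1 := pow_le_pow_left₀ (abs_nonneg _) (hb1 w hw) 3
    have i2 : |x₁ w| * |x₂ w| ≤ (Q * W w) * (Q ^ 2 * W w ^ 2) :=
      mul_le_mul (hb1 w hw) (hb2 w hw) (abs_nonneg _) (mul_nonneg hQ0 (hW0 w hw))
    have i3 := hb3 w hw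
    have e2 : |3 * x₁ w * x₂ w| = 3 * (|x₁ w| * |x₂ w|) := by
      rw [abs_mul, abs_mul, abs_of_pos (by norm_num : (0 : ℝ) < 3)]; ring
    refine (abs_add_three _ _ _).trans ?_
    rw [abs_pow, e2]
    rw [mul_pow] at i1
    have e3 : (Q * W w) * (Q ^ 2 * W w ^ 2) = Q ^ 3 * W w ^ 3 := by ring
    rw [e3] at i2
    linarith
  generalize gibbs s E (fun w => x₁ w ^ 3 + 3 * x₁ w * x₂ w + x₃ w) = F at *
  generalize gibbs s E (fun w => x₁ w ^ 2 + x₂ w) = D at *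
  generalize gibbs s E x₁ = A at *
  have hm10 : 0 ≤ gibbs s E W := gibbs_nonneg _ hW0
  have hm20 : 0 ≤ gibbs s E (fun w => W w ^ 2) := gibbs_nonneg _ fun w _ => sq_nonneg _
  generalize gibbs s E W = m₁ at *
  generalize gibbs s E (fun w => W w ^ 2) = m₂ at *
  generalize gibbs s E (fun w => W w ^ 3) = m₃ at *
  have A2 : |A| ^ 2 ≤ Q ^ 2 * m₂ := by
    calc |A| ^ 2 ≤ (Q * m₁) ^ 2 := pow_le_pow_left₀ (abs_nonneg _) A1 2
      _ = Q ^ 2 * m₁ ^ 2 := by ring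
      _ ≤ _ := by gcongr
  have i1 : |D| * |A| ≤ 2 * (Q ^ 3 * m₃) := by
    calc |D| * |A| ≤ (2 * Q ^ 2 * m₂) * (Q * m₁) := by gcongr
      _ = 2 * (Q ^ 3 * (m₁ * m₂)) := by ring
      _ ≤ _ := by gcongr
  have i2 : |A| ^ 3 ≤ Q ^ 3 * m₃ := by
    calc |A| ^ 3 ≤ (Q * m₁) ^ 3 := pow_le_pow_left₀ (abs_nonneg _) A1 3
      _ = Q ^ 3 * m₁ ^ 3 := by ring
      _ ≤ _ := by gcongr
  refine abs_third_deriv_le hS0 hS1 hk hQ0 hm10 A1 ?_ j1 j2 ?_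
  · refine (abs_sub _ _).trans ?_
    rw [abs_pow]
    linarith
  · have e1 : |3 * D * A| = 3 * (|D| * |A|) := by
      rw [abs_mul, abs_mul, abs_of_pos (by norm_num : (0 : ℝ) < 3)]; ring
    have e2 : |2 * A ^ 3| = 2 * |A| ^ 3 := by
      rw [abs_mul, abs_pow, abs_of_pos (by norm_num : (0 : ℝ) < 2)]
    refine (abs_add_le _ _).trans ((add_le_add_left (abs_sub _ _) _).trans ?_)
    rw [e1, e2]
    linarith

/-- Expansion of a smooth function of the soft minimum when one summand of the design is switched
on. The first two orders are exact polynomials in the perturbation, with coefficients which do not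
depend on it. -/
lemma exists_expansion {g g₁ g₂ g₃ V : ℝ → ℝ} {c C : ℝ} (hg : IsTame g g₁ g₂ g₃ V c C)
    {s : Finset κ} (hs : s.Nonempty) {θ k : ℝ} (m : ℝ) (hθ : 1 ≤ θ) (hk : |k| ≤ 1) (r a : κ → ℝ) :
    ∃ (u : κ → ℝ) (v : κ → κ → ℝ), ∀ (b : κ → ℝ) (B : ℝ), (∀ w ∈ s, |b w| ≤ B) →
      |Real.sigmoid (k * Real.log (partitionFn s fun w => r w + θ * g (a w + b w)) + m) -
        Real.sigmoid (k * Real.log (partitionFn s fun w => r w + θ * g (a w)) + m) -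
        (∑ w ∈ s, u w * b w + ∑ w ∈ s, ∑ w' ∈ s, v w w' * (b w * b w'))| ≤
      23 * |k| * ((θ * C * B) ^ 3 *
        (C * (1 + 4 * c * (gibbs s r (fun w => |a w| ^ 3) + B ^ 3)))) := by
  classical
  set S₀ := Real.sigmoid (k * Real.log (partitionFn s fun w => r w + θ * g (a w)) + m) with hS₀
  set Z₀ := partitionFn s fun w => r w + θ * g (a w) with hZ₀
  set q : κ → ℝ := fun w => Real.exp (-(r w + θ * g (a w))) / Z₀ with hq
  set h₁ := k * (S₀ * (1 - S₀)) with hh₁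
  set h₂ := k ^ 2 * (S₀ * (1 - S₀) * (1 - 2 * S₀)) with hh₂
  -- The coefficients are read off from f₁(0) = h₁A and f₂(0)/2 = ((h₂ − h₁)A² + h₁D)/2, where A and
  -- D are the Gibbs averages of x₁ and of x₁² + x₂ at t = 0. The diagonal `if` encodes D, a single
  -- sum.
  refine ⟨fun w => h₁ * (q w * (-θ * g₁ (a w))), fun w w' =>
    (h₂ - h₁) / 2 * ((q w * (-θ * g₁ (a w))) * (q w' * (-θ * g₁ (a w')))) +
    if w = w' then h₁ / 2 * (q w * ((-θ * g₁ (a w)) ^ 2 + -θ * g₂ (a w))) else 0, ?_⟩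
  intro b B hb
  have hC := hg.one_le
  have hB : 0 ≤ B := by
    obtain ⟨w, hw⟩ := hs
    exact (abs_nonneg _).trans (hb w hw)
  -- the energies and their derivatives along the segment
  set e : κ → ℝ → ℝ := fun w t => Real.exp (-(r w + θ * g (a w + t * b w))) with he
  set x₁ : κ → ℝ → ℝ := fun w t => -θ * g₁ (a w + t * b w) * b w with hx₁
  set x₂ : κ → ℝ → ℝ := fun w t => -θ * g₂ (a w + t * b w) * b w ^ 2 with hx₂
  set x₃ : κ → ℝ → ℝ := fun w t => -θ * g₃ (a w + t * b w) * b w ^ 3 with hx₃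
  have hline : ∀ w t, HasDerivAt (fun t => a w + t * b w) (b w) t := fun w t => by
    simpa using ((hasDerivAt_id t).mul_const (b w)).const_add (a w)
  have de : ∀ w t, HasDerivAt (e w) (e w t * x₁ w t) t := by
    intro w t
    have h := ((((hg.deriv₁ (a w + t * b w)).comp t (hline w t)).const_mul θ).const_add (r w)).neg.exp
    refine h.congr_deriv ?_
    simp only [he, hx₁, Function.comp, Pi.neg_apply]
    ring
  have d1 : ∀ w t, HasDerivAt (x₁ w) (x₂ w t) t := by
    intro w t
    refine ((((hg.deriv₂ (a w + t * b w)).comp t (hline w t)).const_mul (-θ)).mul_const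
      (b w)).congr_deriv ?_
    simp only [hx₂]; ring
  have d2 : ∀ w t, HasDerivAt (x₂ w) (x₃ w t) t := by
    intro w t
    refine ((((hg.deriv₃ (a w + t * b w)).comp t (hline w t)).const_mul (-θ)).mul_const
      (b w ^ 2)).congr_deriv ?_
    simp only [hx₃]; ring
  set Z : ℝ → ℝ := fun t => ∑ w ∈ s, e w t with hZ
  set Z₁ : ℝ → ℝ := fun t => ∑ w ∈ s, e w t * x₁ w t with hZ₁
  set Z₂ : ℝ → ℝ := fun t => ∑ w ∈ s, e w t * (x₁ w t ^ 2 + x₂ w t) with hZ₂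
  set Z₃ : ℝ → ℝ := fun t => ∑ w ∈ s, e w t * (x₁ w t ^ 3 + 3 * x₁ w t * x₂ w t + x₃ w t) with hZ₃
  have D1 : ∀ t, HasDerivAt Z (Z₁ t) t := fun t => HasDerivAt.fun_sum fun w _ => de w t
  have D2 : ∀ t, HasDerivAt Z₁ (Z₂ t) t := fun t => by
    refine HasDerivAt.fun_sum fun w _ => ?_
    refine ((de w t).mul (d1 w t)).congr_deriv ?_
    ring
  have D3 : ∀ t, HasDerivAt Z₂ (Z₃ t) t := fun t => by
    refine HasDerivAt.fun_sum fun w _ => ?_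
    refine ((de w t).mul (((d1 w t).pow 2).add (d2 w t))).congr_deriv ?_
    simp only [Pi.add_apply, Pi.pow_apply]
    push_cast
    ring
  have hZpos : ∀ t, 0 < Z t := fun t => Finset.sum_pos (fun _ _ => Real.exp_pos _) hs
  obtain ⟨f₁, f₂, f₃, F1, F2, F3, hf⟩ := exists_derivs_sigmoid_log hZpos k m D1 D2 D3
  have key := abs_taylor_two_le (C := 23 * |k| * ((θ * C * B) ^ 3 *
        (C * (1 + 4 * c * (gibbs s r (fun w => |a w| ^ 3) + B ^ 3))))) F1 F2 F3 ?_
  · obtain ⟨S, hS, e1, e2, -⟩ := hf 0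
    have z0 : Z 0 = Z₀ := by simp [hZ, hZ₀, he, partitionFn]
    have hSS : S = S₀ := by rw [hS, hS₀, z0]
    have q0 : ∀ w, e w 0 / Z 0 = q w := fun w => by simp [he, hq, z0]
    have y1 : Z₁ 0 / Z 0 = ∑ w ∈ s, q w * (-θ * g₁ (a w)) * b w := by
      rw [hZ₁, Finset.sum_div]
      refine Finset.sum_congr rfl fun w _ => ?_
      rw [← q0]; simp only [hx₁, zero_mul, add_zero]; ring
    have y2 : Z₂ 0 / Z 0 = ∑ w ∈ s, q w * ((-θ * g₁ (a w)) ^ 2 + -θ * g₂ (a w)) * b w ^ 2 := by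
      rw [hZ₂, Finset.sum_div]
      refine Finset.sum_congr rfl fun w _ => ?_
      rw [← q0]; simp only [hx₁, hx₂, zero_mul, add_zero]; ring
    refine le_trans (le_of_eq ?_) key
    congr 1
    have z1 : Z 1 = partitionFn s fun w => r w + θ * g (a w + b w) := by
      simp [hZ, he, partitionFn]
    simp only [z1, z0]
    rw [sub_sub (_ - _) (f₁ 0)]
    congr 1
    have sq : (Z₁ 0 / Z 0) ^ 2 = ∑ w ∈ s, ∑ w' ∈ s,
        ((q w * (-θ * g₁ (a w))) * (q w' * (-θ * g₁ (a w')))) * (b w * b w') := by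
      rw [y1, sq, Finset.sum_mul_sum]
      exact Finset.sum_congr rfl fun w _ => Finset.sum_congr rfl fun w' _ => by ring
    have dg : ∑ w ∈ s, ∑ w' ∈ s,
        (if w = w' then h₁ / 2 * (q w * ((-θ * g₁ (a w)) ^ 2 + -θ * g₂ (a w))) else 0) *
          (b w * b w') = h₁ / 2 * (Z₂ 0 / Z 0) := by
      rw [y2, Finset.mul_sum]
      refine Finset.sum_congr rfl fun w hw => ?_
      simp only [ite_mul, zero_mul, Finset.sum_ite_eq, hw, if_true]
      ring
    have l1 : ∑ w ∈ s, h₁ * (q w * (-θ * g₁ (a w))) * b w = h₁ * (Z₁ 0 / Z 0) := by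
      rw [y1, Finset.mul_sum]
      exact Finset.sum_congr rfl fun w _ => by ring
    simp only [add_mul, Finset.sum_add_distrib]
    rw [dg, l1]
    have q2 : ∑ w ∈ s, ∑ w' ∈ s, (h₂ - h₁) / 2 *
        ((q w * (-θ * g₁ (a w))) * (q w' * (-θ * g₁ (a w')))) * (b w * b w') =
        (h₂ - h₁) / 2 * (Z₁ 0 / Z 0) ^ 2 := by
      rw [sq, Finset.mul_sum]
      refine Finset.sum_congr rfl fun w _ => ?_
      rw [Finset.mul_sum]
      exact Finset.sum_congr rfl fun w' _ => by ring
    rw [q2, e1, e2, hSS]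
    ring
  · intro t ht
    obtain ⟨S, hS, -, -, e3⟩ := hf t
    rw [e3]
    set G : (κ → ℝ) → ℝ := gibbs s (fun w => r w + θ * g (a w + t * b w)) with hG
    set W : κ → ℝ := fun w => V (a w + t * b w) with hW
    have hW0 : ∀ w ∈ s, 0 ≤ W w := fun w _ => hg.V_nonneg _
    set Q := θ * C * B with hQ
    -- Differentiating the loss twice or three times produces only one factor θC; since θC ≥ 1 it is
    -- bounded by (θC)² or (θC)³, so that all three bounds take the form of powers of Q times W.
    have hθC : 1 ≤ θ * C := by nlinarith
    have hQ0 : 0 ≤ Q := by positivity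
    have hb1 : ∀ w ∈ s, |x₁ w t| ≤ Q * W w := fun w hw => by
      simp only [hx₁, abs_mul, abs_neg, abs_of_nonneg (zero_le_one.trans hθ)]
      calc θ * |g₁ (a w + t * b w)| * |b w| ≤ θ * (C * W w) * B := by
            have := hg.bound₁ (a w + t * b w)
            have h0 := hW0 w hw
            gcongr
            exact hb w hw
        _ = _ := by ring
    have hb2 : ∀ w ∈ s, |x₂ w t| ≤ Q ^ 2 * W w ^ 2 := fun w hw => by
      simp only [hx₂, abs_mul, abs_neg, abs_of_nonneg (zero_le_one.trans hθ), abs_pow]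
      calc θ * |g₂ (a w + t * b w)| * |b w| ^ 2 ≤ θ * (C * W w ^ 2) * B ^ 2 := by
            have := hg.bound₂ (a w + t * b w)
            have h0 := hW0 w hw
            gcongr
            exact hb w hw
        _ = (θ * C) * (B ^ 2 * W w ^ 2) := by ring
        _ ≤ (θ * C) ^ 2 * (B ^ 2 * W w ^ 2) := by
            gcongr
            nlinarith
        _ = _ := by ring
    have hb3 : ∀ w ∈ s, |x₃ w t| ≤ Q ^ 3 * W w ^ 3 := fun w hw => by
      simp only [hx₃, abs_mul, abs_neg, abs_of_nonneg (zero_le_one.trans hθ), abs_pow]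
      calc θ * |g₃ (a w + t * b w)| * |b w| ^ 3 ≤ θ * (C * W w ^ 3) * B ^ 3 := by
            have := hg.bound₃ (a w + t * b w)
            have h0 := hW0 w hw
            gcongr
            exact hb w hw
        _ = (θ * C) * (B ^ 3 * W w ^ 3) := by ring
        _ ≤ (θ * C) ^ 3 * (B ^ 3 * W w ^ 3) := by
            have h0 := hW0 w hw
            refine mul_le_mul_of_nonneg_right ?_ (by positivity)
            exact le_self_pow₀ hθC (by norm_num)
        _ = _ := by ring
    have bound := abs_third_deriv_gibbs_le hs (fun w => r w + θ * g (a w + t * b w)) hW0 hQ0 hb1 hb2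
      hb3 (S := S) (by rw [hS]; exact Real.sigmoid_nonneg _) (by rw [hS]; exact Real.sigmoid_le_one _)
      hk
    refine bound.trans ?_
    refine mul_le_mul_of_nonneg_left (mul_le_mul_of_nonneg_left ?_ (by positivity))
      (by positivity)
    -- association, then the growth of the weight
    have assoc : G (fun w => W w ^ 3) ≤ gibbs s r (fun w => W w ^ 3) := by
      refine gibbs_add_energy_le hs r _ _ fun w _ w' _ => ?_
      rw [← mul_sub, mul_assoc]
      exact mul_nonneg (by linarith) (hg.comono _ _)
    refine assoc.trans ?_
    have hc := hg.c_nonneg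
    have gr : gibbs s r (fun w => W w ^ 3) ≤
        gibbs s r (fun w => 4 * C * c * |a w| ^ 3 + (C + 4 * C * c * B ^ 3)) := by
      refine gibbs_mono r fun w hw => (hg.growth _).trans ?_
      have h1 := abs_add_pow_three_le (a w) (t * b w)
      have h2 : |t * b w| ^ 3 ≤ B ^ 3 := by
        refine pow_le_pow_left₀ (abs_nonneg _) ?_ 3
        rw [abs_mul, abs_of_nonneg ht.1]
        have := hb w hw
        nlinarith [ht.2, abs_nonneg (b w)]
      calc C * (1 + c * |a w + t * b w| ^ 3) ≤ C * (1 + c * (4 * (|a w| ^ 3 + B ^ 3))) := by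
            gcongr
            linarith
        _ = _ := by ring
    refine gr.trans (le_of_eq ?_)
    rw [gibbs_add, gibbs_const_mul, gibbs_const hs]
    ring

end Expansion

/-! ### Replacing factors of a product measure one at a time -/

section ProductMeasure

variable {ι : Type*} [Fintype ι] [DecidableEq ι] {E : Type*} [MeasurableSpace E]

lemma measurable_update_prod (c : ι) :
    Measurable fun z : E × (ι → E) => Function.update z.2 c z.1 := by
  refine measurable_pi_iff.2 fun i => ?_
  rcases eq_or_ne i c with rfl | h
  · simpa using measurable_fst
  · simp only [Function.update_of_ne h]
    fun_prop

/-- Changing one factor amounts to overwriting that coordinate by an independent draw; the old value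
is discarded. The replacement thus becomes an inner integral over one cell with all others frozen.
-/
lemma pi_update_eq_map (m : ι → Measure E) [∀ i, IsProbabilityMeasure (m i)] (c : ι)
    (μ : Measure E) [IsProbabilityMeasure μ] :
    Measure.pi (Function.update m c μ) =
      (μ.prod (Measure.pi m)).map fun z => Function.update z.2 c z.1 := by
  have : ∀ i, IsProbabilityMeasure (Function.update m c μ i) := fun i => by
    rcases eq_or_ne i c with rfl | h
    · simpa using ‹IsProbabilityMeasure μ›
    · simpa [h] using inferInstanceAs (IsProbabilityMeasure (m i))
  have hmeas := measurable_update_prod (E := E) c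
  refine Measure.pi_eq fun s hs => ?_
  rw [Measure.map_apply hmeas (MeasurableSet.univ_pi hs)]
  have hpre : (fun z : E × (ι → E) => Function.update z.2 c z.1) ⁻¹' Set.pi Set.univ s =
      s c ×ˢ Set.pi Set.univ (Function.update s c Set.univ) := by
    ext z
    simp only [Set.mem_preimage, Set.mem_pi, Set.mem_univ, true_implies, Set.mem_prod]
    constructor
    · intro h
      refine ⟨by simpa using h c, fun i => ?_⟩
      rcases eq_or_ne i c with rfl | hi
      · simp
      · simpa [hi] using h i
    · rintro ⟨h1, h2⟩ i
      rcases eq_or_ne i c with rfl | hi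
      · simpa using h1
      · simpa [hi] using h2 i
  rw [hpre, Measure.prod_prod, Measure.pi_pi,
    ← Finset.mul_prod_erase Finset.univ (fun i => Function.update m c μ i (s i)) (Finset.mem_univ c),
    ← Finset.mul_prod_erase Finset.univ (fun i => m i (Function.update s c Set.univ i))
      (Finset.mem_univ c)]
  simp only [Function.update_self, measure_univ, one_mul]
  congr 1
  refine Finset.prod_congr rfl fun i hi => ?_
  simp [(Finset.mem_erase.1 hi).1]

lemma integral_pi_update (m : ι → Measure E) [∀ i, IsProbabilityMeasure (m i)] (c : ι)
    (μ : Measure E) [IsProbabilityMeasure μ] {f : (ι → E) → ℝ} (hf : Measurable f)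
    (hf1 : ∀ y, |f y| ≤ 1) :
    Integrable (fun y => ∫ x, f (Function.update y c x) ∂μ) (Measure.pi m) ∧
    ∫ y, f y ∂(Measure.pi (Function.update m c μ)) =
      ∫ y, ∫ x, f (Function.update y c x) ∂μ ∂(Measure.pi m) := by
  have hm := hf.comp (measurable_update_prod (E := E) c)
  have hi : Integrable (fun z : E × (ι → E) => f (Function.update z.2 c z.1))
      (μ.prod (Measure.pi m)) :=
    Integrable.of_bound hm.aestronglyMeasurable 1 (ae_of_all _ fun z => hf1 _)
  refine ⟨hi.integral_prod_right, ?_⟩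
  rw [pi_update_eq_map, integral_map (measurable_update_prod c).aemeasurable hf.aestronglyMeasurable,
    integral_prod_symm _ hi]

/-- Replacing one factor of a product measure. -/
lemma abs_integral_pi_update_sub_le (m : ι → Measure E) [∀ i, IsProbabilityMeasure (m i)] (c : ι)
    (μ ν : Measure E) [IsProbabilityMeasure μ] [IsProbabilityMeasure ν] {f : (ι → E) → ℝ}
    (hf : Measurable f) (hf1 : ∀ y, |f y| ≤ 1) {q : (ι → E) → ℝ}
    (hq : Integrable q (Measure.pi m))
    (h : ∀ y, |∫ x, f (Function.update y c x) ∂μ - ∫ x, f (Function.update y c x) ∂ν| ≤ q y) :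
    |∫ y, f y ∂(Measure.pi (Function.update m c μ)) -
      ∫ y, f y ∂(Measure.pi (Function.update m c ν))| ≤ ∫ y, q y ∂(Measure.pi m) := by
  obtain ⟨i1, e1⟩ := integral_pi_update m c μ hf hf1
  obtain ⟨i2, e2⟩ := integral_pi_update m c ν hf hf1
  rw [e1, e2, ← integral_sub i1 i2]
  exact (abs_integral_le_integral_abs).trans (integral_mono (i1.sub i2).abs hq h)

/-- Lindeberg's telescoping sum: replacing the factors of a product measure one by one. -/
lemma abs_integral_pi_sub_le_sum (μ ν : ι → Measure E) [∀ i, IsProbabilityMeasure (μ i)]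
    [∀ i, IsProbabilityMeasure (ν i)] (f : (ι → E) → ℝ) (err : ι → ℝ)
    (h : ∀ (c : ι) (m : ι → Measure E), (∀ i, m i = μ i ∨ m i = ν i) →
      |∫ y, f y ∂(Measure.pi (Function.update m c (μ c))) -
        ∫ y, f y ∂(Measure.pi (Function.update m c (ν c)))| ≤ err c) :
    |∫ y, f y ∂(Measure.pi μ) - ∫ y, f y ∂(Measure.pi ν)| ≤ ∑ c, err c := by
  -- T is the set of factors already replaced.
  have key : ∀ T : Finset ι, |∫ y, f y ∂(Measure.pi μ) -
      ∫ y, f y ∂(Measure.pi fun i => if i ∈ T then ν i else μ i)| ≤ ∑ c ∈ T, err c := by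
    intro T
    induction T using Finset.induction_on with
    | empty => simp
    | insert c T hc ih =>
      rw [Finset.sum_insert hc, add_comm]
      have h1 := h c (fun i => if i ∈ T then ν i else μ i) fun i => by
        by_cases hi : i ∈ T <;> simp [hi]
      have e1 : Function.update (fun i => if i ∈ T then ν i else μ i) c (μ c) =
          fun i => if i ∈ T then ν i else μ i := by
        refine Function.update_eq_iff.2 ⟨by simp [hc], fun _ _ => rfl⟩
      have e2 : Function.update (fun i => if i ∈ T then ν i else μ i) c (ν c) =
          fun i => if i ∈ insert c T then ν i else μ i := by
        refine Function.update_eq_iff.2 ⟨by simp, fun i hi => by simp [hi]⟩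
      rw [e1, e2] at h1
      exact (abs_sub_le _ _ _).trans (add_le_add ih h1)
  simpa using key Finset.univ

/-- Functions of disjoint sets of coordinates are independent for a product measure. -/
lemma indepFun_pi_of_disjoint [Zero E] (m : ι → Measure E) [∀ i, IsProbabilityMeasure (m i)]
    {S T : Finset ι} (hST : Disjoint S T) {F₁ F₂ : (ι → E) → ℝ} (h₁ : Measurable F₁)
    (h₂ : Measurable F₂) (hS : ∀ y y', (∀ c ∈ S, y c = y' c) → F₁ y = F₁ y')
    (hT : ∀ y y', (∀ c ∈ T, y c = y' c) → F₂ y = F₂ y') :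
    IndepFun F₁ F₂ (Measure.pi m) := by
  have hind : iIndepFun (fun (i : ι) (ω : ι → E) => ω i) (Measure.pi m) :=
    iIndepFun_pi (X := fun _ => id) fun _ => aemeasurable_id
  have h := hind.indepFun_finset S T hST fun i => measurable_pi_apply i
  -- Extension by zero expresses F₁ and F₂ as functions of the restricted families, to which
  -- independence of finite subfamilies applies.
  have ext_meas : ∀ U : Finset ι, Measurable fun (z : U → E) (c : ι) =>
      if hc : c ∈ U then z ⟨c, hc⟩ else 0 := by
    intro U
    refine measurable_pi_iff.2 fun c => ?_
    by_cases hc : c ∈ U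
    · simpa [hc] using measurable_pi_apply _
    · simp [hc]
  have := h.comp (h₁.comp (ext_meas S)) (h₂.comp (ext_meas T))
  convert this using 1
  · ext y
    exact hS _ _ fun c hc => by simp [hc]
  · ext y
    exact hT _ _ fun c hc => by simp [hc]

end ProductMeasure

/-! ### Fourth moments of independent sums -/

section Moments

variable {Ω : Type*} [MeasurableSpace Ω] {P : Measure Ω} [IsProbabilityMeasure P]

lemma MemLp.integrable_pow_of_le {f : Ω → ℝ} {q : ENNReal} (hf : MemLp f q P) {k : ℕ}
    (hk : (k : ENNReal) ≤ q) : Integrable (fun x => f x ^ k) P := by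
  have h := (hf.mono_exponent hk).integrable_norm_pow'
  refine h.mono' (hf.1.pow k) (ae_of_all _ fun x => ?_)
  simp

lemma integral_add_five {f₁ f₂ f₃ f₄ f₅ : Ω → ℝ} (h₁ : Integrable f₁ P) (h₂ : Integrable f₂ P)
    (h₃ : Integrable f₃ P) (h₄ : Integrable f₄ P) (h₅ : Integrable f₅ P) :
    ∫ ω, f₁ ω + f₂ ω + f₃ ω + f₄ ω + f₅ ω ∂P =
      ∫ ω, f₁ ω ∂P + ∫ ω, f₂ ω ∂P + ∫ ω, f₃ ω ∂P + ∫ ω, f₄ ω ∂P + ∫ ω, f₅ ω ∂P := by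
  have h12 : Integrable (fun ω => f₁ ω + f₂ ω) P := h₁.add h₂
  have h123 : Integrable (fun ω => f₁ ω + f₂ ω + f₃ ω) P := h12.add h₃
  have h1234 : Integrable (fun ω => f₁ ω + f₂ ω + f₃ ω + f₄ ω) P := h123.add h₄
  rw [integral_add h1234 h₅, integral_add h123 h₄, integral_add h12 h₃, integral_add h₁ h₂]

/-- Fourth moment of a sum of independent centered random variables. -/
lemma integral_sum_pow_four_le {ι : Type*} {Z : ι → Ω → ℝ} (hZ : iIndepFun Z P)
    (hm : ∀ i, Measurable (Z i)) (S : Finset ι) (hL : ∀ i ∈ S, MemLp (Z i) 4 P)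
    (h0 : ∀ i ∈ S, ∫ ω, Z i ω ∂P = 0) :
    MemLp (fun ω => ∑ i ∈ S, Z i ω) 4 P ∧
    ∫ ω, (∑ i ∈ S, Z i ω) ^ 2 ∂P = ∑ i ∈ S, ∫ ω, Z i ω ^ 2 ∂P ∧
    ∫ ω, (∑ i ∈ S, Z i ω) ^ 4 ∂P ≤
      3 * (∑ i ∈ S, ∫ ω, Z i ω ^ 2 ∂P) ^ 2 + ∑ i ∈ S, ∫ ω, Z i ω ^ 4 ∂P := by
  classical
  induction S using Finset.induction_on with
  | empty => simp
  | insert c S hc ih =>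
    obtain ⟨iL, i2, i4⟩ := ih (fun i hi => hL i (Finset.mem_insert_of_mem hi))
      (fun i hi => h0 i (Finset.mem_insert_of_mem hi))
    have hLc := hL c (Finset.mem_insert_self _ _)
    have h0c := h0 c (Finset.mem_insert_self _ _)
    set U : Ω → ℝ := fun ω => ∑ i ∈ S, Z i ω with hU
    have hUZ : IndepFun U (Z c) P := by
      have := hZ.indepFun_finsetSum_of_notMem hm hc
      convert this using 1
      ext ω; simp [hU]
    have hZU : ∀ k l : ℕ, k ≤ 4 → l ≤ 4 → Integrable (fun ω => U ω ^ k * Z c ω ^ l) P ∧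
        ∫ ω, U ω ^ k * Z c ω ^ l ∂P = (∫ ω, U ω ^ k ∂P) * ∫ ω, Z c ω ^ l ∂P := by
      intro k l hk hl
      have ik : Integrable (fun ω => U ω ^ k) P :=
        MemLp.integrable_pow_of_le iL (by exact_mod_cast hk)
      have il : Integrable (fun ω => Z c ω ^ l) P :=
        MemLp.integrable_pow_of_le hLc (by exact_mod_cast hl)
      have hind : IndepFun (fun ω => U ω ^ k) (fun ω => Z c ω ^ l) P :=
        hUZ.comp (measurable_id.pow_const k) (measurable_id.pow_const l)
      exact ⟨hind.integrable_mul ik il,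
        hind.integral_fun_mul_eq_mul_integral ik.aestronglyMeasurable il.aestronglyMeasurable⟩
    have hU0 : ∫ ω, U ω ∂P = 0 := by
      rw [hU, integral_finsetSum]
      · exact Finset.sum_eq_zero fun i hi => h0 i (Finset.mem_insert_of_mem hi)
      · intro i hi
        exact (hL i (Finset.mem_insert_of_mem hi)).integrable (by norm_num)
    have hsum : ∀ ω, ∑ i ∈ insert c S, Z i ω = U ω + Z c ω := fun ω => by
      rw [Finset.sum_insert hc, add_comm]
    -- Trivial powers are kept so that every term is of the form U^k Z^l, to which the factorization
    -- `hZU` applies.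
    have e2 : ∀ ω, (U ω + Z c ω) ^ 2 =
        U ω ^ 2 * Z c ω ^ 0 + 2 * (U ω ^ 1 * Z c ω ^ 1) + U ω ^ 0 * Z c ω ^ 2 := fun ω => by ring
    have e4 : ∀ ω, (U ω + Z c ω) ^ 4 =
        U ω ^ 4 * Z c ω ^ 0 + 4 * (U ω ^ 3 * Z c ω ^ 1) + 6 * (U ω ^ 2 * Z c ω ^ 2) +
          4 * (U ω ^ 1 * Z c ω ^ 3) + U ω ^ 0 * Z c ω ^ 4 := fun ω => by ring
    have j2 : ∫ ω, (U ω + Z c ω) ^ 2 ∂P = ∫ ω, U ω ^ 2 ∂P + ∫ ω, Z c ω ^ 2 ∂P := by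
      simp_rw [e2]
      rw [integral_add, integral_add, integral_const_mul, (hZU 2 0 (by simp) (by simp)).2,
        (hZU 1 1 (by simp) (by simp)).2, (hZU 0 2 (by simp) (by simp)).2]
      · simp [hU0, h0c]
      · exact (hZU 2 0 (by simp) (by simp)).1
      · exact (hZU 1 1 (by simp) (by simp)).1.const_mul _
      · exact (hZU 2 0 (by simp) (by simp)).1.add ((hZU 1 1 (by simp) (by simp)).1.const_mul _)
      · exact (hZU 0 2 (by simp) (by simp)).1
    have j4 : ∫ ω, (U ω + Z c ω) ^ 4 ∂P = ∫ ω, U ω ^ 4 ∂P +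
        6 * ((∫ ω, U ω ^ 2 ∂P) * ∫ ω, Z c ω ^ 2 ∂P) + ∫ ω, Z c ω ^ 4 ∂P := by
      simp_rw [e4]
      have a1 := (hZU 4 0 (by simp) (by simp)).1
      have a2 := (hZU 3 1 (by simp) (by simp)).1.const_mul 4
      have a3 := (hZU 2 2 (by simp) (by simp)).1.const_mul 6
      have a4 := (hZU 1 3 (by simp) (by simp)).1.const_mul 4
      have a5 := (hZU 0 4 (by simp) (by simp)).1
      rw [integral_add_five a1 a2 a3 a4 a5,
        integral_const_mul, integral_const_mul, integral_const_mul,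
        (hZU 4 0 (by simp) (by simp)).2, (hZU 3 1 (by simp) (by simp)).2,
        (hZU 2 2 (by simp) (by simp)).2, (hZU 1 3 (by simp) (by simp)).2,
        (hZU 0 4 (by simp) (by simp)).2]
      simp [hU0, h0c]
    simp_rw [hsum]
    refine ⟨iL.add hLc, ?_, ?_⟩
    · rw [j2, i2, Finset.sum_insert hc, add_comm]
    · rw [j4, i2, Finset.sum_insert hc, Finset.sum_insert hc]
      -- The cross term 6ab is exactly the one in 3(a + b)², which closes the induction.
      have n2 : 0 ≤ ∫ ω, Z c ω ^ 2 ∂P := integral_nonneg fun _ => sq_nonneg _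
      nlinarith [sq_nonneg (∫ ω, Z c ω ^ 2 ∂P)]

end Moments

/-! ### Means of random Gibbs averages -/

section GibbsIntegral

variable {κ : Type*} {Ω : Type*} [MeasurableSpace Ω] {P : Measure Ω} [IsProbabilityMeasure P]

lemma gibbs_eq_sum_weights (s : Finset κ) (E φ : κ → ℝ) :
    gibbs s E φ = ∑ w ∈ s, Real.exp (-E w) / partitionFn s E * φ w := by
  unfold gibbs
  rw [Finset.sum_div]
  exact Finset.sum_congr rfl fun w _ => by ring

lemma measurable_partitionFn (s : Finset κ) {E : Ω → κ → ℝ}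
    (hE : ∀ w, Measurable fun ω => E ω w) : Measurable fun ω => partitionFn s (E ω) :=
  Finset.measurable_fun_sum s fun w _ => (hE w).neg.exp

/-- Mean of a random Gibbs average of quantities which are independent of the Gibbs weights. -/
lemma integral_gibbs_le {s : Finset κ} (hs : s.Nonempty) {E φ : Ω → κ → ℝ} {K : ℝ}
    (hE : ∀ w, Measurable fun ω => E ω w) (hφ : ∀ w ∈ s, Integrable (fun ω => φ ω w) P)
    (hK : ∀ w ∈ s, ∫ ω, φ ω w ∂P ≤ K)
    (hind : ∀ w ∈ s, IndepFun (fun ω => Real.exp (-E ω w) / partitionFn s (E ω))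
      (fun ω => φ ω w) P) :
    Integrable (fun ω => gibbs s (E ω) (φ ω)) P ∧ ∫ ω, gibbs s (E ω) (φ ω) ∂P ≤ K := by
  have hw0 : ∀ w, ∀ ω, 0 ≤ Real.exp (-E ω w) / partitionFn s (E ω) := fun w ω =>
    div_nonneg (Real.exp_pos _).le (partitionFn_pos hs _).le
  have hw1 : ∀ w ∈ s, ∀ ω, Real.exp (-E ω w) / partitionFn s (E ω) ≤ 1 := fun w hw ω => by
    rw [div_le_one (partitionFn_pos hs _)]
    exact Finset.single_le_sum (f := fun w => Real.exp (-E ω w))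
      (fun _ _ => (Real.exp_pos _).le) hw
  have hwm : ∀ w, Measurable fun ω => Real.exp (-E ω w) / partitionFn s (E ω) := fun w =>
    (hE w).neg.exp.div (measurable_partitionFn s hE)
  have hwi : ∀ w ∈ s, Integrable (fun ω => Real.exp (-E ω w) / partitionFn s (E ω)) P :=
    fun w hw => Integrable.of_bound (hwm w).aestronglyMeasurable 1 (ae_of_all _ fun ω => by
      rw [Real.norm_eq_abs, abs_of_nonneg (hw0 w ω)]; exact hw1 w hw ω)
  have hint : ∀ w ∈ s, Integrable
      (fun ω => Real.exp (-E ω w) / partitionFn s (E ω) * φ ω w) P := fun w hw =>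
    (hind w hw).integrable_mul (hwi w hw) (hφ w hw)
  simp_rw [gibbs_eq_sum_weights]
  refine ⟨integrable_finsetSum _ hint, ?_⟩
  rw [integral_finsetSum _ hint]
  calc ∑ w ∈ s, ∫ ω, Real.exp (-E ω w) / partitionFn s (E ω) * φ ω w ∂P
      ≤ ∑ w ∈ s, (∫ ω, Real.exp (-E ω w) / partitionFn s (E ω) ∂P) * K := by
        refine Finset.sum_le_sum fun w hw => ?_
        rw [(hind w hw).integral_fun_mul_eq_mul_integral (hwm w).aestronglyMeasurable
          (hφ w hw).aestronglyMeasurable]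
        exact mul_le_mul_of_nonneg_left (hK w hw) (integral_nonneg (hw0 w))
    _ = K := by
        rw [← Finset.sum_mul, ← integral_finsetSum _ hwi]
        have : ∀ ω, ∑ w ∈ s, Real.exp (-E ω w) / partitionFn s (E ω) = 1 := fun ω => by
          rw [← Finset.sum_div]
          exact div_self (partitionFn_pos hs _).ne'
        simp [this]

/-- Comparison of the means of a function with an expansion whose polynomial part has the same mean
for both measures. -/
lemma abs_integral_sub_le_of_expansion {μ ν : Measure Ω} [IsProbabilityMeasure μ]
    [IsProbabilityMeasure ν] {F Q D : Ω → ℝ} {F₀ d : ℝ} (hFμ : Integrable F μ)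
    (hFν : Integrable F ν) (hQμ : Integrable Q μ) (hQν : Integrable Q ν)
    (hQ : ∫ x, Q x ∂μ = ∫ x, Q x ∂ν) (hDμ : Integrable D μ) (hDν : Integrable D ν)
    (hdμ : ∫ x, D x ∂μ ≤ d) (hdν : ∫ x, D x ∂ν ≤ d) (h : ∀ x, |F x - F₀ - Q x| ≤ D x) :
    |∫ x, F x ∂μ - ∫ x, F x ∂ν| ≤ 2 * d := by
  have key : ∀ (m : Measure Ω) [IsProbabilityMeasure m], Integrable F m → Integrable Q m →
      Integrable D m → |∫ x, F x ∂m - F₀ - ∫ x, Q x ∂m| ≤ ∫ x, D x ∂m := by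
    intro m _ h1 h2 h3
    have hc : Integrable (fun _ : Ω => F₀) m := integrable_const _
    have e : ∫ x, (F x - F₀ - Q x) ∂m = ∫ x, F x ∂m - F₀ - ∫ x, Q x ∂m := by
      have h1c : Integrable (fun x => F x - F₀) m := h1.sub hc
      rw [integral_sub h1c h2, integral_sub h1 hc]
      simp
    rw [← e]
    exact abs_integral_le_integral_abs.trans (integral_mono ((h1.sub hc).sub h2).abs h3 h)
  have k1 := abs_le.1 (key μ hFμ hQμ hDμ)
  have k2 := abs_le.1 (key ν hFν hQν hDν)
  exact abs_le.2 ⟨by linarith [k1.1, k2.2], by linarith [k1.2, k2.1]⟩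

end GibbsIntegral

/-! ### Cell-wise Lindeberg comparison of the soft test function -/

section Lindeberg

variable {ι : Type*} [Fintype ι] [DecidableEq ι] {n p : ℕ}

/-- The design whose `i`-th row is the sum of the cells `c` with `row c = i`. -/
def assemble (row : ι → Fin n) (y : ι → Fin p → ℝ) (i : Fin n) (j : Fin p) : ℝ :=
  ∑ c, if row c = i then y c j else 0

/-- The rescaled regularized empirical risk, as an energy. -/
def energy (g : ℝ → ℝ) (θ : ℝ) (ρ : (Fin p → ℝ) → ℝ) (e : Fin n → ℝ) (A : Fin n → Fin p → ℝ)
    (w : Fin p → ℝ) : ℝ :=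
  ρ w + ∑ i, θ * g (A i ⬝ᵥ w - e i)

/-- A smooth test function of the soft minimum of the energy over the finite set `s`. -/
def softTest (s : Finset (Fin p → ℝ)) (g : ℝ → ℝ) (θ : ℝ) (ρ : (Fin p → ℝ) → ℝ) (k m : ℝ)
    (e : Fin n → ℝ) (A : Fin n → Fin p → ℝ) : ℝ :=
  Real.sigmoid (k * Real.log (partitionFn s (energy g θ ρ e A)) + m)

/-- Moment bounds for a family of laws of cells. -/
structure HasCellBounds (μ : ι → Measure (Fin p → ℝ)) (s : Finset (Fin p → ℝ))
    (B : (Fin p → ℝ) → ℝ) (c : ℝ) (v₂ v₄ b : ι → ℝ) : Prop where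
  isProb : ∀ i, IsProbabilityMeasure (μ i)
  memLp : ∀ i, ∀ w ∈ s, MemLp (fun x => x ⬝ᵥ w) 4 (μ i)
  mean : ∀ i, ∀ w ∈ s, ∫ x, x ⬝ᵥ w ∂(μ i) = 0
  sq_le : ∀ i, ∀ w ∈ s, ∫ x, (x ⬝ᵥ w) ^ 2 ∂(μ i) ≤ v₂ i
  four_le : ∀ i, ∀ w ∈ s, ∫ x, (x ⬝ᵥ w) ^ 4 ∂(μ i) ≤ v₄ i
  integrable_three : ∀ i, Integrable (fun x => B x ^ 3) (μ i)
  integrable_six : ∀ i, Integrable (fun x => c * B x ^ 6) (μ i)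
  three_le : ∀ i, ∫ x, B x ^ 3 ∂(μ i) ≤ b i
  six_le : ∀ i, ∫ x, c * B x ^ 6 ∂(μ i) ≤ b i

lemma continuous_dotProduct_right (w : Fin p → ℝ) : Continuous fun x : Fin p → ℝ => x ⬝ᵥ w :=
  continuous_finsetSum _ fun j _ => (continuous_apply j).mul continuous_const

lemma continuous_energy {g : ℝ → ℝ} (hg : Continuous g) (θ : ℝ) (ρ : (Fin p → ℝ) → ℝ)
    (w : Fin p → ℝ) :
    Continuous fun z : (Fin n → Fin p → ℝ) × (Fin n → ℝ) => energy g θ ρ z.2 z.1 w := by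
  unfold energy
  refine continuous_const.add (continuous_finsetSum _ fun i _ => continuous_const.mul
    (hg.comp (((continuous_dotProduct_right w).comp
      ((continuous_apply i).comp continuous_fst)).sub ((continuous_apply i).comp continuous_snd))))

lemma continuous_softTest {s : Finset (Fin p → ℝ)} (hs : s.Nonempty) {g : ℝ → ℝ}
    (hg : Continuous g) (θ : ℝ) (ρ : (Fin p → ℝ) → ℝ) (k m : ℝ) :
    Continuous fun z : (Fin n → Fin p → ℝ) × (Fin n → ℝ) => softTest s g θ ρ k m z.2 z.1 := by
  unfold softTest
  refine continuous_sigmoid.comp ((continuous_const.mul (Continuous.log ?_ fun z =>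
    (partitionFn_pos hs _).ne')).add continuous_const)
  exact continuous_finsetSum _ fun w _ => (continuous_energy hg θ ρ w).neg.rexp

lemma continuous_assemble (row : ι → Fin n) :
    Continuous (assemble row : (ι → Fin p → ℝ) → Fin n → Fin p → ℝ) := by
  refine continuous_pi fun i => continuous_pi fun j => continuous_finsetSum _ fun c _ => ?_
  by_cases h : row c = i
  · simp only [h, if_true]
    exact (continuous_apply j).comp (continuous_apply c)
  · simp only [h, if_false]
    exact continuous_const

lemma assemble_dotProduct (row : ι → Fin n) (y : ι → Fin p → ℝ) (i : Fin n) (w : Fin p → ℝ) :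
    assemble row y i ⬝ᵥ w = ∑ c with row c = i, y c ⬝ᵥ w := by
  simp only [assemble, dotProduct, Finset.sum_mul, ite_mul, zero_mul]
  rw [Finset.sum_comm, Finset.sum_filter]
  refine Finset.sum_congr rfl fun c _ => ?_
  by_cases h : row c = i <;> simp [h]

/-- Isolating the contribution of one cell to the energy. -/
lemma energy_update (g : ℝ → ℝ) (θ : ℝ) (ρ : (Fin p → ℝ) → ℝ) (e : Fin n → ℝ) (row : ι → Fin n)
    (y : ι → Fin p → ℝ) (c : ι) (x : Fin p → ℝ) (w : Fin p → ℝ) :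
    energy g θ ρ e (assemble row (Function.update y c x)) w =
      (ρ w + ∑ i ∈ Finset.univ.erase (row c), θ * g (assemble row y i ⬝ᵥ w - e i)) +
      θ * g ((∑ c' ∈ (Finset.univ.filter fun c' => row c' = row c).erase c, y c' ⬝ᵥ w) -
        e (row c) + x ⬝ᵥ w) := by
  unfold energy
  rw [← Finset.add_sum_erase _ _ (Finset.mem_univ (row c)), add_assoc]
  congr 1
  rw [add_comm]
  congr 1
  · refine Finset.sum_congr rfl fun i hi => ?_
    have hi' := (Finset.mem_erase.1 hi).1
    rw [assemble_dotProduct, assemble_dotProduct]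
    congr 3
    refine Finset.sum_congr rfl fun c' hc' => ?_
    have : c' ≠ c := by
      rintro rfl
      exact hi' (Finset.mem_filter.1 hc').2.symm
    rw [Function.update_of_ne this]
  · rw [assemble_dotProduct, ← Finset.add_sum_erase _ _ (show c ∈ Finset.univ.filter
      (fun c' => row c' = row c) by simp)]
    rw [Function.update_self]
    have : ∑ c' ∈ (Finset.univ.filter fun c' => row c' = row c).erase c,
        Function.update y c x c' ⬝ᵥ w =
        ∑ c' ∈ (Finset.univ.filter fun c' => row c' = row c).erase c, y c' ⬝ᵥ w := by
      refine Finset.sum_congr rfl fun c' hc' => ?_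
      rw [Function.update_of_ne (Finset.mem_erase.1 hc').1]
    rw [this]
    congr 2
    ring

/-- Mean of the leave-one-row-out Gibbs average of the cube of the residual. -/
lemma integral_gibbs_residual_le {s : Finset (Fin p → ℝ)} (hs : s.Nonempty) {g : ℝ → ℝ}
    (hg : Continuous g) (θ : ℝ) (ρ : (Fin p → ℝ) → ℝ) (e : Fin n → ℝ) (row : ι → Fin n)
    {m : ι → Measure (Fin p → ℝ)} {B : (Fin p → ℝ) → ℝ} {c₀ : ℝ} {v₂ v₄ b : ι → ℝ}
    (hm : HasCellBounds m s B c₀ v₂ v₄ b) {V₂ V₄ : ℝ}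
    (hV₂ : ∀ i, ∑ c with row c = i, v₂ c ≤ V₂) (hV₄ : ∀ i, ∑ c with row c = i, v₄ c ≤ V₄) (c : ι) :
    Integrable (fun y : ι → Fin p → ℝ => gibbs s
        (fun w => ρ w + ∑ i ∈ Finset.univ.erase (row c), θ * g (assemble row y i ⬝ᵥ w - e i))
        (fun w => |(∑ c' ∈ (Finset.univ.filter fun c' => row c' = row c).erase c, y c' ⬝ᵥ w) -
          e (row c)| ^ 3)) (Measure.pi m) ∧
    ∫ y, gibbs s
        (fun w => ρ w + ∑ i ∈ Finset.univ.erase (row c), θ * g (assemble row y i ⬝ᵥ w - e i))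
        (fun w => |(∑ c' ∈ (Finset.univ.filter fun c' => row c' = row c).erase c, y c' ⬝ᵥ w) -
          e (row c)| ^ 3) ∂(Measure.pi m) ≤
      4 * (1 + 3 * V₂ ^ 2 + V₄ + |e (row c)| ^ 3) := by
  have := hm.isProb
  set T := Finset.univ.filter fun c' => row c' = row c with hT
  set S := T.erase c with hS
  set r : (ι → Fin p → ℝ) → (Fin p → ℝ) → ℝ := fun y w =>
    ρ w + ∑ i ∈ Finset.univ.erase (row c), θ * g (assemble row y i ⬝ᵥ w - e i) with hr
  have hdot : ∀ (c' : ι) (w : Fin p → ℝ), Measurable fun y : ι → Fin p → ℝ => y c' ⬝ᵥ w :=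
    fun c' w => (continuous_dotProduct_right w).measurable.comp (measurable_pi_apply c')
  have hu : ∀ w, Measurable fun y : ι → Fin p → ℝ => ∑ c' ∈ S, y c' ⬝ᵥ w := fun w =>
    Finset.measurable_fun_sum _ fun c' _ => hdot c' w
  have hrm : ∀ w, Measurable fun y => r y w := fun w => by
    refine Continuous.measurable (continuous_const.add (continuous_finsetSum _ fun i _ =>
      continuous_const.mul (hg.comp (Continuous.sub ?_ continuous_const))))
    exact (continuous_dotProduct_right w).comp ((continuous_apply i).comp (continuous_assemble row))
  -- fourth moments
  have hfour : ∀ w ∈ s, MemLp (fun y : ι → Fin p → ℝ => ∑ c' ∈ S, y c' ⬝ᵥ w) 4 (Measure.pi m) ∧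
      ∫ y, (∑ c' ∈ S, (y : ι → Fin p → ℝ) c' ⬝ᵥ w) ^ 4 ∂(Measure.pi m) ≤ 3 * V₂ ^ 2 + V₄ := by
    intro w hw
    have hind : iIndepFun (fun (i : ι) (y : ι → Fin p → ℝ) => y i ⬝ᵥ w) (Measure.pi m) :=
      iIndepFun_pi (X := fun _ x => x ⬝ᵥ w)
        fun _ => (continuous_dotProduct_right w).measurable.aemeasurable
    have hmp : ∀ i, MeasurePreserving (Function.eval i) (Measure.pi m) (m i) :=
      fun i => measurePreserving_eval m i
    have hint : ∀ (i : ι) (f : (Fin p → ℝ) → ℝ), Measurable f →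
        ∫ y, f ((y : ι → Fin p → ℝ) i) ∂(Measure.pi m) = ∫ x, f x ∂(m i) := fun i f hf => by
      rw [← (hmp i).map_eq, integral_map (hmp i).measurable.aemeasurable hf.aestronglyMeasurable]
    have hdm := (continuous_dotProduct_right w).measurable
    obtain ⟨h1, -, h3⟩ := integral_sum_pow_four_le hind (fun i => hdot i w) S
      (fun i _ => (hm.memLp i w hw).comp_measurePreserving (hmp i))
      (fun i _ => (hint i (fun x => x ⬝ᵥ w) hdm).trans (hm.mean i w hw))
    refine ⟨h1, h3.trans ?_⟩
    have n2 : 0 ≤ ∑ i ∈ S, ∫ y, ((y : ι → Fin p → ℝ) i ⬝ᵥ w) ^ 2 ∂(Measure.pi m) :=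
      Finset.sum_nonneg fun i _ => integral_nonneg fun _ => sq_nonneg _
    have b2 : ∑ i ∈ S, ∫ y, ((y : ι → Fin p → ℝ) i ⬝ᵥ w) ^ 2 ∂(Measure.pi m) ≤ V₂ := by
      refine le_trans ?_ (hV₂ (row c))
      refine (Finset.sum_le_sum fun i _ => ?_).trans (Finset.sum_le_sum_of_subset_of_nonneg
        (Finset.erase_subset c T) fun i _ _ => ?_)
      · rw [hint i (fun x => (x ⬝ᵥ w) ^ 2) (hdm.pow_const 2)]
        exact hm.sq_le i w hw
      · exact (integral_nonneg fun _ => sq_nonneg _).trans (hm.sq_le i w hw)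
    have b4 : ∑ i ∈ S, ∫ y, ((y : ι → Fin p → ℝ) i ⬝ᵥ w) ^ 4 ∂(Measure.pi m) ≤ V₄ := by
      refine le_trans ?_ (hV₄ (row c))
      refine (Finset.sum_le_sum fun i _ => ?_).trans (Finset.sum_le_sum_of_subset_of_nonneg
        (Finset.erase_subset c T) fun i _ _ => ?_)
      · rw [hint i (fun x => (x ⬝ᵥ w) ^ 4) (hdm.pow_const 4)]
        exact hm.four_le i w hw
      · exact (integral_nonneg fun _ => by positivity).trans (hm.four_le i w hw)
    have := pow_le_pow_left₀ n2 b2 2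
    linarith
  -- independence of the weights and the residuals
  have hpow : ∀ w ∈ s, Integrable (fun y : ι → Fin p → ℝ =>
      4 * (1 + (∑ c' ∈ S, y c' ⬝ᵥ w) ^ 4 + |e (row c)| ^ 3)) (Measure.pi m) := fun w hw =>
    (((integrable_const _).add (MemLp.integrable_pow_of_le (hfour w hw).1 (by norm_num))).add
      (integrable_const _)).const_mul 4
  obtain ⟨hI, hle⟩ := integral_gibbs_le (P := Measure.pi m) hs (E := r)
    (φ := fun y w => 4 * (1 + (∑ c' ∈ S, y c' ⬝ᵥ w) ^ 4 + |e (row c)| ^ 3))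
    (K := 4 * (1 + 3 * V₂ ^ 2 + V₄ + |e (row c)| ^ 3)) hrm hpow (fun w hw => by
      rw [integral_const_mul]
      have i4 : Integrable (fun y : ι → Fin p → ℝ => (∑ c' ∈ S, y c' ⬝ᵥ w) ^ 4) (Measure.pi m) :=
        MemLp.integrable_pow_of_le (hfour w hw).1 (by norm_num)
      have i1 : Integrable (fun y : ι → Fin p → ℝ => 1 + (∑ c' ∈ S, y c' ⬝ᵥ w) ^ 4)
        (Measure.pi m) := (integrable_const _).add i4
      rw [integral_add i1 (integrable_const _), integral_add (integrable_const _) i4]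
      have := (hfour w hw).2
      simp only [integral_const, probReal_univ, smul_eq_mul, one_mul]
      linarith) (fun w hw => by
      -- The energy without this row depends only on the cells of the other rows, hence is
      -- independent of the residual built from T.
      have hagree : ∀ y y' : ι → Fin p → ℝ, (∀ c' ∈ Tᶜ, y c' = y' c') → r y = r y' := by
        intro y y' h
        funext w'
        simp only [hr]
        congr 1
        refine Finset.sum_congr rfl fun i hi => ?_
        rw [assemble_dotProduct, assemble_dotProduct]
        congr 3
        refine Finset.sum_congr rfl fun c' hc' => ?_
        rw [h c']
        simp only [hT, Finset.mem_compl, Finset.mem_filter, Finset.mem_univ, true_and]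
        rw [(Finset.mem_filter.1 hc').2]
        exact (Finset.mem_erase.1 hi).1
      refine indepFun_pi_of_disjoint m (S := Tᶜ) (T := S) ?_ ?_ ?_ ?_ ?_
      · exact disjoint_compl_left.mono_right (Finset.erase_subset _ _)
      · exact (hrm w).neg.exp.div (measurable_partitionFn s hrm)
      · exact ((((hu w).pow_const 4).const_add 1).add_const _).const_mul 4
      · intro y y' h
        rw [hagree y y' h]
      · intro y y' h
        have : ∑ c' ∈ S, y c' ⬝ᵥ w = ∑ c' ∈ S, y' c' ⬝ᵥ w :=
          Finset.sum_congr rfl fun c' hc' => by rw [h c' hc']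
        rw [this])
  -- The cube is dominated through |t|³ ≤ 1 + t⁴, because only the fourth moment of the sum has been
  -- computed.
  have hdom : ∀ y : ι → Fin p → ℝ, gibbs s (r y) (fun w => |(∑ c' ∈ S, y c' ⬝ᵥ w) -
      e (row c)| ^ 3) ≤ gibbs s (r y)
        (fun w => 4 * (1 + (∑ c' ∈ S, y c' ⬝ᵥ w) ^ 4 + |e (row c)| ^ 3)) := fun y =>
    gibbs_mono _ fun w _ => by
      have h := abs_add_pow_three_le (∑ c' ∈ S, y c' ⬝ᵥ w) (-e (row c))
      rw [abs_neg, ← sub_eq_add_neg] at h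
      set t := ∑ c' ∈ S, y c' ⬝ᵥ w
      have h2 : |t| ^ 3 ≤ 1 + t ^ 4 := by
        have ht : t ^ 4 = |t| ^ 4 := by rw [← abs_pow, abs_of_nonneg (by positivity)]
        rw [ht]
        have := abs_nonneg t
        nlinarith [sq_nonneg (|t| ^ 2 - |t|), sq_nonneg (|t| ^ 2 - 1), sq_nonneg (|t| - 1),
          sq_nonneg (|t| ^ 2)]
      linarith
  have hI' : Integrable (fun y => gibbs s (r y) (fun w => |(∑ c' ∈ S, y c' ⬝ᵥ w) -
      e (row c)| ^ 3)) (Measure.pi m) := by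
    refine hI.mono' ?_ (ae_of_all _ fun y => ?_)
    · refine Measurable.aestronglyMeasurable ?_
      unfold gibbs
      refine Measurable.div (Finset.measurable_fun_sum _ fun w _ => (hrm w).neg.exp.mul ?_)
        (measurable_partitionFn s hrm)
      exact (((hu w).sub_const _).abs).pow_const 3
    · rw [Real.norm_eq_abs, abs_of_nonneg (gibbs_nonneg _ fun _ _ => by positivity)]
      exact hdom y
  exact ⟨hI', (integral_mono hI' hI hdom).trans hle⟩

/-- Block-wise Lindeberg comparison for the smooth test function of the soft minimum. -/
theorem abs_integral_softTest_sub_le {g g₁ g₂ g₃ V : ℝ → ℝ} {c₀ C : ℝ}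
    (hg : IsTame g g₁ g₂ g₃ V c₀ C) {s : Finset (Fin p → ℝ)} (hs : s.Nonempty) {θ k : ℝ} (m : ℝ)
    (hθ : 1 ≤ θ) (hk : |k| ≤ 1) (ρ : (Fin p → ℝ) → ℝ) (e : Fin n → ℝ) (row : ι → Fin n)
    {μ ν : ι → Measure (Fin p → ℝ)} {B : (Fin p → ℝ) → ℝ} {v₂ v₄ b : ι → ℝ}
    (hμ : HasCellBounds μ s B c₀ v₂ v₄ b) (hν : HasCellBounds ν s B c₀ v₂ v₄ b)
    (hB : ∀ x, ∀ w ∈ s, |x ⬝ᵥ w| ≤ B x)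
    (hcov : ∀ c, ∀ w ∈ s, ∀ w' ∈ s,
      ∫ x, (x ⬝ᵥ w) * (x ⬝ᵥ w') ∂(μ c) = ∫ x, (x ⬝ᵥ w) * (x ⬝ᵥ w') ∂(ν c))
    {V₂ V₄ : ℝ} (hV₂ : ∀ i, ∑ c with row c = i, v₂ c ≤ V₂)
    (hV₄ : ∀ i, ∑ c with row c = i, v₄ c ≤ V₄) :
    |∫ y, softTest s g θ ρ k m e (assemble row y) ∂(Measure.pi μ) -
      ∫ y, softTest s g θ ρ k m e (assemble row y) ∂(Measure.pi ν)| ≤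
    ∑ c, 46 * |k| * (θ * C) ^ 3 * C * b c *
      (5 + 16 * c₀ * (1 + 3 * V₂ ^ 2 + V₄ + |e (row c)| ^ 3)) := by
  have := hμ.isProb
  have := hν.isProb
  have hC := hg.one_le
  have hc₀ := hg.c_nonneg
  have hgc : Continuous g := continuous_iff_continuousAt.2 fun t => (hg.deriv₁ t).continuousAt
  set f : (ι → Fin p → ℝ) → ℝ := fun y => softTest s g θ ρ k m e (assemble row y) with hf
  have hfm : Measurable f := ((continuous_softTest hs hgc θ ρ k m).comp
    ((continuous_assemble row).prodMk continuous_const)).measurable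
  have hf1 : ∀ y, |f y| ≤ 1 := fun y => abs_le.2
    ⟨by linarith [Real.sigmoid_nonneg (k * Real.log (partitionFn s (energy g θ ρ e
      (assemble row y))) + m), show f y = Real.sigmoid _ from rfl], Real.sigmoid_le_one _⟩
  refine abs_integral_pi_sub_le_sum μ ν f _ fun c M hM => ?_
  -- Both families obey the same bounds, so every hybrid met along the telescoping does too.
  have hMb : HasCellBounds M s B c₀ v₂ v₄ b := by
    constructor <;> intro i <;> rcases hM i with h | h <;> rw [h]
    exacts [hμ.isProb i, hν.isProb i, hμ.memLp i, hν.memLp i, hμ.mean i, hν.mean i, hμ.sq_le i,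
      hν.sq_le i, hμ.four_le i, hν.four_le i, hμ.integrable_three i, hν.integrable_three i,
      hμ.integrable_six i, hν.integrable_six i, hμ.three_le i, hν.three_le i, hμ.six_le i,
      hν.six_le i]
  have := hMb.isProb
  obtain ⟨hΨ, hΨle⟩ := integral_gibbs_residual_le hs hgc θ ρ e row hMb hV₂ hV₄ c
  set Ψ : (ι → Fin p → ℝ) → ℝ := fun y => gibbs s
    (fun w => ρ w + ∑ i ∈ Finset.univ.erase (row c), θ * g (assemble row y i ⬝ᵥ w - e i))
    (fun w => |(∑ c' ∈ (Finset.univ.filter fun c' => row c' = row c).erase c, y c' ⬝ᵥ w) -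
      e (row c)| ^ 3) with hΨdef
  have hΨ0 : ∀ y, 0 ≤ Ψ y := fun y => gibbs_nonneg _ fun _ _ => by positivity
  set K := 23 * |k| * (θ * C) ^ 3 * C with hK
  have hK0 : 0 ≤ K := by positivity
  have hqi : Integrable (fun y => 2 * (K * b c * (5 + 4 * c₀ * Ψ y))) (Measure.pi M) :=
    (((integrable_const _).add (hΨ.const_mul _)).const_mul _).const_mul _
  refine (abs_integral_pi_update_sub_le M c (μ c) (ν c) hfm hf1 hqi fun y => ?_).trans ?_
  · obtain ⟨u, v, huv⟩ := exists_expansion hg hs m hθ hk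
      (fun w => ρ w + ∑ i ∈ Finset.univ.erase (row c), θ * g (assemble row y i ⬝ᵥ w - e i))
      (fun w => (∑ c' ∈ (Finset.univ.filter fun c' => row c' = row c).erase c, y c' ⬝ᵥ w) -
        e (row c))
    have hFm : Measurable fun x => f (Function.update y c x) :=
      hfm.comp (measurable_update y)
    have hFi : ∀ (μ' : Measure (Fin p → ℝ)) [IsProbabilityMeasure μ'],
        Integrable (fun x => f (Function.update y c x)) μ' := fun μ' _ =>
      Integrable.of_bound hFm.aestronglyMeasurable 1 (ae_of_all _ fun z => hf1 _)
    have hL2 : ∀ (m' : ι → Measure (Fin p → ℝ)), HasCellBounds m' s B c₀ v₂ v₄ b → ∀ w ∈ s,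
        MemLp (fun x => x ⬝ᵥ w) 2 (m' c) := fun m' hm' w hw => by
      have := hm'.isProb c
      exact (hm'.memLp c w hw).mono_exponent (by norm_num)
    have hlin : ∀ (m' : ι → Measure (Fin p → ℝ)), HasCellBounds m' s B c₀ v₂ v₄ b → ∀ w ∈ s,
        Integrable (fun x => u w * (x ⬝ᵥ w)) (m' c) := fun m' hm' w hw => by
      have := hm'.isProb c
      exact ((hm'.memLp c w hw).integrable (by norm_num)).const_mul _
    have hquad : ∀ (m' : ι → Measure (Fin p → ℝ)), HasCellBounds m' s B c₀ v₂ v₄ b → ∀ w ∈ s,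
        ∀ w' ∈ s, Integrable (fun x => v w w' * ((x ⬝ᵥ w) * (x ⬝ᵥ w'))) (m' c) :=
      fun m' hm' w hw w' hw' =>
        ((hL2 m' hm' w hw).integrable_mul (hL2 m' hm' w' hw')).const_mul _
    have hQi : ∀ (m' : ι → Measure (Fin p → ℝ)), HasCellBounds m' s B c₀ v₂ v₄ b →
        Integrable (fun x => ∑ w ∈ s, u w * (x ⬝ᵥ w) +
          ∑ w ∈ s, ∑ w' ∈ s, v w w' * ((x ⬝ᵥ w) * (x ⬝ᵥ w'))) (m' c) := fun m' hm' =>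
      (integrable_finsetSum _ (hlin m' hm')).add (integrable_finsetSum _ fun w hw =>
        integrable_finsetSum _ (hquad m' hm' w hw))
    have hQ : ∀ (m' : ι → Measure (Fin p → ℝ)), HasCellBounds m' s B c₀ v₂ v₄ b →
        ∫ x, (∑ w ∈ s, u w * (x ⬝ᵥ w) +
          ∑ w ∈ s, ∑ w' ∈ s, v w w' * ((x ⬝ᵥ w) * (x ⬝ᵥ w'))) ∂(m' c) =
        ∑ w ∈ s, ∑ w' ∈ s, v w w' * ∫ x, (x ⬝ᵥ w) * (x ⬝ᵥ w') ∂(m' c) := fun m' hm' => by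
      rw [integral_add (integrable_finsetSum _ (hlin m' hm')) (integrable_finsetSum _ fun w hw =>
        integrable_finsetSum _ (hquad m' hm' w hw)), integral_finsetSum _ (hlin m' hm'),
        integral_finsetSum _ fun w hw => integrable_finsetSum _ (hquad m' hm' w hw)]
      have z : ∑ w ∈ s, ∫ x, u w * (x ⬝ᵥ w) ∂(m' c) = 0 := Finset.sum_eq_zero fun w hw => by
        rw [integral_const_mul, hm'.mean c w hw, mul_zero]
      rw [z, zero_add]
      refine Finset.sum_congr rfl fun w hw => ?_
      rw [integral_finsetSum _ (hquad m' hm' w hw)]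
      exact Finset.sum_congr rfl fun w' _ => integral_const_mul _ _
    -- The remainder is B³ times 1 + 4c₀(Ψ + B³). Here Ψ depends only on the frozen cells, so
    -- integrating over one cell requires only the third moment of B and, when c₀ ≠ 0, the sixth.
    set D : (Fin p → ℝ) → ℝ := fun x =>
      K * (1 + 4 * c₀ * Ψ y) * B x ^ 3 + K * 4 * (c₀ * B x ^ 6) with hD
    have hDi : ∀ (m' : ι → Measure (Fin p → ℝ)), HasCellBounds m' s B c₀ v₂ v₄ b →
        Integrable D (m' c) := fun m' hm' =>
      ((hm'.integrable_three c).const_mul _).add ((hm'.integrable_six c).const_mul _)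
    have hDle : ∀ (m' : ι → Measure (Fin p → ℝ)), HasCellBounds m' s B c₀ v₂ v₄ b →
        ∫ x, D x ∂(m' c) ≤ K * b c * (5 + 4 * c₀ * Ψ y) := fun m' hm' => by
      rw [hD, integral_add ((hm'.integrable_three c).const_mul _)
        ((hm'.integrable_six c).const_mul _), integral_const_mul, integral_const_mul]
      have h1 := hm'.three_le c
      have h2 := hm'.six_le c
      have hΨy := hΨ0 y
      calc K * (1 + 4 * c₀ * Ψ y) * ∫ x, B x ^ 3 ∂(m' c) + K * 4 * ∫ x, c₀ * B x ^ 6 ∂(m' c)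
          ≤ K * (1 + 4 * c₀ * Ψ y) * b c + K * 4 * b c := by gcongr
        _ = _ := by ring
    refine abs_integral_sub_le_of_expansion (hFi _) (hFi _) (hQi μ hμ) (hQi ν hν) ?_ (hDi μ hμ)
      (hDi ν hν) (hDle μ hμ) (hDle ν hν) (F₀ := Real.sigmoid (k * Real.log (partitionFn s fun w =>
        (ρ w + ∑ i ∈ Finset.univ.erase (row c), θ * g (assemble row y i ⬝ᵥ w - e i)) +
        θ * g ((∑ c' ∈ (Finset.univ.filter fun c' => row c' = row c).erase c, y c' ⬝ᵥ w) -
        e (row c))) + m)) fun x => ?_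
    · rw [hQ μ hμ, hQ ν hν]
      exact Finset.sum_congr rfl fun w hw => Finset.sum_congr rfl fun w' hw' => by
        rw [hcov c w hw w' hw']
    · have h := huv (fun w => x ⬝ᵥ w) (B x) (hB x)
      have e1 : f (Function.update y c x) = Real.sigmoid (k * Real.log (partitionFn s fun w =>
        (ρ w + ∑ i ∈ Finset.univ.erase (row c), θ * g (assemble row y i ⬝ᵥ w - e i)) +
        θ * g ((∑ c' ∈ (Finset.univ.filter fun c' => row c' = row c).erase c, y c' ⬝ᵥ w) -
        e (row c) + x ⬝ᵥ w)) + m) := by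
        simp only [hf, softTest]
        congr 3
        refine congrArg (fun E => Real.log (partitionFn s E)) (funext fun w => ?_)
        exact energy_update g θ ρ e row y c x w
      rw [e1]
      refine h.trans (le_of_eq ?_)
      simp only [hD, hK, hΨdef]
      ring
  · have hb0 : 0 ≤ b c := (integral_nonneg fun x => by
      have : 0 ≤ B x := (abs_nonneg _).trans (hB x _ hs.choose_spec)
      positivity).trans (hμ.three_le c)
    rw [integral_const_mul, integral_const_mul, integral_add (integrable_const _)
      (hΨ.const_mul _), integral_const_mul]
    simp only [integral_const, probReal_univ, smul_eq_mul, one_mul]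
    calc 2 * (K * b c * (5 + 4 * c₀ * ∫ y, Ψ y ∂(Measure.pi M)))
        ≤ 2 * (K * b c * (5 + 4 * c₀ * (4 * (1 + 3 * V₂ ^ 2 + V₄ + |e (row c)| ^ 3)))) := by
          gcongr
      _ = _ := by rw [hK]; ring

end Lindeberg

/-! ### Smoothing of Lipschitz losses by moving averages -/

section Smoothing

/-- The average of `f` over a window of length `h` to the right of `t`. -/
def slidingAverage (h : ℝ) (f : ℝ → ℝ) (t : ℝ) : ℝ := (∫ u in (0 : ℝ)..h, f (t + u)) / h

/-- The difference quotient of `f` with step `h`. -/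
def differenceQuotient (h : ℝ) (f : ℝ → ℝ) (t : ℝ) : ℝ := (f (t + h) - f t) / h

/-- The derivative of a moving average is a difference quotient of the original function, so each
averaging gains one derivative. -/
lemma hasDerivAt_slidingAverage (h : ℝ) {f : ℝ → ℝ} (hf : Continuous f) (t : ℝ) :
    HasDerivAt (slidingAverage h f) (differenceQuotient h f t) t := by
  have e : slidingAverage h f = fun t => ((∫ u in (0 : ℝ)..(t + h), f u) -
      ∫ u in (0 : ℝ)..t, f u) / h := by
    ext t
    rw [slidingAverage, intervalIntegral.integral_comp_add_left,
      intervalIntegral.integral_interval_sub_left (hf.intervalIntegrable _ _)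
        (hf.intervalIntegrable _ _), add_zero]
  rw [e]
  have d : ∀ x, HasDerivAt (fun x => ∫ u in (0 : ℝ)..x, f u) (f x) x := fun x =>
    intervalIntegral.integral_hasDerivAt_right (hf.intervalIntegrable _ _)
      (hf.stronglyMeasurableAtFilter _ _) hf.continuousAt
  exact (((d (t + h)).comp_add_const t h).sub (d t)).div_const h

lemma hasDerivAt_differenceQuotient (h : ℝ) {f f' : ℝ → ℝ} (hf : ∀ t, HasDerivAt f (f' t) t)
    (t : ℝ) : HasDerivAt (differenceQuotient h f) (differenceQuotient h f' t) t :=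
  (((hf (t + h)).comp_add_const t h).sub (hf t)).div_const h

lemma continuous_of_abs_sub_le {f : ℝ → ℝ} {K : ℝ} (hf : ∀ s t, |f s - f t| ≤ K * |s - t|) :
    Continuous f := by
  have : LipschitzWith K.toNNReal f := LipschitzWith.of_dist_le_mul fun s t => by
    rw [Real.dist_eq, Real.dist_eq]
    exact (hf s t).trans (mul_le_mul_of_nonneg_right (Real.le_coe_toNNReal K) (abs_nonneg _))
  exact this.continuous

lemma abs_slidingAverage_sub_le {h : ℝ} (hh : 0 < h) {f : ℝ → ℝ} {K : ℝ}
    (hf : ∀ s t, |f s - f t| ≤ K * |s - t|) (s t : ℝ) :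
    |slidingAverage h f s - slidingAverage h f t| ≤ K * |s - t| := by
  have hi : ∀ s, IntervalIntegrable (fun u => f (s + u)) volume 0 h := fun s =>
    ((continuous_of_abs_sub_le hf).comp (continuous_const.add continuous_id)).intervalIntegrable _ _
  unfold slidingAverage
  rw [← sub_div, ← intervalIntegral.integral_sub (hi s) (hi t), abs_div, abs_of_pos hh, div_le_iff₀ hh]
  have := intervalIntegral.norm_integral_le_of_norm_le_const (a := 0) (b := h)
    (C := K * |s - t|) (f := fun u => f (s + u) - f (t + u)) fun u _ => by
      simpa using hf (s + u) (t + u)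
  simpa [abs_of_pos hh] using this

lemma abs_slidingAverage_sub_self_le {h : ℝ} (hh : 0 < h) {f : ℝ → ℝ} {K : ℝ} (hK : 0 ≤ K)
    (hf : ∀ s t, |f s - f t| ≤ K * |s - t|) (t : ℝ) :
    |slidingAverage h f t - f t| ≤ K * h := by
  have hi : IntervalIntegrable (fun u => f (t + u)) volume 0 h :=
    ((continuous_of_abs_sub_le hf).comp (continuous_const.add continuous_id)).intervalIntegrable _ _
  have e : f t = (∫ _ in (0 : ℝ)..h, f t) / h := by
    rw [intervalIntegral.integral_const]
    simp [hh.ne']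
  rw [e]
  unfold slidingAverage
  rw [← sub_div, ← intervalIntegral.integral_sub hi
    (continuous_const.intervalIntegrable _ _), abs_div,
    abs_of_pos hh, div_le_iff₀ hh]
  have := intervalIntegral.norm_integral_le_of_norm_le_const (a := 0) (b := h)
    (C := K * h) (f := fun u => f (t + u) - f t) fun u hu => by
      rw [Set.uIoc_of_le hh.le] at hu
      have h2 := hf (t + u) t
      rw [add_sub_cancel_left, abs_of_pos hu.1] at h2
      exact h2.trans (mul_le_mul_of_nonneg_left hu.2 hK)
  simpa [abs_of_pos hh] using this

lemma abs_differenceQuotient_le {h : ℝ} (hh : 0 < h) {f : ℝ → ℝ} {K : ℝ}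
    (hf : ∀ t, |f t| ≤ K) (t : ℝ) : |differenceQuotient h f t| ≤ 2 * K / h := by
  rw [differenceQuotient, abs_div, abs_of_pos hh]
  have := (abs_sub (f (t + h)) (f t)).trans (add_le_add (hf _) (hf _))
  gcongr
  linarith

lemma abs_differenceQuotient_le_of_lipschitz {h : ℝ} (hh : 0 < h) {f : ℝ → ℝ} {K : ℝ}
    (hf : ∀ s t, |f s - f t| ≤ K * |s - t|) (t : ℝ) : |differenceQuotient h f t| ≤ K := by
  rw [differenceQuotient, abs_div, abs_of_pos hh, div_le_iff₀ hh]
  simpa [abs_of_pos hh] using hf (t + h) t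

/-- Lipschitz functions are uniform limits of functions with three bounded derivatives. -/
lemma exists_isTame_of_lipschitz {f : ℝ → ℝ} {K : ℝ} (hK : 0 ≤ K)
    (hf : ∀ s t, |f s - f t| ≤ K * |s - t|) {σ : ℝ} (hσ : 0 < σ) :
    ∃ (g g₁ g₂ g₃ V : ℝ → ℝ) (C : ℝ), IsTame g g₁ g₂ g₃ V 0 C ∧ ∀ t, |g t - f t| ≤ σ := by
  -- Each of the three averages moves the function by at most Kh; the 1 in the denominator covers K
  -- = 0.
  set h := σ / (3 * K + 1) with hh
  have hh0 : 0 < h := by positivity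
  have hKh : 3 * (K * h) ≤ σ := by
    rw [hh, mul_div_assoc', mul_div_assoc', div_le_iff₀ (by positivity)]
    nlinarith
  have l1 := abs_slidingAverage_sub_le hh0 hf
  have l2 := abs_slidingAverage_sub_le hh0 l1
  have b1 := abs_differenceQuotient_le_of_lipschitz hh0 l2
  have b2 := abs_differenceQuotient_le hh0 (abs_differenceQuotient_le_of_lipschitz hh0 l1)
  have b3 := abs_differenceQuotient_le hh0 (abs_differenceQuotient_le hh0
    (abs_differenceQuotient_le_of_lipschitz hh0 hf))
  have p2 : 0 ≤ 2 * K / h := by positivity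
  have p3 : 0 ≤ 2 * (2 * K / h) / h := by positivity
  refine ⟨slidingAverage h (slidingAverage h (slidingAverage h f)),
    differenceQuotient h (slidingAverage h (slidingAverage h f)),
    differenceQuotient h (differenceQuotient h (slidingAverage h f)),
    differenceQuotient h (differenceQuotient h (differenceQuotient h f)), fun _ => 1,
    1 + K + 2 * K / h + 2 * (2 * K / h) / h, ?_, fun t => ?_⟩
  · constructor
    · exact hasDerivAt_slidingAverage h (continuous_of_abs_sub_le l2)
    · exact hasDerivAt_differenceQuotient h
        (hasDerivAt_slidingAverage h (continuous_of_abs_sub_le l1))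
    · exact hasDerivAt_differenceQuotient h (hasDerivAt_differenceQuotient h
        (hasDerivAt_slidingAverage h (continuous_of_abs_sub_le hf)))
    · linarith
    · exact le_rfl
    · exact fun _ => zero_le_one
    · intro t; linarith [b1 t]
    · intro t; linarith [b2 t]
    · intro t; linarith [b3 t]
    · simp
    · intro t; simp only [one_pow, zero_mul, add_zero, mul_one]; linarith
  · have a1 := abs_le.1 (abs_slidingAverage_sub_self_le hh0 hK hf t)
    have a2 := abs_le.1 (abs_slidingAverage_sub_self_le hh0 hK l1 t)
    have a3 := abs_le.1 (abs_slidingAverage_sub_self_le hh0 hK l2 t)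
    exact abs_le.2 ⟨by linarith, by linarith⟩

/-- The loss is already smooth, but its derivative is unbounded, so the weight must grow. The
constant 4 comes from (1 + x)³ ≤ 4(1 + x³). -/
lemma isTame_sq : IsTame (fun t => t ^ 2) (fun t => 2 * t) (fun _ => 2) (fun _ => 0)
    (fun t => 1 + |t|) 1 4 := by
  constructor
  · intro t; simpa using hasDerivAt_pow 2 t
  · intro t; simpa using (hasDerivAt_id t).const_mul 2
  · intro t; exact hasDerivAt_const t 2
  · norm_num
  · norm_num
  · intro t; positivity
  · intro t
    rw [abs_mul, abs_two]
    nlinarith [abs_nonneg t]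
  · intro t
    rw [abs_two]
    nlinarith [abs_nonneg t, sq_nonneg |t|]
  · intro t
    rw [abs_zero]
    positivity
  · intro s t
    rw [← sq_abs s, ← sq_abs t]
    have hs := abs_nonneg s
    have ht := abs_nonneg t
    rcases le_total |s| |t| with h | h
    · exact mul_nonneg_of_nonpos_of_nonpos (by nlinarith)
        (sub_nonpos.2 (pow_le_pow_left₀ (by positivity) (by linarith) 3))
    · exact mul_nonneg (by nlinarith)
        (sub_nonneg.2 (pow_le_pow_left₀ (by positivity) (by linarith) 3))
  · intro t
    have := abs_nonneg t
    nlinarith [mul_nonneg (add_nonneg zero_le_one this) (sq_nonneg (|t| - 1))]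

end Smoothing

/-! ### Continuity and smooth approximation of the three losses -/

namespace RegressionLoss

/-- `1` for the squared loss, whose derivative is unbounded, and `0` for the Lipschitz losses. -/
def growthFlag : RegressionLoss → ℝ
  | squared => 1
  | absolute => 0
  | huber _ _ => 0

/-- The Lipschitz constant of the Lipschitz losses. -/
def slope : RegressionLoss → ℝ
  | squared => 1
  | absolute => 1
  | huber η _ => η

lemma slope_pos (l : RegressionLoss) : 0 < l.slope := by
  cases l with
  | squared => exact one_pos
  | absolute => exact one_pos
  | huber η hη => exact hη

lemma growthFlag_nonneg (l : RegressionLoss) : 0 ≤ l.growthFlag := by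
  cases l <;> simp [growthFlag]

lemma huber_lipschitz (η : ℝ) (hη : 0 < η) (u v : ℝ) :
    |(huber η hη).fn u - (huber η hη).fn v| ≤ η * |u - v| := by
  -- The loss is a nondecreasing function of |t| with slope at most η, so the arguments may be
  -- ordered by absolute value.
  have key : ∀ u v : ℝ, |u| ≤ |v| → 0 ≤ (huber η hη).fn v - (huber η hη).fn u ∧
      (huber η hη).fn v - (huber η hη).fn u ≤ η * (|v| - |u|) := by
    intro u v huv
    have h0 := abs_nonneg u
    simp only [fn]
    rw [← sq_abs u, ← sq_abs v]
    by_cases hv : |v| ≤ η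
    · rw [if_pos hv, if_pos (huv.trans hv)]
      constructor <;> nlinarith
    · rw [if_neg hv]
      by_cases hu : |u| ≤ η
      · rw [if_pos hu]
        constructor <;> nlinarith [sq_nonneg (|u| - η)]
      · rw [if_neg hu]
        constructor <;> nlinarith
  have hd : ∀ u v : ℝ, |v| - |u| ≤ |u - v| := fun u v => by
    have := abs_abs_sub_abs_le v u
    rw [abs_sub_comm v u] at this
    exact (le_abs_self _).trans this
  rcases le_total |u| |v| with h | h
  · obtain ⟨k1, k2⟩ := key u v h
    rw [abs_sub_comm, abs_of_nonneg k1]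
    exact k2.trans (mul_le_mul_of_nonneg_left (hd u v) hη.le)
  · obtain ⟨k1, k2⟩ := key v u h
    rw [abs_of_nonneg k1]
    refine k2.trans (mul_le_mul_of_nonneg_left ?_ hη.le)
    rw [abs_sub_comm]
    exact hd v u

/-- One modulus of continuity for all losses; the flag switches off the residual factor for the
Lipschitz ones. It controls the passage to the net. -/
lemma abs_fn_sub_le (l : RegressionLoss) (u v : ℝ) :
    |l.fn u - l.fn v| ≤ l.slope * |u - v| * (1 + l.growthFlag * (|u| + |v|)) := by
  cases l with
  | squared =>
    simp only [fn, slope, growthFlag, one_mul]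
    have : u ^ 2 - v ^ 2 = (u - v) * (u + v) := by ring
    rw [this, abs_mul]
    have h := abs_add_le u v
    gcongr
    linarith
  | absolute =>
    simp only [fn, slope, growthFlag, one_mul, zero_mul, add_zero, mul_one]
    exact abs_abs_sub_abs_le u v
  | huber η hη =>
    simp only [slope, growthFlag, zero_mul, add_zero, mul_one]
    exact huber_lipschitz η hη u v

lemma exists_isTame (l : RegressionLoss) {σ : ℝ} (hσ : 0 < σ) :
    ∃ (g g₁ g₂ g₃ V : ℝ → ℝ) (C : ℝ), IsTame g g₁ g₂ g₃ V l.growthFlag C ∧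
      ∀ t, |g t - l.fn t| ≤ σ := by
  cases l with
  | squared => exact ⟨_, _, _, _, _, _, isTame_sq, fun t => by simpa [fn] using hσ.le⟩
  | absolute =>
    exact exists_isTame_of_lipschitz zero_le_one (fun s t => by
      simpa [fn] using abs_abs_sub_abs_le s t) hσ
  | huber η hη => exact exists_isTame_of_lipschitz hη.le (huber_lipschitz η hη) hσ

end RegressionLoss

/-! ### Finite nets adapted to the regularizer -/

section Net

/-- A finite net of a bounded set made of near-minimizers of `R`. -/
lemma exists_net {p : ℕ} {T : Set (Fin p → ℝ)} (hT : T.Nonempty) {L δ δ' : ℝ} (hL : 0 ≤ L)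
    (hδ : 0 < δ) (hδ' : 0 < δ') (hbox : ∀ w ∈ T, ∀ j, |w j| ≤ L) {R : (Fin p → ℝ) → ℝ}
    (hR : BddBelow (R '' T)) :
    ∃ s : Finset (Fin p → ℝ), s.Nonempty ∧ (s : Set (Fin p → ℝ)) ⊆ T ∧
      (s.card : ℝ) ≤ (2 * (L / δ) + 2) ^ p ∧
      ∀ w ∈ T, ∃ w' ∈ s, (∀ j, |w j - w' j| ≤ δ) ∧ R w' ≤ R w + δ' := by
  classical
  -- Cubes of side δ are indexed by floors; two points with the same code are coordinatewise within
  -- δ.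
  set code : (Fin p → ℝ) → Fin p → ℤ := fun w j => ⌊w j / δ⌋ with hcode
  set I : Finset ℤ := Finset.Icc ⌊-(L / δ)⌋ ⌊L / δ⌋ with hI
  have hmem : ∀ w ∈ T, code w ∈ Fintype.piFinset fun _ : Fin p => I := fun w hw => by
    refine Fintype.mem_piFinset.2 fun j => Finset.mem_Icc.2 ⟨?_, ?_⟩
    · refine Int.floor_le_floor ?_
      rw [← neg_div]
      exact div_le_div_of_nonneg_right (abs_le.1 (hbox w hw j)).1 hδ.le
    · exact Int.floor_le_floor (div_le_div_of_nonneg_right (abs_le.1 (hbox w hw j)).2 hδ.le)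
  -- In each nonempty cube a point within δ' of the infimum of R is chosen. The value of R at the
  -- representative is then at most that at any point of the cube plus δ'; this bound is one-sided,
  -- which is all a minimum needs.
  have hpick : ∀ k : Fin p → ℤ, ∃ w₀, (∃ w ∈ T, code w = k) →
      w₀ ∈ T ∧ code w₀ = k ∧ ∀ w ∈ T, code w = k → R w₀ ≤ R w + δ' := by
    intro k
    by_cases hk : ∃ w ∈ T, code w = k
    · obtain ⟨w, hw, hwk⟩ := hk
      have hb : BddBelow (R '' (T ∩ {w | code w = k})) :=
        hR.mono (Set.image_mono Set.inter_subset_left)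
      obtain ⟨_, ⟨w₀, ⟨h1, h2⟩, rfl⟩, h3⟩ := Real.lt_sInf_add_pos
        (s := R '' (T ∩ {w | code w = k})) ⟨_, w, ⟨hw, hwk⟩, rfl⟩ hδ'
      refine ⟨w₀, fun _ => ⟨h1, h2, fun w' hw' hk' => ?_⟩⟩
      have := csInf_le hb ⟨w', ⟨hw', hk'⟩, rfl⟩
      linarith
    · exact ⟨0, fun h => absurd h hk⟩
  choose pick hpick using hpick
  set J := (Fintype.piFinset fun _ : Fin p => I).filter fun k => ∃ w ∈ T, code w = k with hJ
  refine ⟨J.image pick, ?_, ?_, ?_, ?_⟩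
  · obtain ⟨w, hw⟩ := hT
    exact ⟨pick (code w), Finset.mem_image_of_mem _ (Finset.mem_filter.2 ⟨hmem w hw, w, hw, rfl⟩)⟩
  · intro w hw
    obtain ⟨k, hk, rfl⟩ := Finset.mem_image.1 (Finset.mem_coe.1 hw)
    exact (hpick k (Finset.mem_filter.1 hk).2).1
  · have h1 : (J.image pick).card ≤ I.card ^ p := by
      refine Finset.card_image_le.trans ((Finset.card_filter_le _ _).trans (le_of_eq ?_))
      simp
    have h2 : (I.card : ℝ) ≤ 2 * (L / δ) + 2 := by
      have hx : 0 ≤ L / δ := by positivity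
      have f1 := Int.floor_le (L / δ)
      have f2 := Int.lt_floor_add_one (-(L / δ))
      rw [hI, Int.card_Icc]
      have hnn : 0 ≤ ⌊L / δ⌋ + 1 - ⌊-(L / δ)⌋ := by
        have : ⌊-(L / δ)⌋ ≤ ⌊L / δ⌋ := Int.floor_le_floor (by linarith)
        omega
      have : (((⌊L / δ⌋ + 1 - ⌊-(L / δ)⌋).toNat : ℤ) : ℝ) =
          ((⌊L / δ⌋ + 1 - ⌊-(L / δ)⌋ : ℤ) : ℝ) := by rw [Int.toNat_of_nonneg hnn]
      rw [Int.cast_natCast] at this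
      rw [this]
      push_cast
      linarith
    calc ((J.image pick).card : ℝ) ≤ (I.card : ℝ) ^ p := by exact_mod_cast h1
      _ ≤ _ := pow_le_pow_left₀ (Nat.cast_nonneg _) h2 p
  · intro w hw
    have hk : ∃ w' ∈ T, code w' = code w := ⟨w, hw, rfl⟩
    obtain ⟨-, h2, h3⟩ := hpick (code w) hk
    refine ⟨pick (code w), Finset.mem_image_of_mem _ (Finset.mem_filter.2 ⟨hmem w hw, hk⟩),
      fun j => ?_, h3 w hw rfl⟩
    have hj : ⌊pick (code w) j / δ⌋ = ⌊w j / δ⌋ := congrFun h2 j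
    have := Int.abs_sub_lt_one_of_floor_eq_floor hj
    rw [← sub_div, abs_div, abs_of_pos hδ, div_lt_one hδ] at this
    rw [abs_sub_comm]
    exact this.le

end Net

/-! ### Quadratic forms and the largest eigenvalue -/

section LambdaMax

-- The bound is the Loewner inequality A ≤ λ_max·I, tested on u.
open scoped MatrixOrder in
lemma dotProduct_mulVec_le_lambdaMax {p : ℕ} {A : Matrix (Fin p) (Fin p) ℝ} (hA : A.PosSemidef)
    (u : Fin p → ℝ) : u ⬝ᵥ A.mulVec u ≤ lambdaMax A * ∑ j, u j ^ 2 := by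
  have hfin : (spectrum ℝ A).Finite := Matrix.finite_spectrum A
  have h : A ≤ algebraMap ℝ _ (lambdaMax A) :=
    le_algebraMap_of_spectrum_le (fun x hx => le_csSup hfin.bddAbove hx) hA.isHermitian
  have h2 := (Matrix.le_iff.1 h).dotProduct_mulVec_nonneg u
  rw [Matrix.sub_mulVec, dotProduct_sub] at h2
  have e : star u ⬝ᵥ (algebraMap ℝ (Matrix (Fin p) (Fin p) ℝ) (lambdaMax A)).mulVec u =
      lambdaMax A * ∑ j, u j ^ 2 := by
    rw [Matrix.algebraMap_eq_diagonal, Finset.mul_sum]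
    simp only [dotProduct, Matrix.mulVec_diagonal]
    exact Finset.sum_congr rfl fun j _ => by simp; ring
  rw [e] at h2
  simpa using h2

lemma diag_le_lambdaMax {p : ℕ} {A : Matrix (Fin p) (Fin p) ℝ} (hA : A.PosSemidef)
    (j : Fin p) : A j j ≤ lambdaMax A := by
  have h := dotProduct_mulVec_le_lambdaMax hA (Pi.single j 1)
  simpa [Pi.single_apply, ite_pow] using h

end LambdaMax

/-! ### Moments of the Gaussian design -/

section Gaussian

variable {Ω : Type*} [MeasurableSpace Ω] {P : Measure Ω} [IsProbabilityMeasure P] {n p : ℕ}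
  {G : Ω → Fin n → Fin p → ℝ} {Sig : Matrix (Fin p) (Fin p) ℝ}

lemma posSemidef_smul_inv (n : ℕ) (hS : Sig.PosDef) :
    ((1 / (n : ℝ)) • Sig).PosSemidef := hS.posSemidef.smul (by positivity)

lemma IsGaussianDesign.hasLaw (hG : IsGaussianDesign P G Sig) (i : Fin n) :
    HasLaw (fun ω => WithLp.toLp 2 (G ω i)) (multivariateGaussian 0 ((1 / (n : ℝ)) • Sig)) P where
  aemeasurable := by
    have := (measurable_pi_apply i).comp hG.measurable
    exact ((WithLp.measurable_toLp 2 (Fin p → ℝ)).comp this).aemeasurable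
  map_eq := hG.law i

lemma IsGaussianDesign.hasGaussianLaw (hG : IsGaussianDesign P G Sig) (i : Fin n) :
    HasGaussianLaw (fun ω => WithLp.toLp 2 (G ω i)) P :=
  (hG.hasLaw i).hasGaussianLaw

lemma IsGaussianDesign.hasLaw_apply (hG : IsGaussianDesign P G Sig) (hS : Sig.PosDef) (i : Fin n)
    (j : Fin p) : HasLaw (fun ω => G ω i j) (gaussianReal 0 (Sig j j / n).toNNReal) P := by
  have h := (measurePreserving_eval_multivariateGaussian (μ := 0)
    (posSemidef_smul_inv n hS) (i := j)).hasLaw.comp (hG.hasLaw i)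
  have e : ((1 / (n : ℝ)) • Sig) j j = Sig j j / n := by simp; ring
  rw [e] at h
  exact h

lemma IsGaussianDesign.memLp (hG : IsGaussianDesign P G Sig) (hS : Sig.PosDef) (i : Fin n)
    (j : Fin p) {q : ENNReal} (hq : q ≠ ⊤) : MemLp (fun ω => G ω i j) q P := by
  have h := hG.hasLaw_apply hS i j
  have h2 : MemLp id q (P.map fun ω => G ω i j) := by
    rw [h.map_eq]
    exact memLp_id_gaussianReal' q hq
  exact (memLp_map_measure_iff h2.1 h.aemeasurable).1 h2

lemma IsGaussianDesign.mean (hG : IsGaussianDesign P G Sig) (hS : Sig.PosDef) (i : Fin n)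
    (j : Fin p) : ∫ ω, G ω i j ∂P = 0 := by
  have h := (hG.hasLaw_apply hS i j).integral_eq
  rw [h]
  simp

lemma IsGaussianDesign.covariance (hG : IsGaussianDesign P G Sig) (hS : Sig.PosDef) (i : Fin n)
    (j k : Fin p) : cov[fun ω => G ω i j, fun ω => G ω i k; P] = Sig j k / n := by
  have h := covariance_eval_multivariateGaussian (μ := 0) (posSemidef_smul_inv n hS) j k
  rw [← hG.law i, covariance_map (by fun_prop) (by fun_prop) (hG.hasLaw i).aemeasurable] at h
  refine Eq.trans ?_ (h.trans ?_)
  · rfl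
  · simp; ring

/-- The rows of a Gaussian design have the moments required of a design. -/
lemma IsGaussianDesign.isDesign (hG : IsGaussianDesign P G Sig) (hS : Sig.PosDef) :
    IsDesign P G Sig where
  measurable := hG.measurable
  indep := hG.indep
  identDistrib i i' := by
    have h : ∀ i, P.map (fun ω => G ω i) =
        (multivariateGaussian 0 ((1 / (n : ℝ)) • Sig)).map (WithLp.ofLp) := fun i => by
      rw [← hG.law i, AEMeasurable.map_map_of_aemeasurable
        (WithLp.measurable_ofLp 2 (Fin p → ℝ)).aemeasurable (hG.hasLaw i).aemeasurable]
      rfl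
    exact ⟨((measurable_pi_apply i).comp hG.measurable).aemeasurable,
      ((measurable_pi_apply i').comp hG.measurable).aemeasurable, by rw [h i, h i']⟩
  mean := hG.mean hS
  cov i j k := by
    rw [← hG.covariance hS i j k, covariance_eq_sub (hG.memLp hS i j (by simp))
      (hG.memLp hS i k (by simp)), hG.mean hS, hG.mean hS]
    simp

/-- The `L^q` norm of the standard Gaussian law. -/
def gaussianNorm (q : ENNReal) : ℝ := (eLpNorm id q (gaussianReal 0 1)).toReal

/-- √n G_ij has the law of √Σ_jj times a standard normal variable, and Σ_jj ≤ λ_max(Σ) ≤ M. Hence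
the Gaussian design has moment bounds uniform in n, as does X. -/
lemma IsGaussianDesign.eLpNorm_le (hG : IsGaussianDesign P G Sig) (hS : Sig.PosDef) (hn : 1 ≤ n)
    {M : ℝ} (hM : lambdaMax Sig ≤ M) (i : Fin n) (j : Fin p) {q : ENNReal} (hq : q ≠ ⊤) :
    eLpNorm (fun ω => √(n : ℝ) * G ω i j) q P ≤ ENNReal.ofReal (√M * gaussianNorm q) := by
  have hn0 : (0 : ℝ) < n := by exact_mod_cast hn
  have hjj : 0 ≤ Sig j j := hS.posSemidef.diag_nonneg
  have hvM : Sig j j ≤ M := (diag_le_lambdaMax hS.posSemidef j).trans hM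
  have h := gaussianReal_const_mul (hG.hasLaw_apply hS i j) (√(n : ℝ))
  have h1 : HasLaw id (gaussianReal 0 1) (gaussianReal 0 1) := HasLaw.id
  have h2 := gaussianReal_const_mul h1 (√(Sig j j))
  have e : gaussianReal (√(n : ℝ) * 0) (.mk (√(n : ℝ) ^ 2) (sq_nonneg _) * (Sig j j / n).toNNReal) =
      gaussianReal (√(Sig j j) * 0) (.mk (√(Sig j j) ^ 2) (sq_nonneg _) * 1) := by
    congr 1
    · simp
    · ext
      have : 0 ≤ Sig j j / n := by positivity
      simp only [NNReal.coe_mul, NNReal.coe_mk, NNReal.coe_one, Real.coe_toNNReal _ this,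
        Real.sq_sqrt hjj, Real.sq_sqrt hn0.le]
      field_simp
  have e1 : eLpNorm (fun ω => √(n : ℝ) * G ω i j) q P =
      eLpNorm (fun x => √(Sig j j) * id x) q (gaussianReal 0 1) := by
    have a : eLpNorm id q (P.map fun ω => √(n : ℝ) * G ω i j) =
        eLpNorm id q ((gaussianReal 0 1).map fun x => √(Sig j j) * id x) := by
      rw [h.map_eq, h2.map_eq, e]
    rw [eLpNorm_map_measure aestronglyMeasurable_id h.aemeasurable,
      eLpNorm_map_measure aestronglyMeasurable_id h2.aemeasurable] at a
    exact a
  rw [e1]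
  have e2 : eLpNorm (fun x => √(Sig j j) * id x) q (gaussianReal 0 1) =
      ENNReal.ofReal (√(Sig j j)) * eLpNorm id q (gaussianReal 0 1) := by
    have := eLpNorm_const_smul (√(Sig j j)) (id : ℝ → ℝ) q (gaussianReal 0 1)
    rw [Real.enorm_eq_ofReal (Real.sqrt_nonneg _)] at this
    exact this
  rw [e2, ENNReal.ofReal_mul (Real.sqrt_nonneg _), gaussianNorm,
    ENNReal.ofReal_toReal (memLp_id_gaussianReal' q hq).eLpNorm_lt_top.ne]
  gcongr

end Gaussian

/-! ### Independence of the cells -/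

section Cells

variable {Ω : Type*} [MeasurableSpace Ω] {P : Measure Ω} [IsProbabilityMeasure P] {n p : ℕ}

/-- The subvector of the `i`-th row on the cell `D`, extended by zero. -/
def cellVec (A : Ω → Fin n → Fin p → ℝ) (i : Fin n) (D : Finset (Fin p)) (ω : Ω) (j : Fin p) : ℝ :=
  if j ∈ D then A ω i j else 0

lemma measurable_cellVec {A : Ω → Fin n → Fin p → ℝ} (hA : Measurable A) (i : Fin n)
    (D : Finset (Fin p)) : Measurable (cellVec A i D) := by
  refine measurable_pi_iff.2 fun j => ?_
  by_cases h : j ∈ D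
  · simp only [cellVec, h, if_true]
    exact (measurable_pi_apply j).comp ((measurable_pi_apply i).comp hA)
  · simp only [cellVec, h, if_false]
    exact measurable_const

lemma measurable_extend_zero (D : Finset (Fin p)) :
    Measurable fun (z : {j : Fin p // j ∈ D} → ℝ) (j : Fin p) =>
      if h : j ∈ D then z ⟨j, h⟩ else 0 := by
  refine measurable_pi_iff.2 fun j => ?_
  by_cases h : j ∈ D
  · simpa [h] using measurable_pi_apply _
  · simp [h]

/-- Row-wise independence on the cells and independence of the rows give independence of all the
cells. -/
lemma iIndepFun_cells {A : Ω → Fin n → Fin p → ℝ} (hA : Measurable A)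
    (hind : iIndepFun (fun i ω => A ω i) P) (k : Fin n → ℕ)
    (B : ∀ i, Fin (k i) → Finset (Fin p))
    (hB : ∀ i, iIndepFun (fun (a : Fin (k i)) (ω : Ω) (j : {j : Fin p // j ∈ B i a}) => A ω i j) P) :
    iIndepFun (fun (c : (i : Fin n) × Fin (k i)) ω => cellVec A c.1 (B c.1 c.2) ω) P := by
  refine iIndepFun_uncurry (X := fun i a ω => cellVec A i (B i a) ω)
    (fun i a => measurable_cellVec hA i _) ?_ fun i => ?_
  · have := hind.comp (fun i (x : Fin p → ℝ) (a : Fin (k i)) (j : Fin p) =>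
      if j ∈ B i a then x j else 0) fun i => by
        refine measurable_pi_iff.2 fun a => measurable_pi_iff.2 fun j => ?_
        by_cases h : j ∈ B i a
        · simpa [h] using measurable_pi_apply j
        · simp [h]
    exact this
  · have := (hB i).comp (fun a z j => if h : j ∈ B i a then z ⟨j, h⟩ else 0)
      fun a => measurable_extend_zero _
    convert this using 3 with a ω
    ext j
    simp [cellVec]

/-- Coordinates of different cells of a block dependent row are uncorrelated. -/
lemma IsDesign.sig_eq_zero {A : Ω → Fin n → Fin p → ℝ} {Sig : Matrix (Fin p) (Fin p) ℝ}
    (hA : IsDesign P A Sig) (hn : 1 ≤ n) (i : Fin n) {k : ℕ} {B : Fin k → Finset (Fin p)}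
    (hB : iIndepFun (fun (a : Fin k) (ω : Ω) (j : {j : Fin p // j ∈ B a}) => A ω i j) P)
    {a b : Fin k} (hab : a ≠ b) {j l : Fin p} (hj : j ∈ B a) (hl : l ∈ B b) : Sig j l = 0 := by
  have hm : ∀ j, Measurable fun ω => A ω i j := fun j =>
    (measurable_pi_apply j).comp ((measurable_pi_apply i).comp hA.measurable)
  have h : IndepFun (fun ω => A ω i j) (fun ω => A ω i l) P :=
    (hB.indepFun hab).comp (measurable_pi_apply (⟨j, hj⟩ : {j : Fin p // j ∈ B a}))
      (measurable_pi_apply (⟨l, hl⟩ : {j : Fin p // j ∈ B b}))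
  have h2 := h.integral_fun_mul_eq_mul_integral (hm j).aestronglyMeasurable
    (hm l).aestronglyMeasurable
  rw [hA.cov, hA.mean, zero_mul] at h2
  have hn0 : (n : ℝ) ≠ 0 := by positivity
  field_simp at h2
  simpa using h2

/-- The Gaussian design inherits the block structure of the covariance matrix. -/
lemma IsGaussianDesign.iIndepFun_blocks {G : Ω → Fin n → Fin p → ℝ}
    {Sig : Matrix (Fin p) (Fin p) ℝ} (hG : IsGaussianDesign P G Sig) (hS : Sig.PosDef) (i : Fin n)
    {k : ℕ} {B : Fin k → Finset (Fin p)}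
    (hB : ∀ a b : Fin k, a ≠ b → ∀ j ∈ B a, ∀ l ∈ B b, Sig j l = 0) :
    iIndepFun (fun (a : Fin k) (ω : Ω) (j : {j : Fin p // j ∈ B a}) => G ω i j) P := by
  refine HasGaussianLaw.iIndepFun_of_covariance_eval
    (X := fun (a : Fin k) (j : {j : Fin p // j ∈ B a}) ω => G ω i j) ?_ fun a b hab j l => ?_
  · exact (hG.hasGaussianLaw i).map_fun (ContinuousLinearMap.pi fun a : Fin k =>
      ContinuousLinearMap.pi fun j : {j : Fin p // j ∈ B a} =>
        (EuclideanSpace.proj (j : Fin p) : EuclideanSpace ℝ (Fin p) →L[ℝ] ℝ))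
  · rw [hG.covariance hS, hB a b hab j j.2 l l.2, zero_div]

end Cells

/-! ### Moment bounds for the cells -/

section CellMoments

variable {Ω : Type*} [MeasurableSpace Ω] {P : Measure Ω} [IsProbabilityMeasure P] {n p : ℕ}
  {A : Ω → Fin n → Fin p → ℝ} {Sig : Matrix (Fin p) (Fin p) ℝ} {q : ENNReal} {M' : ℝ}

lemma IsDesign.measurable_apply (hA : IsDesign P A Sig) (i : Fin n) (j : Fin p) :
    Measurable fun ω => A ω i j :=
  (measurable_pi_apply j).comp ((measurable_pi_apply i).comp hA.measurable)

lemma IsDesign.memLp_of_norm_le (hA : IsDesign P A Sig) (hn : 1 ≤ n)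
    (hq : ∀ i j, eLpNorm (fun ω => √(n : ℝ) * A ω i j) q P ≤ ENNReal.ofReal M') (i : Fin n)
    (j : Fin p) : MemLp (fun ω => A ω i j) q P := by
  have hn0 : √(n : ℝ) ≠ 0 := (Real.sqrt_pos.2 (by exact_mod_cast hn)).ne'
  have h : MemLp (fun ω => √(n : ℝ) * A ω i j) q P :=
    ⟨((hA.measurable_apply i j).const_mul _).aestronglyMeasurable,
      (hq i j).trans_lt ENNReal.ofReal_lt_top⟩
  have h2 := h.const_mul (√(n : ℝ))⁻¹
  refine (memLp_congr_ae (ae_of_all _ fun ω => ?_)).1 h2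
  change (√(n : ℝ))⁻¹ * (√(n : ℝ) * A ω i j) = A ω i j
  field_simp

lemma IsDesign.integrable_abs_pow (hA : IsDesign P A Sig) (hn : 1 ≤ n)
    (hq : ∀ i j, eLpNorm (fun ω => √(n : ℝ) * A ω i j) q P ≤ ENNReal.ofReal M') (i : Fin n)
    (j : Fin p) {m : ℕ} (hm : (m : ENNReal) ≤ q) : Integrable (fun ω => |A ω i j| ^ m) P := by
  have := ((hA.memLp_of_norm_le hn hq i j).mono_exponent hm).integrable_norm_pow'
  simpa using this

lemma IsDesign.integral_abs_pow_le (hA : IsDesign P A Sig) (hn : 1 ≤ n) (hM' : 0 ≤ M')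
    (hq : ∀ i j, eLpNorm (fun ω => √(n : ℝ) * A ω i j) q P ≤ ENNReal.ofReal M') (i : Fin n)
    (j : Fin p) {m : ℕ} (hm0 : m ≠ 0) (hm : (m : ENNReal) ≤ q) :
    ∫ ω, |A ω i j| ^ m ∂P ≤ (M' / √(n : ℝ)) ^ m := by
  have hn0 : 0 < √(n : ℝ) := Real.sqrt_pos.2 (by exact_mod_cast hn)
  have hmem : MemLp (fun ω => √(n : ℝ) * A ω i j) m P :=
    ((hA.memLp_of_norm_le hn hq i j).mono_exponent hm).const_mul _
  have h1 : eLpNorm (fun ω => √(n : ℝ) * A ω i j) m P ≤ ENNReal.ofReal M' :=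
    (eLpNorm_le_eLpNorm_of_exponent_le hm hmem.1).trans (hq i j)
  rw [hmem.eLpNorm_eq_integral_rpow_norm (by exact_mod_cast hm0) (by simp),
    ENNReal.ofReal_le_ofReal_iff hM'] at h1
  simp only [ENNReal.toReal_natCast, Real.norm_eq_abs, Real.rpow_natCast, abs_mul, mul_pow,
    abs_of_pos hn0] at h1
  rw [integral_const_mul] at h1
  have hI : 0 ≤ ∫ ω, |A ω i j| ^ m ∂P := integral_nonneg fun _ => by positivity
  have h2 := pow_le_pow_left₀ (by positivity) h1 m
  rw [← Real.rpow_natCast (_ ^ _), ← Real.rpow_mul (by positivity),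
    inv_mul_cancel₀ (by exact_mod_cast hm0), Real.rpow_one] at h2
  rw [div_pow, le_div_iff₀ (by positivity)]
  linarith

lemma cellVec_dotProduct (A : Ω → Fin n → Fin p → ℝ) (i : Fin n) (D : Finset (Fin p)) (ω : Ω)
    (w : Fin p → ℝ) : cellVec A i D ω ⬝ᵥ w = ∑ j ∈ D, A ω i j * w j := by
  simp [dotProduct, cellVec, Finset.sum_ite_mem]

lemma sum_abs_cellVec (A : Ω → Fin n → Fin p → ℝ) (i : Fin n) (D : Finset (Fin p)) (ω : Ω) :
    ∑ j, |cellVec A i D ω j| = ∑ j ∈ D, |A ω i j| := by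
  have : ∀ j, |cellVec A i D ω j| = if j ∈ D then |A ω i j| else 0 := fun j => by
    by_cases h : j ∈ D <;> simp [cellVec, h]
  simp [this, Finset.sum_ite_mem]

/-- Moments of the `ℓ¹` norm of a cell. -/
lemma IsDesign.integral_sum_abs_pow_le (hA : IsDesign P A Sig) (hn : 1 ≤ n) (hM' : 0 ≤ M')
    (hq : ∀ i j, eLpNorm (fun ω => √(n : ℝ) * A ω i j) q P ≤ ENNReal.ofReal M') (i : Fin n)
    (D : Finset (Fin p)) {m : ℕ} (hm : ((m + 1 : ℕ) : ENNReal) ≤ q) :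
    Integrable (fun ω => (∑ j ∈ D, |A ω i j|) ^ (m + 1)) P ∧
      ∫ ω, (∑ j ∈ D, |A ω i j|) ^ (m + 1) ∂P ≤ (D.card * (M' / √(n : ℝ))) ^ (m + 1) := by
  rcases D.eq_empty_or_nonempty with rfl | hD
  · simp
  have hcard : (0 : ℝ) < D.card := by exact_mod_cast hD.card_pos
  -- Power mean inequality: the entries within a cell may be arbitrarily dependent, at the price of
  -- a power of the cell size.
  have hpt : ∀ ω, (∑ j ∈ D, |A ω i j|) ^ (m + 1) ≤
      (D.card : ℝ) ^ m * ∑ j ∈ D, |A ω i j| ^ (m + 1) := fun ω => by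
    have := pow_sum_div_card_le_sum_pow (s := D) (f := fun j => |A ω i j|)
      (fun _ _ => abs_nonneg _) m
    rw [div_le_iff₀ (by positivity)] at this
    linarith
  have hint : Integrable (fun ω => (D.card : ℝ) ^ m * ∑ j ∈ D, |A ω i j| ^ (m + 1)) P :=
    (integrable_finsetSum _ fun j _ => hA.integrable_abs_pow hn hq i j hm).const_mul _
  have hI : Integrable (fun ω => (∑ j ∈ D, |A ω i j|) ^ (m + 1)) P := by
    refine hint.mono' ?_ (ae_of_all _ fun ω => ?_)
    · exact ((Finset.measurable_fun_sum _ fun j _ =>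
        (hA.measurable_apply i j).abs).pow_const _).aestronglyMeasurable
    · rw [Real.norm_eq_abs, abs_of_nonneg (pow_nonneg (Finset.sum_nonneg fun _ _ => abs_nonneg _) _)]
      exact hpt ω
  refine ⟨hI, (integral_mono hI hint hpt).trans ?_⟩
  rw [integral_const_mul, integral_finsetSum _ fun j _ => hA.integrable_abs_pow hn hq i j hm]
  calc (D.card : ℝ) ^ m * ∑ j ∈ D, ∫ ω, |A ω i j| ^ (m + 1) ∂P
      ≤ (D.card : ℝ) ^ m * ∑ j ∈ D, (M' / √(n : ℝ)) ^ (m + 1) := by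
        gcongr with j _
        exact hA.integral_abs_pow_le hn hM' hq i j (by omega) hm
    _ = _ := by
        rw [Finset.sum_const, nsmul_eq_mul]
        ring

/-- Second moments of a cell. -/
lemma IsDesign.integral_cell_mul (hA : IsDesign P A Sig) (hn : 1 ≤ n) (hq4 : 4 ≤ q)
    (hq : ∀ i j, eLpNorm (fun ω => √(n : ℝ) * A ω i j) q P ≤ ENNReal.ofReal M') (i : Fin n)
    (D : Finset (Fin p)) (w w' : Fin p → ℝ) :
    ∫ ω, (∑ j ∈ D, A ω i j * w j) * (∑ j ∈ D, A ω i j * w' j) ∂P =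
      ∑ j ∈ D, ∑ l ∈ D, w j * w' l * (Sig j l / n) := by
  have h2 : ∀ j, MemLp (fun ω => A ω i j) 2 P := fun j =>
    (hA.memLp_of_norm_le hn hq i j).mono_exponent (le_trans (by norm_num) hq4)
  have hint : ∀ j l, Integrable (fun ω => w j * w' l * (A ω i j * A ω i l)) P := fun j l =>
    ((h2 j).integrable_mul (h2 l)).const_mul _
  have e : ∀ ω, (∑ j ∈ D, A ω i j * w j) * (∑ j ∈ D, A ω i j * w' j) =
      ∑ j ∈ D, ∑ l ∈ D, w j * w' l * (A ω i j * A ω i l) := fun ω => by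
    rw [Finset.sum_mul_sum]
    exact Finset.sum_congr rfl fun j _ => Finset.sum_congr rfl fun l _ => by ring
  simp_rw [e]
  rw [integral_finsetSum _ fun j _ => integrable_finsetSum _ fun l _ => hint j l]
  refine Finset.sum_congr rfl fun j _ => ?_
  rw [integral_finsetSum _ fun l _ => hint j l]
  exact Finset.sum_congr rfl fun l _ => by rw [integral_const_mul, hA.cov]

/-- The spectral bound is linear in the cell size, so the variances of a row sum to O(L²p/n);
bounding through the ℓ¹ norm would lose a factor d. -/
lemma quadratic_cell_le {M L : ℝ} (hS : Sig.PosSemidef) (hM : lambdaMax Sig ≤ M) (hM0 : 0 ≤ M)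
    (D : Finset (Fin p)) {w : Fin p → ℝ} (hw : ∀ j, |w j| ≤ L) :
    ∑ j ∈ D, ∑ l ∈ D, w j * w l * (Sig j l / n) ≤ M * (D.card * L ^ 2) / n := by
  set u : Fin p → ℝ := fun j => if j ∈ D then w j else 0 with hu
  have e : ∑ j ∈ D, ∑ l ∈ D, w j * w l * (Sig j l / n) = (u ⬝ᵥ Sig.mulVec u) / n := by
    have i1 : ∀ j, Sig.mulVec u j = ∑ l ∈ D, Sig j l * w l := fun j => by
      simp [Matrix.mulVec, dotProduct, hu, Finset.sum_ite_mem]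
    have i2 : ∀ f : Fin p → ℝ, u ⬝ᵥ f = ∑ j ∈ D, w j * f j := fun f => by
      simp [dotProduct, hu, Finset.sum_ite_mem]
    simp only [i2, i1, Finset.sum_div, Finset.mul_sum]
    exact Finset.sum_congr rfl fun j _ => Finset.sum_congr rfl fun l _ => by ring
  have h2 : ∑ j, u j ^ 2 ≤ D.card * L ^ 2 := by
    simp only [hu, ite_pow, zero_pow two_ne_zero, Finset.sum_ite_mem, Finset.univ_inter]
    refine (Finset.sum_le_card_nsmul D _ (L ^ 2) fun j _ => ?_).trans (by simp)
    rw [← sq_abs]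
    exact pow_le_pow_left₀ (abs_nonneg _) (hw j) 2
  rw [e]
  refine div_le_div_of_nonneg_right ?_ (Nat.cast_nonneg n)
  refine (dotProduct_mulVec_le_lambdaMax hS u).trans ?_
  exact mul_le_mul hM h2 (Finset.sum_nonneg fun _ _ => sq_nonneg _) hM0

/-- The laws of the cells of a design satisfy the moment bounds of the comparison theorem. -/
lemma IsDesign.hasCellBounds (hA : IsDesign P A Sig) (hn : 1 ≤ n) (hS : Sig.PosSemidef) {M : ℝ}
    (hM : lambdaMax Sig ≤ M) (hM0 : 0 ≤ M) (hM' : 0 ≤ M') (hq4 : 4 ≤ q)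
    (hq : ∀ i j, eLpNorm (fun ω => √(n : ℝ) * A ω i j) q P ≤ ENNReal.ofReal M')
    {c₀ : ℝ} (hc₀ : c₀ = 0 ∨ c₀ = 1 ∧ 6 ≤ q)
    (k : Fin n → ℕ) (B : ∀ i, Fin (k i) → Finset (Fin p)) {d : ℕ} (hd : ∀ i a, (B i a).card ≤ d)
    {s : Finset (Fin p → ℝ)} {L : ℝ} (hL : 0 ≤ L) (hs : ∀ w ∈ s, ∀ j, |w j| ≤ L)
    (hr : L * (d * (M' / √(n : ℝ))) ≤ 1) :
    HasCellBounds (fun c : (i : Fin n) × Fin (k i) => P.map (cellVec A c.1 (B c.1 c.2))) s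
      (fun x => L * ∑ j, |x j|) c₀ (fun c => M * ((B c.1 c.2).card * L ^ 2) / n)
      (fun c => (L * ((B c.1 c.2).card * (M' / √(n : ℝ)))) ^ 4)
      (fun c => (L * ((B c.1 c.2).card * (M' / √(n : ℝ)))) ^ 3) := by
  have hmc : ∀ c : (i : Fin n) × Fin (k i), Measurable (cellVec A c.1 (B c.1 c.2)) :=
    fun c => measurable_cellVec hA.measurable _ _
  have hmB : Measurable fun x : Fin p → ℝ => L * ∑ j, |x j| :=
    (Finset.measurable_fun_sum _ fun j _ => (measurable_pi_apply j).abs).const_mul _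
  have hmd : ∀ w : Fin p → ℝ, Measurable fun x : Fin p → ℝ => x ⬝ᵥ w :=
    fun w => (continuous_dotProduct_right w).measurable
  have hint : ∀ (c : (i : Fin n) × Fin (k i)) (f : (Fin p → ℝ) → ℝ), Measurable f →
      ∫ x, f x ∂(P.map (cellVec A c.1 (B c.1 c.2))) =
        ∫ ω, f (cellVec A c.1 (B c.1 c.2) ω) ∂P := fun c f hf =>
    integral_map (hmc c).aemeasurable hf.aestronglyMeasurable
  have hintg : ∀ (c : (i : Fin n) × Fin (k i)) (f : (Fin p → ℝ) → ℝ), Measurable f →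
      Integrable (fun ω => f (cellVec A c.1 (B c.1 c.2) ω)) P →
      Integrable f (P.map (cellVec A c.1 (B c.1 c.2))) := fun c f hf h =>
    (integrable_map_measure hf.aestronglyMeasurable (hmc c).aemeasurable).2 h
  have hmem : ∀ i (D : Finset (Fin p)) (w : Fin p → ℝ),
      MemLp (fun ω => ∑ j ∈ D, A ω i j * w j) 4 P := fun i D w =>
    memLp_finsetSum _ fun j _ => by
      have := ((hA.memLp_of_norm_le hn hq i j).mono_exponent hq4).const_mul (w j)
      simpa [mul_comm] using this
  have hpow : ∀ (c : (i : Fin n) × Fin (k i)) (m : ℕ), ((m + 1 : ℕ) : ENNReal) ≤ q →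
      Integrable (fun x : Fin p → ℝ => (L * ∑ j, |x j|) ^ (m + 1))
        (P.map (cellVec A c.1 (B c.1 c.2))) ∧
      ∫ x, (L * ∑ j, |x j|) ^ (m + 1) ∂(P.map (cellVec A c.1 (B c.1 c.2))) ≤
        (L * ((B c.1 c.2).card * (M' / √(n : ℝ)))) ^ (m + 1) := fun c m hm => by
    obtain ⟨h1, h2⟩ := hA.integral_sum_abs_pow_le hn hM' hq c.1 (B c.1 c.2) hm
    refine ⟨hintg c _ (hmB.pow_const _) ?_, ?_⟩
    · simp only [sum_abs_cellVec, mul_pow]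
      exact h1.const_mul _
    · rw [hint c _ (hmB.pow_const _)]
      simp only [sum_abs_cellVec, mul_pow] at h2 ⊢
      rw [integral_const_mul]
      exact mul_le_mul_of_nonneg_left h2 (by positivity)
  have hdot : ∀ x, ∀ w ∈ s, |x ⬝ᵥ w| ≤ L * ∑ j, |x j| := fun x w hw => by
    rw [Finset.mul_sum]
    refine (Finset.abs_sum_le_sum_abs _ _).trans (Finset.sum_le_sum fun j _ => ?_)
    rw [abs_mul, mul_comm]
    exact mul_le_mul_of_nonneg_right (hs w hw j) (abs_nonneg _)
  have hq3 : ((2 + 1 : ℕ) : ENNReal) ≤ q := le_trans (by norm_num) hq4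
  have hq4' : ((3 + 1 : ℕ) : ENNReal) ≤ q := le_trans (by norm_num) hq4
  -- Once the scale of a cell is at most 1, its sixth power is below its cube, so one bound serves
  -- B³ and B⁶.
  have hr' : ∀ c : (i : Fin n) × Fin (k i), L * ((B c.1 c.2).card * (M' / √(n : ℝ))) ≤ 1 := fun c => by
    refine le_trans ?_ hr
    have : ((B c.1 c.2).card : ℝ) ≤ d := by exact_mod_cast hd c.1 c.2
    gcongr
  refine ⟨fun c => Measure.isProbabilityMeasure_map (hmc c).aemeasurable, fun c w hw => ?_,
    fun c w hw => ?_, fun c w hw => ?_, fun c w hw => ?_, fun c => (hpow c 2 hq3).1, fun c => ?_,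
    fun c => (hpow c 2 hq3).2, fun c => ?_⟩
  · rw [memLp_map_measure_iff (hmd w).aestronglyMeasurable (hmc c).aemeasurable]
    have := hmem c.1 (B c.1 c.2) w
    simp_rw [← cellVec_dotProduct] at this
    exact this
  · rw [hint c _ (hmd w)]
    simp only [cellVec_dotProduct]
    rw [integral_finsetSum]
    · exact Finset.sum_eq_zero fun j _ => by rw [integral_mul_const, hA.mean, zero_mul]
    · intro j _
      exact ((hA.memLp_of_norm_le hn hq c.1 j).integrable (le_trans (by norm_num) hq4)).mul_const _
  · rw [hint c _ ((hmd w).pow_const 2)]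
    simp only [cellVec_dotProduct, sq (∑ j ∈ _, _)]
    rw [hA.integral_cell_mul hn hq4 hq]
    exact quadratic_cell_le hS hM hM0 _ (hs w hw)
  · refine le_trans (integral_mono (hintg c _ ((hmd w).pow_const 4) ?_) (hpow c 3 hq4').1
      fun x => ?_) (hpow c 3 hq4').2
    · simp only [cellVec_dotProduct]
      exact MemLp.integrable_pow_of_le (hmem c.1 _ w) (by norm_num)
    · have h := pow_le_pow_left₀ (abs_nonneg _) (hdot x w hw) 4
      rwa [← abs_pow, abs_of_nonneg (by positivity)] at h
  · rcases hc₀ with rfl | ⟨rfl, hq6⟩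
    · simp
    · simpa using (hpow c 5 (by simpa using hq6)).1
  · have hx0 : 0 ≤ L * ((B c.1 c.2).card * (M' / √(n : ℝ))) := by positivity
    rcases hc₀ with rfl | ⟨rfl, hq6⟩
    · simp only [zero_mul, integral_zero]
      positivity
    · simp only [one_mul]
      exact (hpow c 5 (by simpa using hq6)).2.trans
        (pow_le_pow_of_le_one hx0 (hr' c) (by norm_num))

end CellMoments

/-! ### Comparison of the two designs for fixed noise -/

section Comparison

variable {Ω : Type*} [MeasurableSpace Ω] {P : Measure Ω} [IsProbabilityMeasure P] {n p : ℕ}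

lemma assemble_cellVec (A : Ω → Fin n → Fin p → ℝ) (k : Fin n → ℕ)
    (B : ∀ i, Fin (k i) → Finset (Fin p))
    (hdisj : ∀ i, Pairwise fun a b => Disjoint (B i a) (B i b)) (hcov : ∀ i j, ∃ a, j ∈ B i a)
    (ω : Ω) :
    assemble (Sigma.fst : ((i : Fin n) × Fin (k i)) → Fin n)
      (fun c => cellVec A c.1 (B c.1 c.2) ω) = A ω := by
  ext i j
  obtain ⟨a, ha⟩ := hcov i j
  unfold assemble
  rw [Finset.sum_eq_single ⟨i, a⟩]
  · simp [cellVec, ha]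
  · rintro ⟨i', a'⟩ - hne
    by_cases hi : i' = i
    · subst hi
      have hab : a' ≠ a := fun h => hne (by rw [h])
      have := Finset.disjoint_right.1 (hdisj i' hab) ha
      simp [cellVec, this]
    · simp [hi]
  · simp

/-- Independence of the cells makes their joint law a product, and the design is recovered by
summing the cells of each row. -/
lemma integral_design_eq {A : Ω → Fin n → Fin p → ℝ} (hA : Measurable A) (k : Fin n → ℕ)
    (B : ∀ i, Fin (k i) → Finset (Fin p))
    (hdisj : ∀ i, Pairwise fun a b => Disjoint (B i a) (B i b)) (hcov : ∀ i j, ∃ a, j ∈ B i a)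
    (hind : iIndepFun (fun (c : (i : Fin n) × Fin (k i)) ω => cellVec A c.1 (B c.1 c.2) ω) P)
    {f : (Fin n → Fin p → ℝ) → ℝ} (hf : Measurable f) :
    ∫ ω, f (A ω) ∂P = ∫ y, f (assemble Sigma.fst y)
      ∂(Measure.pi fun c : (i : Fin n) × Fin (k i) => P.map (cellVec A c.1 (B c.1 c.2))) := by
  have hm : ∀ c : (i : Fin n) × Fin (k i), AEMeasurable (fun ω => cellVec A c.1 (B c.1 c.2) ω) P :=
    fun c => (measurable_cellVec hA _ _).aemeasurable
  rw [← (iIndepFun_iff_map_fun_eq_pi_map hm).1 hind, integral_map]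
  · simp_rw [assemble_cellVec A k B hdisj hcov]
  · exact (measurable_pi_iff.2 fun c => measurable_cellVec hA _ _).aemeasurable
  · exact (hf.comp (continuous_assemble _).measurable).aestronglyMeasurable

lemma sum_card_le (k : ℕ) (B : Fin k → Finset (Fin p))
    (hdisj : Pairwise fun a b => Disjoint (B a) (B b)) : ∑ a, (B a).card ≤ p := by
  rw [← Finset.card_biUnion fun a _ b _ hab => hdisj hab]
  exact (Finset.card_le_univ _).trans (by simp)

/-- All but one factor is bounded by d, and the cells together have at most p elements. -/
lemma sum_card_pow_le (k : ℕ) (B : Fin k → Finset (Fin p))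
    (hdisj : Pairwise fun a b => Disjoint (B a) (B b)) {d : ℕ} (hd : ∀ a, (B a).card ≤ d) (m : ℕ) :
    ∑ a, ((B a).card : ℝ) ^ (m + 1) ≤ (d : ℝ) ^ m * p := by
  have h : (∑ a, ((B a).card : ℝ)) ≤ p := by exact_mod_cast sum_card_le k B hdisj
  calc ∑ a, ((B a).card : ℝ) ^ (m + 1) ≤ ∑ a, (d : ℝ) ^ m * (B a).card := by
        refine Finset.sum_le_sum fun a _ => ?_
        rw [pow_succ]
        have : ((B a).card : ℝ) ≤ d := by exact_mod_cast hd a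
        gcongr
    _ = (d : ℝ) ^ m * ∑ a, ((B a).card : ℝ) := by rw [Finset.mul_sum]
    _ ≤ _ := by gcongr

lemma sum_sigma_row (k : Fin n → ℕ) (f : (i : Fin n) × Fin (k i) → ℝ) (i : Fin n) :
    ∑ c : (i : Fin n) × Fin (k i) with c.1 = i, f c = ∑ a, f ⟨i, a⟩ := by
  rw [Finset.sum_filter, Fintype.sum_sigma, Finset.sum_eq_single i]
  · simp
  · intro i' _ hi
    simp [hi]
  · simp

/-- Comparison of two designs with the same covariance matrix and the same blocks, for a fixed noise
vector. -/
theorem abs_integral_softTest_design_sub_le {X G : Ω → Fin n → Fin p → ℝ}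
    {Sig : Matrix (Fin p) (Fin p) ℝ} (hX : IsDesign P X Sig) (hG : IsDesign P G Sig) (hn : 1 ≤ n)
    (hS : Sig.PosSemidef) {M M' : ℝ} {q : ENNReal}
    (hM : lambdaMax Sig ≤ M) (hM0 : 0 ≤ M) (hM' : 0 ≤ M') (hq4 : 4 ≤ q)
    (hqX : ∀ i j, eLpNorm (fun ω => √(n : ℝ) * X ω i j) q P ≤ ENNReal.ofReal M')
    (hqG : ∀ i j, eLpNorm (fun ω => √(n : ℝ) * G ω i j) q P ≤ ENNReal.ofReal M')
    {g g₁ g₂ g₃ V : ℝ → ℝ} {c₀ C : ℝ} (hg : IsTame g g₁ g₂ g₃ V c₀ C)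
    (hc₀ : c₀ = 0 ∨ c₀ = 1 ∧ 6 ≤ q)
    (k : Fin n → ℕ) (B : ∀ i, Fin (k i) → Finset (Fin p)) {d : ℕ} (hd : ∀ i a, (B i a).card ≤ d)
    (hdisj : ∀ i, Pairwise fun a b => Disjoint (B i a) (B i b)) (hcov : ∀ i j, ∃ a, j ∈ B i a)
    (hBX : ∀ i, iIndepFun
      (fun (a : Fin (k i)) (ω : Ω) (j : {j : Fin p // j ∈ B i a}) => X ω i j) P)
    (hBG : ∀ i, iIndepFun
      (fun (a : Fin (k i)) (ω : Ω) (j : {j : Fin p // j ∈ B i a}) => G ω i j) P)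
    {s : Finset (Fin p → ℝ)} (hs : s.Nonempty) {L : ℝ} (hL : 0 ≤ L) (hsL : ∀ w ∈ s, ∀ j, |w j| ≤ L)
    (hr : L * (d * (M' / √(n : ℝ))) ≤ 1)
    {θ t : ℝ} (m : ℝ) (hθ : 1 ≤ θ) (ht : |t| ≤ 1) (ρ : (Fin p → ℝ) → ℝ) (e : Fin n → ℝ) :
    |∫ ω, softTest s g θ ρ t m e (X ω) ∂P - ∫ ω, softTest s g θ ρ t m e (G ω) ∂P| ≤
      46 * |t| * (θ * C) ^ 3 * C * ((L * (M' / √(n : ℝ))) ^ 3 * (d ^ 2 * p)) *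
        ∑ i, (5 + 16 * c₀ * (1 + 3 * (M * (p * L ^ 2) / n) ^ 2 +
          (L * (M' / √(n : ℝ))) ^ 4 * (d ^ 3 * p) + |e i| ^ 3)) := by
  have hgc : Continuous g := continuous_iff_continuousAt.2 fun t => (hg.deriv₁ t).continuousAt
  have hC := hg.one_le
  have hc00 := hg.c_nonneg
  have hfm : Measurable fun A : Fin n → Fin p → ℝ => softTest s g θ ρ t m e A :=
    ((continuous_softTest hs hgc θ ρ t m).comp (continuous_id.prodMk continuous_const)).measurable
  rw [integral_design_eq hX.measurable k B hdisj hcov (iIndepFun_cells hX.measurable hX.indep k B hBX)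
    hfm, integral_design_eq hG.measurable k B hdisj hcov
      (iIndepFun_cells hG.measurable hG.indep k B hBG) hfm]
  have bX := hX.hasCellBounds hn hS hM hM0 hM' hq4 hqX hc₀ k B hd hL hsL hr
  have bG := hG.hasCellBounds hn hS hM hM0 hM' hq4 hqG hc₀ k B hd hL hsL hr
  have hB : ∀ x : Fin p → ℝ, ∀ w ∈ s, |x ⬝ᵥ w| ≤ L * ∑ j, |x j| := fun x w hw => by
    rw [Finset.mul_sum]
    refine (Finset.abs_sum_le_sum_abs _ _).trans (Finset.sum_le_sum fun j _ => ?_)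
    rw [abs_mul, mul_comm]
    exact mul_le_mul_of_nonneg_right (hsL w hw j) (abs_nonneg _)
  refine (abs_integral_softTest_sub_le hg hs m hθ ht ρ e Sigma.fst bX bG hB ?_
    (V₂ := M * (p * L ^ 2) / n) (V₄ := (L * (M' / √(n : ℝ))) ^ 4 * (d ^ 3 * p)) ?_ ?_).trans ?_
  · intro c w _ w' _
    have hmd : Measurable fun x : Fin p → ℝ => (x ⬝ᵥ w) * (x ⬝ᵥ w') :=
      (continuous_dotProduct_right w).measurable.mul (continuous_dotProduct_right w').measurable
    rw [integral_map (measurable_cellVec hX.measurable _ _).aemeasurable hmd.aestronglyMeasurable,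
      integral_map (measurable_cellVec hG.measurable _ _).aemeasurable hmd.aestronglyMeasurable]
    simp only [cellVec_dotProduct]
    rw [hX.integral_cell_mul hn hq4 hqX, hG.integral_cell_mul hn hq4 hqG]
  · intro i
    rw [sum_sigma_row]
    have h := sum_card_pow_le (k i) (B i) (hdisj i) (hd i) 0
    simp only [zero_add, pow_one, pow_zero, one_mul] at h
    rw [← Finset.sum_div, ← Finset.mul_sum, ← Finset.sum_mul]
    gcongr
  · intro i
    rw [sum_sigma_row]
    have h := sum_card_pow_le (k i) (B i) (hdisj i) (hd i) 3
    calc ∑ a, (L * ((B i a).card * (M' / √(n : ℝ)))) ^ 4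
        = (L * (M' / √(n : ℝ))) ^ 4 * ∑ a, ((B i a).card : ℝ) ^ 4 := by
          rw [Finset.mul_sum]
          exact Finset.sum_congr rfl fun a _ => by ring
      _ ≤ _ := by gcongr
  · rw [Fintype.sum_sigma, Finset.mul_sum]
    refine Finset.sum_le_sum fun i _ => ?_
    have h := sum_card_pow_le (k i) (B i) (hdisj i) (hd i) 2
    calc ∑ a, 46 * |t| * (θ * C) ^ 3 * C * (L * ((B i a).card * (M' / √(n : ℝ)))) ^ 3 *
          (5 + 16 * c₀ * (1 + 3 * (M * (p * L ^ 2) / n) ^ 2 +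
          (L * (M' / √(n : ℝ))) ^ 4 * (d ^ 3 * p) + |e i| ^ 3))
        = 46 * |t| * (θ * C) ^ 3 * C * ((L * (M' / √(n : ℝ))) ^ 3 * ∑ a, ((B i a).card : ℝ) ^ 3) *
          (5 + 16 * c₀ * (1 + 3 * (M * (p * L ^ 2) / n) ^ 2 +
          (L * (M' / √(n : ℝ))) ^ 4 * (d ^ 3 * p) + |e i| ^ 3)) := by
          rw [Finset.mul_sum, Finset.mul_sum, Finset.sum_mul]
          exact Finset.sum_congr rfl fun a _ => by ring
      _ ≤ _ := by gcongr

end Comparison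

/-! ### From test functions to probabilities, averaging over the noise -/

section Events

variable {Ω : Type*} [MeasurableSpace Ω] {P : Measure Ω} [IsProbabilityMeasure P]

/-- Passing from expectations of approximate indicators to probabilities. -/
lemma measureReal_le_of_sandwich {f h : Ω → ℝ} (hfm : Measurable f) (hhm : Measurable h)
    (hf0 : ∀ ω, 0 ≤ f ω) (hf1 : ∀ ω, f ω ≤ 1) (hh1 : ∀ ω, h ω ≤ 1) (hh0 : ∀ ω, 0 ≤ h ω)
    {η E : ℝ} (hη : 0 ≤ η) (hE : ∫ ω, f ω ∂P ≤ ∫ ω, h ω ∂P + E) {A A' N N' : Set Ω}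
    (hA : ∀ ω ∈ A, ω ∉ N → 1 - η ≤ f ω) (hA' : ∀ ω, η < h ω → ω ∉ N' → ω ∈ A') :
    P.real A ≤ P.real A' + (P.real N + P.real N') + E + 2 * η := by
  have hfi : Integrable f P := Integrable.of_bound hfm.aestronglyMeasurable 1
    (ae_of_all _ fun ω => by rw [Real.norm_eq_abs, abs_of_nonneg (hf0 ω)]; exact hf1 ω)
  have hhi : Integrable h P := Integrable.of_bound hhm.aestronglyMeasurable 1
    (ae_of_all _ fun ω => by rw [Real.norm_eq_abs, abs_of_nonneg (hh0 ω)]; exact hh1 ω)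
  have h1 : P.real A ≤ P.real {ω | 1 - η ≤ f ω} + P.real N := by
    refine (measureReal_mono (fun ω hω => ?_) (measure_ne_top _ _)).trans (measureReal_union_le _ _)
    by_cases hN : ω ∈ N
    · exact Or.inr hN
    · exact Or.inl (hA ω hω hN)
  -- Markov's inequality is applied to a level set of f, which is measurable; the events A, A', N,
  -- N' need not be.
  have h2 := mul_meas_ge_le_integral_of_nonneg (ae_of_all P hf0) hfi (1 - η)
  have h3 : P.real {ω | 1 - η ≤ f ω} ≤ 1 := measureReal_le_one
  have h4 : ∫ ω, h ω ∂P ≤ η + P.real {ω | η < h ω} := by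
    have hs : MeasurableSet {ω | η < h ω} := measurableSet_lt measurable_const hhm
    have hi : Integrable ({ω | η < h ω}.indicator fun _ => (1 : ℝ)) P :=
      (integrable_const _).indicator hs
    calc ∫ ω, h ω ∂P ≤ ∫ ω, (η + {ω | η < h ω}.indicator (fun _ => (1 : ℝ)) ω) ∂P := by
          refine integral_mono hhi ((integrable_const _).add hi) fun ω => ?_
          by_cases hω : η < h ω
          · have : ω ∈ {ω | η < h ω} := hω
            simp only [Set.indicator_of_mem this]
            linarith [hh1 ω]
          · have : ω ∉ {ω | η < h ω} := hω
            simp only [Set.indicator_of_notMem this]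
            linarith
      _ = _ := by
          rw [integral_add (integrable_const _) hi, integral_indicator_const _ hs]
          simp
  have h5 : P.real {ω | η < h ω} ≤ P.real A' + P.real N' := by
    refine (measureReal_mono (fun ω hω => ?_) (measure_ne_top _ _)).trans (measureReal_union_le _ _)
    by_cases hN : ω ∈ N'
    · exact Or.inr hN
    · exact Or.inl (hA' ω hω hN)
  have h6 : P.real {ω | 1 - η ≤ f ω} ≤ ∫ ω, f ω ∂P + η := by
    have := measureReal_nonneg (μ := P) (s := {ω | 1 - η ≤ f ω})
    nlinarith
  linarith

/-- Averaging a comparison over an independent noise. -/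
lemma abs_integral_comp_noise_sub_le {α β : Type*} [MeasurableSpace α] [MeasurableSpace β]
    {X G : Ω → α} {ξ : Ω → β} (hX : Measurable X) (hG : Measurable G) (hξ : Measurable ξ)
    (hXξ : IndepFun X ξ P) (hGξ : IndepFun G ξ P) {f : α × β → ℝ} (hf : Measurable f)
    (hf0 : ∀ z, 0 ≤ f z) (hf1 : ∀ z, f z ≤ 1) {N : Set β} (hN : MeasurableSet N) {E₀ : ℝ}
    (hE₀ : 0 ≤ E₀)
    (h : ∀ e ∉ N, |∫ ω, f (X ω, e) ∂P - ∫ ω, f (G ω, e) ∂P| ≤ E₀) :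
    |∫ ω, f (X ω, ξ ω) ∂P - ∫ ω, f (G ω, ξ ω) ∂P| ≤ E₀ + P.real (ξ ⁻¹' N) := by
  have := Measure.isProbabilityMeasure_map (μ := P) hξ.aemeasurable
  have key : ∀ (Y : Ω → α), Measurable Y → IndepFun Y ξ P →
      Integrable (fun e => ∫ ω, f (Y ω, e) ∂P) (P.map ξ) ∧
      ∫ ω, f (Y ω, ξ ω) ∂P = ∫ e, ∫ ω, f (Y ω, e) ∂P ∂(P.map ξ) := by
    intro Y hY hYξ
    have := Measure.isProbabilityMeasure_map (μ := P) hY.aemeasurable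
    have hi : Integrable f ((P.map Y).prod (P.map ξ)) :=
      Integrable.of_bound hf.aestronglyMeasurable 1
        (ae_of_all _ fun z => by rw [Real.norm_eq_abs, abs_of_nonneg (hf0 z)]; exact hf1 z)
    have e1 : ∀ e, ∫ ω, f (Y ω, e) ∂P = ∫ x, f (x, e) ∂(P.map Y) := fun e =>
      (integral_map (f := fun x => f (x, e)) hY.aemeasurable
        (hf.comp (measurable_id.prodMk measurable_const)).aestronglyMeasurable).symm
    simp_rw [e1]
    refine ⟨hi.integral_prod_right, ?_⟩
    rw [← integral_prod_symm _ hi, ← (indepFun_iff_map_prod_eq_prod_map_map hY.aemeasurable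
      hξ.aemeasurable).1 hYξ, integral_map (hY.prodMk hξ).aemeasurable hf.aestronglyMeasurable]
  obtain ⟨i1, e1⟩ := key X hX hXξ
  obtain ⟨i2, e2⟩ := key G hG hGξ
  rw [e1, e2, ← integral_sub i1 i2]
  have hi : Integrable (N.indicator fun _ => (1 : ℝ)) (P.map ξ) := (integrable_const _).indicator hN
  refine abs_integral_le_integral_abs.trans ?_
  calc ∫ e, |∫ ω, f (X ω, e) ∂P - ∫ ω, f (G ω, e) ∂P| ∂(P.map ξ)
      ≤ ∫ e, (E₀ + N.indicator (fun _ => (1 : ℝ)) e) ∂(P.map ξ) := by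
        refine integral_mono (i1.sub i2).abs ((integrable_const _).add hi) fun e => ?_
        by_cases he : e ∈ N
        -- On the exceptional noise both integrals lie in [0, 1], so their difference costs at most
        -- the probability of N.
        · simp only [Set.indicator_of_mem he]
          have b : ∀ Y : Ω → α, Measurable Y →
              0 ≤ ∫ ω, f (Y ω, e) ∂P ∧ ∫ ω, f (Y ω, e) ∂P ≤ 1 := fun Y hY => by
            refine ⟨integral_nonneg fun _ => hf0 _, ?_⟩
            have hfy : Integrable (fun ω => f (Y ω, e)) P :=
              Integrable.of_bound (hf.comp (hY.prodMk measurable_const)).aestronglyMeasurable 1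
                (ae_of_all _ fun z => by rw [Real.norm_eq_abs, abs_of_nonneg (hf0 _)]; exact hf1 _)
            calc ∫ ω, f (Y ω, e) ∂P ≤ ∫ _, (1 : ℝ) ∂P :=
                  integral_mono hfy (integrable_const _) fun _ => hf1 _
              _ = 1 := by simp
          obtain ⟨a1, a2⟩ := b X hX
          obtain ⟨b1, b2⟩ := b G hG
          exact abs_le.2 ⟨by linarith, by linarith⟩
        · simp only [Set.indicator_of_notMem he, add_zero]
          exact h e he
    _ = _ := by
        rw [integral_add (integrable_const _) hi, integral_indicator_const _ hN,
          map_measureReal_apply hξ hN]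
        simp

end Events

/-! ### Soft minimum of the risk on a finite net -/

section SoftMin

variable {n p : ℕ}

/-- Keeping a single term of the sum, or bounding all of them by the largest, shows that −log Z is
within log|s| of the minimal energy. -/
lemma log_partitionFn_bounds {κ : Type*} {s : Finset κ} (hs : s.Nonempty) (E : κ → ℝ) :
    (∀ w ∈ s, -E w ≤ Real.log (partitionFn s E)) ∧
      ∀ a, (∀ w ∈ s, a ≤ E w) → Real.log (partitionFn s E) ≤ Real.log s.card - a := by
  have hpos := partitionFn_pos hs E
  constructor
  · intro w hw
    rw [Real.le_log_iff_exp_le hpos]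
    exact Finset.single_le_sum (f := fun w => Real.exp (-E w)) (fun _ _ => (Real.exp_pos _).le) hw
  · intro a ha
    have hcard : (0 : ℝ) < s.card := by exact_mod_cast hs.card_pos
    rw [Real.log_le_iff_le_exp hpos, sub_eq_add_neg, Real.exp_add, Real.exp_log hcard]
    unfold partitionFn
    refine (Finset.sum_le_card_nsmul s _ (Real.exp (-a)) fun w hw => ?_).trans (by simp)
    exact Real.exp_le_exp.2 (neg_le_neg (ha w hw))

lemma energy_eq_risk (l : RegressionLoss) (R : (Fin p → ℝ) → ℝ) {g : ℝ → ℝ} (θ : ℝ) (hn : 1 ≤ n)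
    (A : Fin n → Fin p → ℝ) (e : Fin n → ℝ) (w : Fin p → ℝ) {σ : ℝ} (hθ : 0 ≤ θ)
    (hg : ∀ t, |g t - l.fn t| ≤ σ) :
    |energy g θ (fun w => θ * n * R w) e A w - θ * n * risk l R A e w| ≤ θ * n * σ := by
  have hn0 : (n : ℝ) ≠ 0 := by positivity
  have e1 : energy g θ (fun w => θ * n * R w) e A w - θ * n * risk l R A e w =
      θ * ∑ i, (g (A i ⬝ᵥ w - e i) - l.fn (A i ⬝ᵥ w - e i)) := by
    have : risk l R A e w = (1 / (n : ℝ)) * ∑ i, l.fn (A i ⬝ᵥ w - e i) + R w := rfl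
    rw [this, energy, ← Finset.mul_sum, Finset.sum_sub_distrib]
    field_simp
    ring
  rw [e1, abs_mul, abs_of_nonneg hθ, mul_assoc]
  refine mul_le_mul_of_nonneg_left ?_ hθ
  refine (Finset.abs_sum_le_sum_abs _ _).trans ?_
  refine (Finset.sum_le_card_nsmul _ _ σ fun i _ => hg _).trans (by simp)

/-- The soft test function detects whether the minimum of the risk over the finite set `s` is above
or below the level `m`. -/
lemma softTest_sandwich (l : RegressionLoss) (R : (Fin p → ℝ) → ℝ) {g : ℝ → ℝ} {θ : ℝ}
    (hn : 1 ≤ n) (A : Fin n → Fin p → ℝ) (e : Fin n → ℝ) {σ γ K : ℝ} (hθ : 0 < θ)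
    (hg : ∀ t, |g t - l.fn t| ≤ σ) (hσ : σ ≤ γ / 2) (hK : 0 ≤ K)
    {s : Finset (Fin p → ℝ)} (hs : s.Nonempty) (hcard : Real.log s.card ≤ θ * n * (γ / 2)) (m : ℝ) :
    ((∀ w ∈ s, m + 2 * γ ≤ risk l R A e w) → 1 - Real.sigmoid (-(K * γ)) ≤
      softTest s g θ (fun w => θ * n * R w) (-(K / (θ * n))) (-(K * m)) e A) ∧
    ((∃ w ∈ s, risk l R A e w ≤ m - 2 * γ) →
      softTest s g θ (fun w => θ * n * R w) (-(K / (θ * n))) (-(K * m)) e A ≤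
        Real.sigmoid (-(K * γ))) := by
  have hn0 : (0 : ℝ) < n := by exact_mod_cast hn
  have hβ : 0 < θ * n := by positivity
  obtain ⟨h1, h2⟩ := log_partitionFn_bounds hs (energy g θ (fun w => θ * n * R w) e A)
  set Λ := Real.log (partitionFn s (energy g θ (fun w => θ * n * R w) e A)) with hΛ
  have hE : ∀ w, |energy g θ (fun w => θ * n * R w) e A w - θ * n * risk l R A e w| ≤ θ * n * σ :=
    fun w => energy_eq_risk l R θ hn A e w hθ.le hg
  -- The choice of k and of the shift makes the test function a sigmoid of slope K in the soft
  -- minimum −Λ/(θn), centred at m. Smoothing of the loss and entropy move the soft minimum by at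
  -- most γ/2 each.
  have hst : softTest s g θ (fun w => θ * n * R w) (-(K / (θ * n))) (-(K * m)) e A =
      Real.sigmoid (K * (-(Λ / (θ * n)) - m)) := by
    unfold softTest
    rw [← hΛ]
    congr 1
    field_simp
    ring
  have hβσ : θ * n * σ ≤ θ * n * (γ / 2) := mul_le_mul_of_nonneg_left hσ hβ.le
  rw [hst]
  constructor
  · intro h
    have hlow : Λ ≤ Real.log s.card - θ * n * (m + 2 * γ - γ / 2) := by
      refine h2 _ fun w hw => ?_
      have a := (abs_le.1 (hE w)).1
      have b := mul_le_mul_of_nonneg_left (h w hw) hβ.le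
      nlinarith
    have : Λ / (θ * n) ≤ -m - γ := by
      rw [div_le_iff₀ hβ]
      nlinarith
    rw [Real.sigmoid_neg, sub_sub_cancel]
    refine Real.sigmoid_le (mul_le_mul_of_nonneg_left ?_ hK)
    linarith
  · rintro ⟨w, hw, hle⟩
    have a := (abs_le.1 (hE w)).2
    have b := mul_le_mul_of_nonneg_left hle hβ.le
    have c := h1 w hw
    have hγ : θ * n * (γ / 2) ≤ θ * n * γ ∨ γ < 0 := by
      rcases le_or_gt 0 γ with h | h
      · left; gcongr; linarith
      · exact Or.inr h
    have hl0 : 0 ≤ Real.log s.card := Real.log_natCast_nonneg _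
    -- The sign is forced by 0 ≤ log|s| ≤ θnγ/2.
    have hγ0 : 0 ≤ γ := by
      by_contra hneg
      push Not at hneg
      nlinarith [mul_pos_of_neg_of_neg (neg_lt_zero.2 hβ) hneg]
    have : -m + γ ≤ Λ / (θ * n) := by
      rw [le_div_iff₀ hβ]
      nlinarith [mul_nonneg hβ.le hγ0]
    refine Real.sigmoid_le ?_
    rw [← mul_neg]
    refine mul_le_mul_of_nonneg_left ?_ hK
    linarith

/-- Modulus of continuity of the empirical loss on a bounded set. -/
lemma risk_le_of_close (l : RegressionLoss) (hc : l.growthFlag ≤ 1)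
    (R : (Fin p → ℝ) → ℝ) (hn : 1 ≤ n)
    (A : Fin n → Fin p → ℝ) (e : Fin n → ℝ) {L δ δ' K₀ : ℝ} (hL : 0 ≤ L) (hδ : 0 ≤ δ)
    {w w' : Fin p → ℝ} (hw : ∀ j, |w j| ≤ L) (hw' : ∀ j, |w' j| ≤ L)
    (hclose : ∀ j, |w j - w' j| ≤ δ) (hR : R w' ≤ R w + δ')
    (hA : ∑ i, (∑ j, |A i j|) ^ 2 ≤ (n : ℝ) ^ 3)
    (he : l.growthFlag * ∑ i, |e i| ^ 3 ≤ K₀ * n) :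
    risk l R A e w' ≤ risk l R A e w + l.slope * δ * (3 + (3 + 2 * L) * n ^ 2 + 2 * K₀) + δ' := by
  have hn0 : (0 : ℝ) < n := by exact_mod_cast hn
  have hc0 := l.growthFlag_nonneg
  have hsl := l.slope_pos
  set c := l.growthFlag
  have hdot : ∀ (i : Fin n) (v : Fin p → ℝ) (b : ℝ), (∀ j, |v j| ≤ b) →
      |A i ⬝ᵥ v| ≤ b * ∑ j, |A i j| := fun i v b hv => by
    rw [Finset.mul_sum]
    refine (Finset.abs_sum_le_sum_abs _ _).trans (Finset.sum_le_sum fun j _ => ?_)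
    rw [abs_mul, mul_comm]
    exact mul_le_mul_of_nonneg_right (hv j) (abs_nonneg _)
  have hpt : ∀ i, l.fn (A i ⬝ᵥ w' - e i) ≤ l.fn (A i ⬝ᵥ w - e i) +
      l.slope * δ * (3 + (3 + 2 * L) * (∑ j, |A i j|) ^ 2 + 2 * (c * |e i| ^ 3)) := by
    intro i
    have h := (abs_le.1 (l.abs_fn_sub_le (A i ⬝ᵥ w' - e i) (A i ⬝ᵥ w - e i))).2
    set S := ∑ j, |A i j| with hS
    have hS0 : 0 ≤ S := Finset.sum_nonneg fun _ _ => abs_nonneg _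
    have he0 := abs_nonneg (e i)
    have d1 : |A i ⬝ᵥ w' - e i - (A i ⬝ᵥ w - e i)| ≤ δ * S := by
      have : A i ⬝ᵥ w' - e i - (A i ⬝ᵥ w - e i) = A i ⬝ᵥ (w' - w) := by
        rw [dotProduct_sub]; ring
      rw [this]
      exact hdot i _ δ fun j => by rw [Pi.sub_apply, abs_sub_comm]; exact hclose j
    have d2 : |A i ⬝ᵥ w' - e i| + |A i ⬝ᵥ w - e i| ≤ 2 * L * S + 2 * |e i| := by
      have a1 := (abs_sub (A i ⬝ᵥ w') (e i)).trans (add_le_add_left (hdot i w' L hw') _)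
      have a2 := (abs_sub (A i ⬝ᵥ w) (e i)).trans (add_le_add_left (hdot i w L hw) _)
      linarith
    have hcube : |e i| ^ 2 ≤ 1 + |e i| ^ 3 := by
      nlinarith [mul_nonneg he0 (sq_nonneg (|e i| - 1)), sq_nonneg (|e i| - 1)]
    have d3 : S * (1 + c * (2 * L * S + 2 * |e i|)) ≤
        3 + (3 + 2 * L) * S ^ 2 + 2 * (c * |e i| ^ 3) := by
      have b1 : S ≤ 1 + S ^ 2 := by nlinarith [sq_nonneg (S - 1)]
      have b2 : 2 * (S * |e i|) ≤ S ^ 2 + (1 + |e i| ^ 3) := by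
        nlinarith [sq_nonneg (S - |e i|)]
      have b3 : c * (2 * L * S ^ 2) ≤ 1 * (2 * L * S ^ 2) :=
        mul_le_mul_of_nonneg_right hc (by positivity)
      have b4 := mul_le_mul_of_nonneg_left b2 hc0
      have b5 : c * S ^ 2 ≤ 1 * S ^ 2 := mul_le_mul_of_nonneg_right hc (by positivity)
      have b6 : 0 ≤ c * |e i| ^ 3 := by positivity
      nlinarith
    have d4 : l.slope * |A i ⬝ᵥ w' - e i - (A i ⬝ᵥ w - e i)| *
        (1 + c * (|A i ⬝ᵥ w' - e i| + |A i ⬝ᵥ w - e i|)) ≤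
        l.slope * (δ * S) * (1 + c * (2 * L * S + 2 * |e i|)) := by
      gcongr
    have d5 := mul_le_mul_of_nonneg_left d3 (mul_nonneg hsl.le hδ)
    linarith
  have hsum := Finset.sum_le_sum fun i (_ : i ∈ Finset.univ) => hpt i
  rw [Finset.sum_add_distrib, ← Finset.mul_sum, Finset.sum_add_distrib, Finset.sum_add_distrib,
    ← Finset.mul_sum, ← Finset.mul_sum, ← Finset.mul_sum, Finset.sum_const, Finset.card_univ,
    Fintype.card_fin, nsmul_eq_mul] at hsum
  have hbr : (n : ℝ) * 3 + (3 + 2 * L) * ∑ i, (∑ j, |A i j|) ^ 2 + 2 * (c * ∑ i, |e i| ^ 3) ≤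
      n * (3 + (3 + 2 * L) * n ^ 2 + 2 * K₀) := by
    have := mul_le_mul_of_nonneg_left hA (show 0 ≤ 3 + 2 * L by positivity)
    nlinarith
  have h2 := mul_le_mul_of_nonneg_left hbr (mul_nonneg hsl.le hδ)
  have h3 : (1 / (n : ℝ)) * ∑ i, l.fn (A i ⬝ᵥ w' - e i) ≤
      (1 / (n : ℝ)) * ∑ i, l.fn (A i ⬝ᵥ w - e i) +
      l.slope * δ * (3 + (3 + 2 * L) * n ^ 2 + 2 * K₀) := by
    have h4 := mul_le_mul_of_nonneg_left (hsum.trans (add_le_add_right h2 _))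
      (show 0 ≤ 1 / (n : ℝ) by positivity)
    refine h4.trans (le_of_eq ?_)
    field_simp
  have r1 : risk l R A e w = (1 / (n : ℝ)) * ∑ i, l.fn (A i ⬝ᵥ w - e i) + R w := rfl
  have r2 : risk l R A e w' = (1 / (n : ℝ)) * ∑ i, l.fn (A i ⬝ᵥ w' - e i) + R w' := rfl
  rw [r1, r2]
  linarith

end SoftMin

/-! ### Transfer of one-sided statements on the minimal risk -/

section Transfer

variable {Ω : Type*} [MeasurableSpace Ω] {P : Measure Ω} [IsProbabilityMeasure P] {n p : ℕ}

/-- A design for which the rows are too large to control the risk on a fine net. -/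
def largeDesign (n p : ℕ) : Set (Fin n → Fin p → ℝ) :=
  {A | (n : ℝ) ^ 3 < ∑ i, (∑ j, |A i j|) ^ 2}

/-- A noise vector with too large a third moment (no noise vector if the loss is Lipschitz). -/
def largeNoise (l : RegressionLoss) (n : ℕ) (K₀ : ℝ) : Set (Fin n → ℝ) :=
  {e | K₀ * n < l.growthFlag * ∑ i, |e i| ^ 3}

lemma measurableSet_largeNoise (l : RegressionLoss) (n : ℕ) (K₀ : ℝ) :
    MeasurableSet (largeNoise l n K₀) :=
  measurableSet_lt measurable_const (by fun_prop)

/-- Markov's inequality: the sum of squared ℓ¹ norms has mean at most n(pM'/√n)² = (pM')². The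
generous threshold n³ makes the probability O(1/n) when p is of order n. -/
lemma IsDesign.measureReal_largeDesign_le {A : Ω → Fin n → Fin p → ℝ}
    {Sig : Matrix (Fin p) (Fin p) ℝ} (hA : IsDesign P A Sig) (hn : 1 ≤ n) {M' : ℝ} (hM' : 0 ≤ M')
    {q : ENNReal} (hq2 : 2 ≤ q)
    (hq : ∀ i j, eLpNorm (fun ω => √(n : ℝ) * A ω i j) q P ≤ ENNReal.ofReal M') :
    P.real (A ⁻¹' largeDesign n p) ≤ (p * M') ^ 2 / (n : ℝ) ^ 3 := by
  have hn0 : (0 : ℝ) < n := by exact_mod_cast hn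
  have h := fun i => hA.integral_sum_abs_pow_le hn hM' hq i Finset.univ (m := 1)
    (by exact_mod_cast hq2)
  have hi : Integrable (fun ω => ∑ i, (∑ j, |A ω i j|) ^ 2) P :=
    integrable_finsetSum _ fun i _ => (h i).1
  have hint : ∫ ω, ∑ i, (∑ j, |A ω i j|) ^ 2 ∂P ≤ (p * M') ^ 2 := by
    rw [integral_finsetSum _ fun i _ => (h i).1]
    refine (Finset.sum_le_card_nsmul _ _ _ fun i _ => (h i).2).trans (le_of_eq ?_)
    rw [Finset.card_univ, Fintype.card_fin, Finset.card_univ, Fintype.card_fin, nsmul_eq_mul,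
      one_add_one_eq_two, mul_pow, div_pow, Real.sq_sqrt hn0.le]
    field_simp
  have hm := mul_meas_ge_le_integral_of_nonneg
    (ae_of_all P fun ω => Finset.sum_nonneg fun i _ => sq_nonneg (∑ j, |A ω i j|)) hi ((n : ℝ) ^ 3)
  rw [le_div_iff₀ (by positivity), mul_comm]
  refine le_trans (mul_le_mul_of_nonneg_left (measureReal_mono ?_ (measure_ne_top _ _))
    (by positivity)) (hm.trans hint)
  intro ω hω
  exact (show (n : ℝ) ^ 3 < _ from hω).le

/-- Transfer of one-sided statements on the minimum of the risk over a bounded set. -/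
theorem measureReal_risk_le (l : RegressionLoss) (hc : l.growthFlag ≤ 1)
    {R : (Fin p → ℝ) → ℝ} (hn : 1 ≤ n)
    {X G : Ω → Fin n → Fin p → ℝ} {ξ : Ω → Fin n → ℝ} (hX : Measurable X) (hG : Measurable G)
    (hξ : Measurable ξ) (hXξ : IndepFun X ξ P) (hGξ : IndepFun G ξ P) {g : ℝ → ℝ}
    (hgc : Continuous g) {σ γ K θ L δ K₀ E₀ πA πe : ℝ} (hg : ∀ t, |g t - l.fn t| ≤ σ)
    (hσ : σ ≤ γ / 2) (hγ : 0 < γ) (hK : 0 ≤ K) (hθ : 0 < θ) (hL : 0 ≤ L) (hδ : 0 < δ) (hE₀ : 0 ≤ E₀)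
    (hcard : p * Real.log (2 * (L / δ) + 2) ≤ θ * n * (γ / 2))
    (hmod : l.slope * δ * (3 + (3 + 2 * L) * n ^ 2 + 2 * K₀) ≤ γ / 2)
    (hcomp : ∀ s : Finset (Fin p → ℝ), s.Nonempty → (∀ w ∈ s, ∀ j, |w j| ≤ L) → ∀ m ρ,
      ∀ e ∉ largeNoise l n K₀,
      |∫ ω, softTest s g θ ρ (-(K / (θ * n))) m e (X ω) ∂P -
        ∫ ω, softTest s g θ ρ (-(K / (θ * n))) m e (G ω) ∂P| ≤ E₀)
    (hbX : P.real (X ⁻¹' largeDesign n p) ≤ πA) (hbG : P.real (G ⁻¹' largeDesign n p) ≤ πA)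
    (hbξ : P.real (ξ ⁻¹' largeNoise l n K₀) ≤ πe)
    {T : Set (Fin p → ℝ)} (hT : T.Nonempty) (hTL : ∀ w ∈ T, ∀ j, |w j| ≤ L)
    (hRT : BddBelow (R '' T)) (m : ℝ) :
    P.real {ω | ∀ w ∈ T, m + 2 * γ ≤ risk l R (X ω) (ξ ω) w} ≤
        P.real {ω | ∀ w ∈ T, m - 3 * γ ≤ risk l R (G ω) (ξ ω) w} +
          (2 * πA + 3 * πe + E₀ + 2 * Real.sigmoid (-(K * γ))) ∧
      P.real {ω | ∃ w ∈ T, risk l R (X ω) (ξ ω) w ≤ m - 3 * γ} ≤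
        P.real {ω | ∃ w ∈ T, risk l R (G ω) (ξ ω) w ≤ m + 2 * γ} +
          (2 * πA + 3 * πe + E₀ + 2 * Real.sigmoid (-(K * γ))) := by
  obtain ⟨s, hs, hsT, hscard, hnet⟩ := exists_net hT hL hδ (half_pos hγ) hTL hRT
  have hLδ : 0 ≤ L / δ := div_nonneg hL hδ.le
  have hlog : Real.log s.card ≤ θ * n * (γ / 2) := by
    have hcp : (0 : ℝ) < s.card := by exact_mod_cast hs.card_pos
    refine (Real.log_le_log hcp hscard).trans ?_
    rw [Real.log_pow]
    exact hcard
  set φ : (Fin n → Fin p → ℝ) × (Fin n → ℝ) → ℝ := fun z =>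
    softTest s g θ (fun w => θ * n * R w) (-(K / (θ * n))) (-(K * m)) z.2 z.1 with hφ
  have hφm : Measurable φ := (continuous_softTest hs hgc θ _ _ _).measurable
  have hφ0 : ∀ z, 0 ≤ φ z := fun z => Real.sigmoid_nonneg _
  have hφ1 : ∀ z, φ z ≤ 1 := fun z => Real.sigmoid_le_one _
  have hint := abs_le.1 (abs_integral_comp_noise_sub_le hX hG hξ hXξ hGξ hφm hφ0 hφ1
    (measurableSet_largeNoise l n K₀) hE₀
    fun e he => hcomp s hs (fun w hw => hTL w (hsT hw)) _ _ e he)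
  have hφi : ∀ Y : Ω → Fin n → Fin p → ℝ, Measurable Y →
      Measurable fun ω => φ (Y ω, ξ ω) := fun Y hY => hφm.comp (hY.prodMk hξ)
  have hφint : ∀ Y : Ω → Fin n → Fin p → ℝ, Measurable Y →
      Integrable (fun ω => φ (Y ω, ξ ω)) P := fun Y hY =>
    Integrable.of_bound (hφi Y hY).aestronglyMeasurable 1
      (ae_of_all _ fun ω => by rw [Real.norm_eq_abs, abs_of_nonneg (hφ0 _)]; exact hφ1 _)
  have hsand := fun A e => softTest_sandwich l R hn A e hθ hg hσ hK hs hlog m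
  -- Passing to the net loses γ: half from the continuity of the loss, half from the near-minimality
  -- of R.
  have hclose : ∀ Y : Ω → Fin n → Fin p → ℝ, ∀ ω,
      ω ∉ Y ⁻¹' largeDesign n p ∪ ξ ⁻¹' largeNoise l n K₀ → ∀ w ∈ T, ∃ w' ∈ s,
        risk l R (Y ω) (ξ ω) w' ≤ risk l R (Y ω) (ξ ω) w + γ := by
    intro Y ω hω w hw
    rw [Set.mem_union, not_or] at hω
    obtain ⟨w', hw', h1, h2⟩ := hnet w hw
    refine ⟨w', hw', ?_⟩
    have := risk_le_of_close l hc R hn (Y ω) (ξ ω) hL hδ.le (hTL w hw) (hTL w' (hsT hw')) h1 h2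
      (not_lt.1 hω.1) (not_lt.1 hω.2)
    linarith
  have hbad : P.real (X ⁻¹' largeDesign n p ∪ ξ ⁻¹' largeNoise l n K₀) +
      P.real (G ⁻¹' largeDesign n p ∪ ξ ⁻¹' largeNoise l n K₀) ≤ 2 * πA + 2 * πe := by
    have h1 := measureReal_union_le (μ := P) (X ⁻¹' largeDesign n p) (ξ ⁻¹' largeNoise l n K₀)
    have h2 := measureReal_union_le (μ := P) (G ⁻¹' largeDesign n p) (ξ ⁻¹' largeNoise l n K₀)
    linarith
  constructor
  -- The test function resolves m ± 2γ on s. The net costs a further γ only in bounding the risk on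
  -- T from below, which accounts for the asymmetric levels m + 2γ and m − 3γ. One πe comes from
  -- averaging over the noise, two from the exceptional events.
  · have := measureReal_le_of_sandwich (P := P) (hφi X hX) (hφi G hG) (fun _ => hφ0 _) (fun _ => hφ1 _)
      (fun _ => hφ1 _) (fun _ => hφ0 _) (Real.sigmoid_nonneg (-(K * γ)))
      (E := E₀ + P.real (ξ ⁻¹' largeNoise l n K₀)) (by linarith)
      (A := {ω | ∀ w ∈ T, m + 2 * γ ≤ risk l R (X ω) (ξ ω) w})
      (A' := {ω | ∀ w ∈ T, m - 3 * γ ≤ risk l R (G ω) (ξ ω) w})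
      (N := X ⁻¹' largeDesign n p ∪ ξ ⁻¹' largeNoise l n K₀)
      (N' := G ⁻¹' largeDesign n p ∪ ξ ⁻¹' largeNoise l n K₀)
      (fun ω hω _ => (hsand _ _).1 fun w hw => hω w (hsT hw))
      (fun ω hω hN w hw => by
        obtain ⟨w', hw', hle⟩ := hclose G ω hN w hw
        by_contra hlt
        push Not at hlt
        exact absurd ((hsand (G ω) (ξ ω)).2 ⟨w', hw', by linarith⟩) (not_le.2 hω))
    linarith
  -- For the events of a small minimum the same comparison is applied to 1 − φ.
  · have hsub : ∀ Y : Ω → Fin n → Fin p → ℝ, Measurable Y →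
        ∫ ω, (1 - φ (Y ω, ξ ω)) ∂P = 1 - ∫ ω, φ (Y ω, ξ ω) ∂P := fun Y hY => by
      rw [integral_sub (integrable_const _) (hφint Y hY)]
      simp
    have := measureReal_le_of_sandwich (P := P) (f := fun ω => 1 - φ (X ω, ξ ω))
      (h := fun ω => 1 - φ (G ω, ξ ω)) ((hφi X hX).const_sub 1) ((hφi G hG).const_sub 1)
      (fun _ => sub_nonneg.2 (hφ1 _)) (fun _ => sub_le_self _ (hφ0 _))
      (fun _ => sub_le_self _ (hφ0 _)) (fun _ => sub_nonneg.2 (hφ1 _))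
      (Real.sigmoid_nonneg (-(K * γ)))
      (E := E₀ + P.real (ξ ⁻¹' largeNoise l n K₀))
      (by rw [hsub X hX, hsub G hG]; linarith)
      (A := {ω | ∃ w ∈ T, risk l R (X ω) (ξ ω) w ≤ m - 3 * γ})
      (A' := {ω | ∃ w ∈ T, risk l R (G ω) (ξ ω) w ≤ m + 2 * γ})
      (N := X ⁻¹' largeDesign n p ∪ ξ ⁻¹' largeNoise l n K₀)
      (N' := G ⁻¹' largeDesign n p ∪ ξ ⁻¹' largeNoise l n K₀)
      (fun ω hω hN => by
        obtain ⟨w, hw, hle⟩ := hω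
        obtain ⟨w', hw', hle'⟩ := hclose X ω hN w hw
        exact sub_le_sub_left ((hsand (X ω) (ξ ω)).2 ⟨w', hw', by linarith⟩) 1)
      (fun ω hω _ => by
        by_contra hne
        simp only [Set.mem_ofPred_eq, not_exists, not_and, not_le] at hne
        have := (hsand (G ω) (ξ ω)).1 fun w hw => (hne w (hsT hw)).le
        linarith)
    linarith

end Transfer

/-! ### From minimal risks to the position of the estimators -/

section Estimator

variable {Ω : Type*} [MeasurableSpace Ω] {P : Measure Ω} [IsProbabilityMeasure P] {n p : ℕ}

lemma le_minRisk_iff {l : RegressionLoss} {R : (Fin p → ℝ) → ℝ} {A : Fin n → Fin p → ℝ}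
    {e : Fin n → ℝ} {S : Set (Fin p → ℝ)} {a : ℝ} :
    (a : EReal) ≤ minRisk l R A e S ↔ ∀ w ∈ S, a ≤ risk l R A e w := by
  simp [minRisk, le_iInf_iff]

lemma minRisk_le_of_mem {l : RegressionLoss} {R : (Fin p → ℝ) → ℝ} {A : Fin n → Fin p → ℝ}
    {e : Fin n → ℝ} {S : Set (Fin p → ℝ)} {w : Fin p → ℝ} (hw : w ∈ S) :
    minRisk l R A e S ≤ (risk l R A e w : EReal) := iInf₂_le w hw

/-- Comparison of the probabilities that the two estimators lie in `S`. -/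
theorem abs_measureReal_mem_sub_le {l : RegressionLoss} {R : (Fin p → ℝ) → ℝ}
    {X G : Ω → Fin n → Fin p → ℝ} {ξ : Ω → Fin n → ℝ} {wX wG : Ω → Fin p → ℝ}
    (hwX : ∀ᵐ ω ∂P, IsMinOn (risk l R (X ω) (ξ ω)) Set.univ (wX ω))
    (hwG : ∀ᵐ ω ∂P, IsMinOn (risk l R (G ω) (ξ ω)) Set.univ (wG ω))
    {S : Set (Fin p → ℝ)} {ε z ρ₀ L E : ℝ} (hρ₀ : 0 < ρ₀) (hL : 0 ≤ L) (hE : 0 ≤ E)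
    (hXL : P.real {ω | L < ‖wX ω‖} ≤ ε) (hGL : P.real {ω | L < ‖wG ω‖} ≤ ε)
    (hall : P.real {ω | ((z + ρ₀ : ℝ) : EReal) ≤ minRisk l R (G ω) (ξ ω) Set.univ} ≤ ε)
    (hS : P.real {ω | minRisk l R (G ω) (ξ ω) S ≤ ((z + 2 * ρ₀ : ℝ) : EReal)} ≤ ε)
    (htr : ∀ T : Set (Fin p → ℝ), T.Nonempty → (∀ w ∈ T, ∀ j, |w j| ≤ L) → ∀ m,
      P.real {ω | ∀ w ∈ T, m + ρ₀ / 5 ≤ risk l R (X ω) (ξ ω) w} ≤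
          P.real {ω | ∀ w ∈ T, m - 3 * ρ₀ / 10 ≤ risk l R (G ω) (ξ ω) w} + E ∧
        P.real {ω | ∃ w ∈ T, risk l R (X ω) (ξ ω) w ≤ m - 3 * ρ₀ / 10} ≤
          P.real {ω | ∃ w ∈ T, risk l R (G ω) (ξ ω) w ≤ m + ρ₀ / 5} + E) :
    |P.real {ω | wX ω ∈ S} - P.real {ω | wG ω ∈ S}| ≤ 4 * ε + 2 * E := by
  set box : Set (Fin p → ℝ) := {w | ∀ j, |w j| ≤ L} with hbox
  have hmem : ∀ w : Fin p → ℝ, ¬ L < ‖w‖ → w ∈ box := fun w hw j => by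
    rw [not_lt, pi_norm_le_iff_of_nonneg hL] at hw
    exact hw j
  have hcup : ∀ {A B C : Set Ω}, A ≤ᵐ[P] (B ∪ C : Set Ω) → P.real A ≤ P.real B + P.real C :=
    fun h => (ENNReal.toReal_mono (measure_ne_top _ _) (measure_mono_ae h)).trans
      (measureReal_union_le _ _)
  have hε : 0 ≤ ε := measureReal_nonneg.trans hXL
  -- If ŵ_G lies in S, its risk is both the global minimum and an upper bound for the infimum over
  -- S, so one of the two events of (ii) occurs.
  have hG2 : P.real {ω | wG ω ∈ S} ≤ 2 * ε := by
    have := hcup (A := {ω | wG ω ∈ S})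
      (B := {ω | ((z + ρ₀ : ℝ) : EReal) ≤ minRisk l R (G ω) (ξ ω) Set.univ})
      (C := {ω | minRisk l R (G ω) (ξ ω) S ≤ ((z + 2 * ρ₀ : ℝ) : EReal)}) (by
        filter_upwards [hwG] with ω hω hωS
        rcases le_or_gt (z + ρ₀) (risk l R (G ω) (ξ ω) (wG ω)) with h | h
        · exact Or.inl (le_minRisk_iff.2 fun w _ => h.trans (hω (Set.mem_univ w)))
        · refine Or.inr ((minRisk_le_of_mem hωS).trans (EReal.coe_le_coe_iff.2 ?_))
          linarith)
    linarith
  have hbG : P.real {ω | ∀ w ∈ box, z + ρ₀ ≤ risk l R (G ω) (ξ ω) w} ≤ 2 * ε := by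
    have := hcup (A := {ω | ∀ w ∈ box, z + ρ₀ ≤ risk l R (G ω) (ξ ω) w})
      (B := {ω | ((z + ρ₀ : ℝ) : EReal) ≤ minRisk l R (G ω) (ξ ω) Set.univ})
      (C := {ω | L < ‖wG ω‖}) (by
        filter_upwards [hwG] with ω hω hωb
        by_cases h : L < ‖wG ω‖
        · exact Or.inr h
        · exact Or.inl (le_minRisk_iff.2 fun w _ =>
            (hωb _ (hmem _ h)).trans (hω (Set.mem_univ w))))
    linarith
  -- The transfer window has width ρ₀/2. Here m = z + 13ρ₀/10 moves z + ρ₀ up to z + 3ρ₀/2; below, m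
  -- = z + 9ρ₀/5 moves z + 2ρ₀ down to the same level.
  have hbX : P.real {ω | ∀ w ∈ box, z + 3 * ρ₀ / 2 ≤ risk l R (X ω) (ξ ω) w} ≤ 2 * ε + E := by
    have := (htr box ⟨0, fun j => by simpa using hL⟩ (fun w hw => hw) (z + 13 * ρ₀ / 10)).1
    rw [show z + 13 * ρ₀ / 10 + ρ₀ / 5 = z + 3 * ρ₀ / 2 by ring,
      show z + 13 * ρ₀ / 10 - 3 * ρ₀ / 10 = z + ρ₀ by ring] at this
    linarith
  have hSX : P.real {ω | ∃ w ∈ S ∩ box, risk l R (X ω) (ξ ω) w ≤ z + 3 * ρ₀ / 2} ≤ ε + E := by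
    rcases (S ∩ box).eq_empty_or_nonempty with h | h
    · simp [h]
      positivity
    have := (htr (S ∩ box) h (fun w hw => hw.2) (z + 9 * ρ₀ / 5)).2
    rw [show z + 9 * ρ₀ / 5 + ρ₀ / 5 = z + 2 * ρ₀ by ring,
      show z + 9 * ρ₀ / 5 - 3 * ρ₀ / 10 = z + 3 * ρ₀ / 2 by ring] at this
    have h2 : P.real {ω | ∃ w ∈ S ∩ box, risk l R (G ω) (ξ ω) w ≤ z + 2 * ρ₀} ≤ ε := by
      refine (measureReal_mono ?_ (measure_ne_top _ _)).trans hS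
      rintro ω ⟨w, hw, hle⟩
      exact (minRisk_le_of_mem hw.1).trans (EReal.coe_le_coe_iff.2 hle)
    linarith
  have hX4 : P.real {ω | wX ω ∈ S} ≤ 4 * ε + 2 * E := by
    have h1 := hcup (A := {ω | wX ω ∈ S}) (B := {ω | L < ‖wX ω‖})
      (C := {ω | ∃ w ∈ S ∩ box, risk l R (X ω) (ξ ω) w ≤ z + 3 * ρ₀ / 2} ∪
        {ω | ∀ w ∈ box, z + 3 * ρ₀ / 2 ≤ risk l R (X ω) (ξ ω) w}) (by
        filter_upwards [hwX] with ω hω hωS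
        by_cases h : L < ‖wX ω‖
        · exact Or.inl h
        · rcases le_or_gt (risk l R (X ω) (ξ ω) (wX ω)) (z + 3 * ρ₀ / 2) with h' | h'
          · exact Or.inr (Or.inl ⟨_, ⟨hωS, hmem _ h⟩, h'⟩)
          · exact Or.inr (Or.inr fun w _ => h'.le.trans (hω (Set.mem_univ w))))
    have h2 := measureReal_union_le (μ := P)
      {ω | ∃ w ∈ S ∩ box, risk l R (X ω) (ξ ω) w ≤ z + 3 * ρ₀ / 2}
      {ω | ∀ w ∈ box, z + 3 * ρ₀ / 2 ≤ risk l R (X ω) (ξ ω) w}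
    linarith
  have := measureReal_nonneg (μ := P) (s := {ω | wX ω ∈ S})
  have := measureReal_nonneg (μ := P) (s := {ω | wG ω ∈ S})
  exact abs_le.2 ⟨by linarith, by linarith⟩

end Estimator

/-- A finite convex function on ℝ^p is continuous, hence bounded below on a compact box. Convexity
enters only here, to make near-minimizers of R in each cube available. -/
lemma bddBelow_image_of_convexOn {p : ℕ} {R : (Fin p → ℝ) → ℝ} (hR : ConvexOn ℝ Set.univ R)
    {T : Set (Fin p → ℝ)} {L : ℝ} (hT : ∀ w ∈ T, ∀ j, |w j| ≤ L) : BddBelow (R '' T) := by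
  have hc : Continuous R := by
    have := hR.continuousOn isOpen_univ
    rwa [continuousOn_univ] at this
  have hK : IsCompact (Set.Icc (fun _ : Fin p => -L) (fun _ => L)) := isCompact_Icc
  refine (hK.image hc).bddBelow.mono (Set.image_mono fun w hw => ?_)
  exact ⟨fun j => (abs_le.1 (hT w hw j)).1, fun j => (abs_le.1 (hT w hw j)).2⟩

/-! ### Exponents and growth constants of the losses -/

namespace RegressionLoss

/-- The exponent `q̄₀` as a natural number. -/
def growthExponent : RegressionLoss → ℕ
  | squared => 4
  | absolute => 0
  | huber _ _ => 0

lemma qBold_squared : qBold squared = 3 / 2 := by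
  norm_num [qBold, qOne, qTwo, qThree]

lemma qBar_eq (l : RegressionLoss) : l.qBar = l.growthExponent := by
  cases l with
  | squared =>
    have : ⌈(3 / 2 : ℝ)⌉ = 2 := by rw [Int.ceil_eq_iff]; norm_num
    rw [qBar, qBold_squared]
    norm_num [qZero, growthExponent, this]
  | absolute => norm_num [qBar, qZero, qBold, qOne, qTwo, qThree, growthExponent]
  | huber η hη => norm_num [qBar, qZero, qBold, qOne, qTwo, qThree, growthExponent]

lemma four_le_qStar (l : RegressionLoss) : 4 ≤ l.qStar := by
  rw [qStar, qBar_eq]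
  cases l <;> norm_num [growthExponent]

/-- The moment order q* is 16 for the squared loss and 4 for the others; sixth moments of the cells
are needed only when the flag is 1. -/
lemma growthFlag_cases (l : RegressionLoss) :
    l.growthFlag = 0 ∨ l.growthFlag = 1 ∧ 6 ≤ ENNReal.ofReal l.qStar := by
  cases l with
  | squared =>
    refine Or.inr ⟨rfl, ?_⟩
    rw [qStar, qBar_eq]
    norm_num [growthExponent]
  | absolute => exact Or.inl rfl
  | huber η hη => exact Or.inl rfl

lemma growthFlag_le_one (l : RegressionLoss) : l.growthFlag ≤ 1 := by
  rcases l.growthFlag_cases with h | h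
  · rw [h]; exact zero_le_one
  · exact h.1.le

/-- The factor L⁴ comes from the squared variance and the fourth moment of a row; the flag retains
it only when q̄₀ = 4. -/
lemma one_add_growthFlag_mul_pow_le (l : RegressionLoss) {b L : ℝ} (hb : 0 ≤ b) (hL : 1 ≤ L) :
    5 + 16 * l.growthFlag * (b * L ^ 4) ≤ (5 + 16 * b) * L ^ l.growthExponent := by
  cases l with
  | squared =>
    simp only [growthFlag, growthExponent, mul_one]
    have : 1 ≤ L ^ 4 := one_le_pow₀ hL
    nlinarith
  | absolute => simp [growthFlag, growthExponent, hb]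
  | huber η hη => simp [growthFlag, growthExponent, hb]

/-- The growth constants of the losses control the third moment of the noise. -/
lemma growthFlag_mul_sum_le (l : RegressionLoss) {n : ℕ} {e Lloss : Fin n → ℝ}
    (h1 : ∀ i, 1 ≤ Lloss i)
    (h : ∀ i, ∀ x : ℝ, |l.fn (x - e i)| / (1 + |x| ^ l.qZero) ≤ Lloss i) :
    l.growthFlag * ∑ i, |e i| ^ 3 ≤ ∑ i, Lloss i ^ l.qBold := by
  have hnn : 0 ≤ ∑ i, Lloss i ^ l.qBold :=
    Finset.sum_nonneg fun i _ => Real.rpow_nonneg (zero_le_one.trans (h1 i)) _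
  cases l with
  | squared =>
    rw [growthFlag, one_mul]
    refine Finset.sum_le_sum fun i _ => ?_
    -- At x = 0 the growth condition reads eᵢ² ≤ L_{ℓᵢ}; raising it to the power 3/2 gives the cube.
    have h2 := h i 0
    simp only [fn, qZero, zero_sub, even_two, Even.neg_pow, abs_pow, sq_abs, abs_zero] at h2
    rw [Real.zero_rpow two_ne_zero, add_zero, div_one] at h2
    rw [qBold_squared]
    calc |e i| ^ 3 = (e i ^ 2) ^ (3 / 2 : ℝ) := by
          rw [← sq_abs, ← Real.rpow_natCast |e i| 2, ← Real.rpow_mul (abs_nonneg _)]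
          norm_num
      _ ≤ _ := Real.rpow_le_rpow (sq_nonneg _) h2 (by norm_num)
  | absolute => simpa [growthFlag] using hnn
  | huber η hη => simpa [growthFlag] using hnn

end RegressionLoss

/-! ### Explicit comparison at fixed sample size -/

section FixedDimension

variable {Ω : Type*} [MeasurableSpace Ω] {P : Measure Ω} [IsProbabilityMeasure P] {n p : ℕ}

/-- The comparison of the two estimators at a fixed sample size, with explicit error. -/
theorem abs_measureReal_mem_sub_le_of_blockDependent (l : RegressionLoss) (hn : 1 ≤ n)
    {Sig : Matrix (Fin p) (Fin p) ℝ} (hSig : Sig.PosDef) {X G : Ω → Fin n → Fin p → ℝ}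
    (hX : IsDesign P X Sig) (hG : IsGaussianDesign P G Sig) {ξ : Ω → Fin n → ℝ}
    (hξ : Measurable ξ) (hXξ : IndepFun X ξ P) (hGξ : IndepFun G ξ P)
    {M M' : ℝ} (hM0 : 0 ≤ M) (hSigM : lambdaMax Sig ≤ M) (hMM' : M ≤ M')
    (hM'G : √M * gaussianNorm (ENNReal.ofReal l.qStar) ≤ M')
    (hXM : ∀ i j, eLpNorm (fun ω => √(n : ℝ) * X ω i j) (ENNReal.ofReal l.qStar) P ≤
      ENNReal.ofReal M)
    {d : ℕ} (hd : ∀ i, BlockDependent P (fun ω => X ω i) d)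
    {R : (Fin p → ℝ) → ℝ} (hR : ConvexOn ℝ Set.univ R) {wX wG : Ω → Fin p → ℝ}
    (hwX : ∀ᵐ ω ∂P, IsMinOn (risk l R (X ω) (ξ ω)) Set.univ (wX ω))
    (hwG : ∀ᵐ ω ∂P, IsMinOn (risk l R (G ω) (ξ ω)) Set.univ (wG ω))
    {S : Set (Fin p → ℝ)} {ε z ρ₀ L : ℝ} (hρ₀ : 0 < ρ₀) (hL : 0 ≤ L)
    (hXL : P.real {ω | L < ‖wX ω‖} ≤ ε) (hGL : P.real {ω | L < ‖wG ω‖} ≤ ε)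
    (hall : P.real {ω | ((z + ρ₀ : ℝ) : EReal) ≤ minRisk l R (G ω) (ξ ω) Set.univ} ≤ ε)
    (hS : P.real {ω | minRisk l R (G ω) (ξ ω) S ≤ ((z + 2 * ρ₀ : ℝ) : EReal)} ≤ ε)
    {g g₁ g₂ g₃ V : ℝ → ℝ} {C : ℝ} (hg : IsTame g g₁ g₂ g₃ V l.growthFlag C)
    (hgl : ∀ t, |g t - l.fn t| ≤ ρ₀ / 20) {K θ δ K₀ E₀ πe : ℝ} (hK : 0 ≤ K) (hθ : 1 ≤ θ)
    (hKθ : K / (θ * n) ≤ 1) (hδ : 0 < δ) (hK₀ : 0 ≤ K₀)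
    (hcard : p * Real.log (2 * (L / δ) + 2) ≤ θ * n * (ρ₀ / 20))
    (hmod : l.slope * δ * (3 + (3 + 2 * L) * n ^ 2 + 2 * K₀) ≤ ρ₀ / 20)
    (hr : L * (d * (M' / √(n : ℝ))) ≤ 1)
    (hE₀ : 46 * (K / (θ * n)) * (θ * C) ^ 3 * C * ((L * (M' / √(n : ℝ))) ^ 3 * (d ^ 2 * p)) *
      (n * (5 + 16 * l.growthFlag * (1 + 3 * (M * (p * L ^ 2) / n) ^ 2 +
          (L * (M' / √(n : ℝ))) ^ 4 * (d ^ 3 * p) + K₀))) ≤ E₀)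
    (hπe : P.real (ξ ⁻¹' largeNoise l n K₀) ≤ πe) :
    |P.real {ω | wX ω ∈ S} - P.real {ω | wG ω ∈ S}| ≤ 4 * ε +
      2 * (2 * ((p * M') ^ 2 / (n : ℝ) ^ 3) + 3 * πe + E₀ + 2 * Real.sigmoid (-(K * (ρ₀ / 10)))) := by
  have hn0 : (0 : ℝ) < n := by exact_mod_cast hn
  have hθ0 : 0 < θ := one_pos.trans_le hθ
  have hM' : 0 ≤ M' := hM0.trans hMM'
  have hC := hg.one_le
  have hc := l.growthFlag_nonneg
  have ht : 0 ≤ K / (θ * n) := by positivity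
  have hq4 : 4 ≤ ENNReal.ofReal l.qStar := by
    rw [← ENNReal.ofReal_ofNat]
    exact ENNReal.ofReal_le_ofReal l.four_le_qStar
  have hXM' : ∀ i j, eLpNorm (fun ω => √(n : ℝ) * X ω i j) (ENNReal.ofReal l.qStar) P ≤
      ENNReal.ofReal M' := fun i j => (hXM i j).trans (ENNReal.ofReal_le_ofReal hMM')
  have hGM' : ∀ i j, eLpNorm (fun ω => √(n : ℝ) * G ω i j) (ENNReal.ofReal l.qStar) P ≤
      ENNReal.ofReal M' := fun i j => (hG.eLpNorm_le hSig hn hSigM i j ENNReal.ofReal_ne_top).trans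
        (ENNReal.ofReal_le_ofReal hM'G)
  have hGd := hG.isDesign hSig
  -- The partition may vary with the row. It also splits the rows of G: Σ vanishes across blocks,
  -- and uncorrelated jointly Gaussian blocks are independent.
  choose k _ B hdisj hcov hBd hBX using hd
  have hBG := fun i => hG.iIndepFun_blocks hSig i (B := B i)
    fun a b hab j hj m hm => hX.sig_eq_zero hn i (hBX i) hab hj hm
  have hE₀0 : 0 ≤ E₀ := le_trans (by positivity) hE₀
  have hsig := Real.sigmoid_nonneg (-(K * (ρ₀ / 10)))
  have hπ0 : 0 ≤ πe := measureReal_nonneg.trans hπe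
  refine abs_measureReal_mem_sub_le hwX hwG hρ₀ hL (by positivity) hXL hGL hall hS
    fun T hT hTL m => ?_
  have := measureReal_risk_le (P := P) (γ := ρ₀ / 10) l l.growthFlag_le_one hn
    hX.measurable hG.measurable hξ hXξ hGξ
    (continuous_iff_continuousAt.2 fun t => (hg.deriv₁ t).continuousAt) hgl (by linarith)
    (by positivity) hK hθ0 hL hδ hE₀0 (by convert hcard using 2; ring) (by linarith)
    (fun s hs hsL m ρ e he => ?_)
    (hX.measureReal_largeDesign_le hn hM' (le_trans (by norm_num) hq4) hXM')
    (hGd.measureReal_largeDesign_le hn hM' (le_trans (by norm_num) hq4) hGM') hπe hT hTL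
    (bddBelow_image_of_convexOn hR hTL) m
  · rwa [show m + 2 * (ρ₀ / 10) = m + ρ₀ / 5 by ring,
      show m - 3 * (ρ₀ / 10) = m - 3 * ρ₀ / 10 by ring] at this
  · refine (abs_integral_softTest_design_sub_le hX hGd hn hSig.posSemidef hSigM hM0 hM' hq4 hXM' hGM'
      hg l.growthFlag_cases k B hBd hdisj hcov hBX hBG hs hL hsL hr m hθ
      (by rwa [abs_neg, abs_of_nonneg ht]) ρ e).trans (le_trans ?_ hE₀)
    rw [abs_neg, abs_of_nonneg ht]
    refine mul_le_mul_of_nonneg_left ?_ (by positivity)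
    have he' : l.growthFlag * ∑ i, |e i| ^ 3 ≤ K₀ * n := not_lt.1 he
    rw [Finset.sum_add_distrib, ← Finset.mul_sum, Finset.sum_add_distrib, Finset.sum_const,
      Finset.sum_const, Finset.card_univ, Fintype.card_fin, nsmul_eq_mul, nsmul_eq_mul]
    set b := 1 + 3 * (M * (p * L ^ 2) / n) ^ 2 + (L * (M' / √(n : ℝ))) ^ 4 * (d ^ 3 * p)
    rcases l.growthFlag_cases with h | h
    · rw [h]
      simp
    · rw [h.1] at he' ⊢
      linarith

end FixedDimension

/-! ### Rates: vanishing of all error terms -/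

section Asymptotics

/-- The growth conditions on the box size and on the block size force the error of the comparison
to vanish. -/
lemma tendsto_error {L : ℕ → ℝ} {d : ℕ → ℕ} {α κ : ℝ} (r : ℕ) (hκ : 0 ≤ κ)
    (hL : L =O[atTop] fun n => (n : ℝ) ^ α * Real.log n ^ κ)
    (hd : (fun n => (d n : ℝ)) =o[atTop] fun n =>
      (n : ℝ) ^ (1 / 4 - (r + 3) * α / 2) / Real.log n ^ (6 + (2 * r + 6) * κ)) :
    Tendsto (fun n : ℕ => Real.log n ^ 2 * ((d n : ℝ) ^ 2 * L n ^ (r + 3)) / √(n : ℝ)) atTop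
      (𝓝 0) := by
  have h := (hd.pow (n := 2) two_pos).mul_isBigO (hL.pow (r + 3))
  have h2 : (fun n : ℕ => (d n : ℝ) ^ 2 * L n ^ (r + 3)) =o[atTop]
      fun n : ℕ => √(n : ℝ) / Real.log n ^ 2 := by
    refine h.trans_isBigO (IsBigO.of_bound 1 ?_)
    have hlog : Tendsto (fun n : ℕ => Real.log n) atTop atTop :=
      Real.tendsto_log_atTop.comp tendsto_natCast_atTop_atTop
    filter_upwards [hlog.eventually_ge_atTop 1, eventually_gt_atTop 0] with n h1 hn
    have hn0 : (0 : ℝ) < n := by exact_mod_cast hn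
    set ℓ := Real.log n
    have hℓ : 0 < ℓ := one_pos.trans_le h1
    -- The powers n^α cancel, 2(1/4 − (r + 3)α/2) + (r + 3)α = 1/2, and the logarithmic exponent has
    -- room to spare over the −2 required.
    have e1 : ((n : ℝ) ^ (1 / 4 - (r + 3) * α / 2) / ℓ ^ (6 + (2 * r + 6) * κ)) ^ 2 *
        ((n : ℝ) ^ α * ℓ ^ κ) ^ (r + 3) = √(n : ℝ) * ℓ ^ (-12 - (3 * r + 9) * κ) := by
      simp only [← Real.rpow_natCast, Real.sqrt_eq_rpow]
      rw [Real.div_rpow (by positivity) (by positivity), Real.mul_rpow (by positivity) (by positivity),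
        ← Real.rpow_mul hn0.le, ← Real.rpow_mul hn0.le, ← Real.rpow_mul hℓ.le, ← Real.rpow_mul hℓ.le,
        div_eq_mul_inv, ← Real.rpow_neg hℓ.le, mul_mul_mul_comm, ← Real.rpow_add hn0,
        ← Real.rpow_add hℓ]
      congr 2 <;> push_cast <;> ring
    have e2 : ℓ ^ (-12 - (3 * r + 9) * κ) ≤ (ℓ ^ 2)⁻¹ := by
      rw [← Real.rpow_natCast, ← Real.rpow_neg hℓ.le]
      refine Real.rpow_le_rpow_of_exponent_le h1 ?_
      have : 0 ≤ (3 * (r : ℝ) + 9) * κ := by positivity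
      push_cast
      linarith
    rw [e1, one_mul, Real.norm_of_nonneg (by positivity), Real.norm_of_nonneg (by positivity),
      div_eq_mul_inv]
    exact mul_le_mul_of_nonneg_left e2 (Real.sqrt_nonneg _)
  refine h2.tendsto_div_nhds_zero.congr fun n => ?_
  rw [div_div_eq_mul_div, mul_comm (_ * _)]

lemma BlockDependent.one_le {Ω : Type*} [MeasurableSpace Ω] {P : Measure Ω} {p : ℕ}
    {Z : Ω → Fin p → ℝ} {d : ℕ} (h : BlockDependent P Z d) (hp : 1 ≤ p) : 1 ≤ d := by
  obtain ⟨k, -, B, -, hcov, hcard, -⟩ := h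
  obtain ⟨a, ha⟩ := hcov ⟨0, hp⟩
  exact le_trans (Finset.card_pos.2 ⟨_, ha⟩) (hcard a)

/-- Bound of the comparison error by the quantity in `tendsto_error`. -/
lemma comparison_error_le (l : RegressionLoss) {n p d : ℝ} {L M M' τ K C Θ K₀ : ℝ} (hn : 1 ≤ n)
    (hτ : 0 < τ) (hp0 : 0 ≤ p) (hp : p ≤ n / τ) (hd : 1 ≤ d) (hd3 : d ^ 3 ≤ n) (hL : 1 ≤ L)
    (hM : 0 ≤ M) (hM' : 0 ≤ M') (hK : 0 ≤ K) (hC : 1 ≤ C) (hΘ : 0 < Θ) (hK₀ : 0 ≤ K₀) {t : ℝ}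
    (ht : 1 ≤ t) :
    46 * (K / (Θ * t * n)) * (Θ * t * C) ^ 3 * C * ((L * (M' / √n)) ^ 3 * (d ^ 2 * p)) *
      (n * (5 + 16 * l.growthFlag * (1 + 3 * (M * (p * L ^ 2) / n) ^ 2 +
          (L * (M' / √n)) ^ 4 * (d ^ 3 * p) + K₀))) ≤
      46 * K * C ^ 4 * Θ ^ 2 * M' ^ 3 / τ * (5 + 16 * (1 + 3 * (M / τ) ^ 2 + M' ^ 4 / τ + K₀)) *
        (t ^ 2 * (d ^ 2 * L ^ (l.growthExponent + 3)) / √n) := by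
  have hn0 : 0 < n := one_pos.trans_le hn
  have hL0 : 0 < L := one_pos.trans_le hL
  have ht0 : 0 < t := one_pos.trans_le ht
  have hc := l.growthFlag_nonneg
  have hpn : p / n ≤ 1 / τ := by
    rw [div_le_div_iff₀ hn0 hτ]
    have := (le_div_iff₀ hτ).1 hp
    linarith
  have hpn0 : 0 ≤ p / n := by positivity
  set u := √n with hu
  have hu0 : 0 < u := Real.sqrt_pos.2 hn0
  have hun : n = u ^ 2 := (Real.sq_sqrt hn0.le).symm
  have hL4 : 1 ≤ L ^ 4 := one_le_pow₀ hL
  have a1 : (M * (p * L ^ 2) / n) ^ 2 ≤ (M / τ) ^ 2 * L ^ 4 := by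
    have : M * (p * L ^ 2) / n ≤ M / τ * L ^ 2 := by
      have := mul_le_mul_of_nonneg_left hpn (show 0 ≤ M * L ^ 2 by positivity)
      calc _ = M * L ^ 2 * (p / n) := by ring
        _ ≤ _ := this
        _ = _ := by ring
    calc _ ≤ (M / τ * L ^ 2) ^ 2 := pow_le_pow_left₀ (by positivity) this 2
      _ = _ := by ring
  have a2 : (L * (M' / u)) ^ 4 * (d ^ 3 * p) ≤ M' ^ 4 / τ * L ^ 4 := by
    have e : (L * (M' / u)) ^ 4 * (d ^ 3 * p) = L ^ 4 * M' ^ 4 * ((d ^ 3 / n) * (p / n)) := by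
      rw [hun]; field_simp
    have hdn : d ^ 3 / n ≤ 1 := (div_le_one hn0).2 hd3
    have : (d ^ 3 / n) * (p / n) ≤ 1 * (1 / τ) := mul_le_mul hdn hpn hpn0 zero_le_one
    rw [e]
    calc _ ≤ L ^ 4 * M' ^ 4 * (1 * (1 / τ)) := mul_le_mul_of_nonneg_left this (by positivity)
      _ = _ := by ring
  have a3 : 1 + 3 * (M * (p * L ^ 2) / n) ^ 2 + (L * (M' / u)) ^ 4 * (d ^ 3 * p) + K₀ ≤
      (1 + 3 * (M / τ) ^ 2 + M' ^ 4 / τ + K₀) * L ^ 4 := by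
    have := mul_le_mul_of_nonneg_left hL4 hK₀
    linarith
  have hb : 0 ≤ 1 + 3 * (M / τ) ^ 2 + M' ^ 4 / τ + K₀ := by positivity
  have a4 : 5 + 16 * l.growthFlag * (1 + 3 * (M * (p * L ^ 2) / n) ^ 2 +
      (L * (M' / u)) ^ 4 * (d ^ 3 * p) + K₀) ≤
      (5 + 16 * (1 + 3 * (M / τ) ^ 2 + M' ^ 4 / τ + K₀)) * L ^ l.growthExponent :=
    (add_le_add_right (mul_le_mul_of_nonneg_left a3 (by positivity)) 5).trans
      (l.one_add_growthFlag_mul_pow_le hb hL)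
  set B := 5 + 16 * l.growthFlag * (1 + 3 * (M * (p * L ^ 2) / n) ^ 2 +
      (L * (M' / u)) ^ 4 * (d ^ 3 * p) + K₀)
  have hB : 0 ≤ B := by positivity
  set b := 5 + 16 * (1 + 3 * (M / τ) ^ 2 + M' ^ 4 / τ + K₀)
  -- Power count: k gives 1/(θn) and the third derivative θ³, leaving θ² after summation over n
  -- rows, while the cells give n^(−3/2)p = (p/n)/√n.
  have e : 46 * (K / (Θ * t * n)) * (Θ * t * C) ^ 3 * C * ((L * (M' / u)) ^ 3 * (d ^ 2 * p)) *
      (n * B) = 46 * K * C ^ 4 * Θ ^ 2 * M' ^ 3 * (t ^ 2 * (d ^ 2 * L ^ 3) / u) * ((p / n) * B) := by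
    rw [hun]; field_simp
  rw [e]
  calc _ ≤ 46 * K * C ^ 4 * Θ ^ 2 * M' ^ 3 * (t ^ 2 * (d ^ 2 * L ^ 3) / u) *
        ((1 / τ) * (b * L ^ l.growthExponent)) :=
        mul_le_mul_of_nonneg_left (mul_le_mul hpn a4 hB (by positivity)) (by positivity)
    _ = _ := by rw [pow_add]; ring

lemma exists_sigmoid_neg_mul_le {γ η : ℝ} (hγ : 0 < γ) (hη : 0 < η) :
    ∃ K, 0 ≤ K ∧ Real.sigmoid (-(K * γ)) ≤ η := by
  have h : Tendsto (fun K : ℝ => Real.sigmoid (-(K * γ))) atTop (𝓝 0) :=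
    Real.tendsto_sigmoid_atBot.comp
      (tendsto_neg_atTop_atBot.comp (tendsto_id.atTop_mul_const hγ))
  obtain ⟨K, hK0, hK⟩ := ((eventually_ge_atTop 0).and (h.eventually_le_const hη)).exists
  exact ⟨K, hK0, hK⟩

/-- With mesh n⁻⁴ and L ≤ n, each coordinate takes at most 2n⁵ + 2 ≤ n⁷ values, so the entropy is at
most 7(n/τ) log n. This dictates θ = Θ log n with Θ = 7/(τγ). -/
lemma log_net_card_le {n p L τ γ : ℝ} (hn : 2 ≤ n) (hτ : 0 < τ) (hγ : 0 < γ)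
    (hp : p ≤ n / τ) (hL0 : 0 ≤ L) (hL : L ≤ n) :
    p * Real.log (2 * (L / (1 / n ^ 4)) + 2) ≤ 7 / (τ * γ) * Real.log n * n * γ := by
  have hn0 : 0 < n := by linarith
  have h0 : 0 ≤ Real.log n := Real.log_nonneg (by linarith)
  have h1 : Real.log (2 * (L / (1 / n ^ 4)) + 2) ≤ 7 * Real.log n := by
    have h3 : 2 * (L / (1 / n ^ 4)) + 2 ≤ n ^ 7 := by
      rw [div_div_eq_mul_div, div_one]
      have a : L * n ^ 4 ≤ n * n ^ 4 := mul_le_mul_of_nonneg_right hL (by positivity)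
      have c : (1 : ℝ) ≤ n ^ 5 := one_le_pow₀ (by linarith)
      have b : 2 ^ 2 * n ^ 5 ≤ n ^ 2 * n ^ 5 := by gcongr
      nlinarith
    have := Real.log_le_log (by positivity) h3
    rwa [Real.log_pow] at this
  calc _ ≤ n / τ * (7 * Real.log n) :=
        mul_le_mul hp h1 (Real.log_nonneg (by
          have : 0 ≤ L / (1 / n ^ 4) := by positivity
          linarith)) (by positivity)
    _ = _ := by field_simp

/-- Since d, L and t are at least 1, smallness of the one error quantity bounds every other size
condition. -/
lemma size_bounds (l : RegressionLoss) {n d L M' t : ℝ} (hn1 : 1 ≤ n) (ht : 1 ≤ t) (hd1 : 1 ≤ d)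
    (hL1 : 1 ≤ L) (hM'0 : 0 ≤ M')
    (hu1 : t ^ 2 * (d ^ 2 * L ^ (l.growthExponent + 3)) / √n ≤ 1)
    (hu2 : t ^ 2 * (d ^ 2 * L ^ (l.growthExponent + 3)) / √n ≤ 1 / (M' + 1)) :
    L ≤ n ∧ d ^ 3 ≤ n ∧ L * (d * (M' / √n)) ≤ 1 := by
  have hn0 : 0 < n := by linarith
  have hL0 : 0 < L := one_pos.trans_le hL1
  have hs0 : 0 < √n := Real.sqrt_pos.2 hn0
  have hsq : √n ^ 2 = n := Real.sq_sqrt hn0.le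
  have hLd : d ^ 2 * L ^ 3 ≤ t ^ 2 * (d ^ 2 * L ^ (l.growthExponent + 3)) := by
    have h1 : L ^ 3 ≤ L ^ (l.growthExponent + 3) := pow_le_pow_right₀ hL1 (by omega)
    have h2 : 1 ≤ t ^ 2 := one_le_pow₀ ht
    calc d ^ 2 * L ^ 3 ≤ 1 * (d ^ 2 * L ^ (l.growthExponent + 3)) := by
          rw [one_mul]; gcongr
      _ ≤ _ := by gcongr
  have hLdn : d ^ 2 * L ^ 3 ≤ √n := by
    rw [div_le_one hs0] at hu1
    exact hLd.trans hu1
  have hL3 : 1 ≤ L ^ 3 := one_le_pow₀ hL1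
  have hL2 : 1 ≤ L ^ 2 := one_le_pow₀ hL1
  have hdd : 1 ≤ d ^ 2 := one_le_pow₀ hd1
  refine ⟨?_, ?_, ?_⟩
  · calc L = 1 * (L * 1) := by ring
      _ ≤ d ^ 2 * (L * L ^ 2) := by gcongr
      _ = d ^ 2 * L ^ 3 := by ring
      _ ≤ √n := hLdn
      _ ≤ n := by
        rw [Real.sqrt_le_left hn0.le]
        nlinarith
  · have hd2 : d ^ 2 ≤ √n := (le_mul_of_one_le_right (by positivity) hL3).trans hLdn
    calc d ^ 3 ≤ d ^ 4 := pow_le_pow_right₀ hd1 (by norm_num)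
      _ = (d ^ 2) ^ 2 := by ring
      _ ≤ √n ^ 2 := by gcongr
      _ = n := hsq
  · have h1 : L * d ≤ d ^ 2 * L ^ 3 := by
      calc L * d = (d * 1) * (L * 1) := by ring
        _ ≤ (d * d) * (L * L ^ 2) := by gcongr
        _ = _ := by ring
    have h2 : L * d / √n ≤ 1 / (M' + 1) :=
      (div_le_div_of_nonneg_right (h1.trans hLd) hs0.le).trans hu2
    calc L * (d * (M' / √n)) = L * d / √n * M' := by ring
      _ ≤ 1 / (M' + 1) * M' := mul_le_mul_of_nonneg_right h2 hM'0
      _ ≤ 1 := by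
        rw [one_div_mul_eq_div, div_le_one (by positivity)]
        linarith

/-- For L ≤ n the modulus of the risk is O(n³), which the mesh n⁻⁴ beats. -/
lemma net_error_le (l : RegressionLoss) {n L K₀ γ : ℝ} (hn1 : 1 ≤ n) (hLn : L ≤ n)
    (hK₀ : 0 ≤ K₀) (hγ : 0 < γ) (hn : l.slope * (8 + 2 * K₀) / γ ≤ n) :
    l.slope * (1 / n ^ 4) * (3 + (3 + 2 * L) * n ^ 2 + 2 * K₀) ≤ γ := by
  have hsl := l.slope_pos
  have hn0 : 0 < n := by linarith
  have hn3 : 1 ≤ n ^ 3 := one_le_pow₀ hn1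
  have hb : 3 + (3 + 2 * L) * n ^ 2 + 2 * K₀ ≤ (8 + 2 * K₀) * n ^ 3 := by
    have a : (3 + 2 * L) * n ^ 2 ≤ (3 * n + 2 * n) * n ^ 2 := by
      gcongr
      linarith
    have b := mul_le_mul_of_nonneg_left hn3 hK₀
    linarith
  calc _ ≤ l.slope * (1 / n ^ 4) * ((8 + 2 * K₀) * n ^ 3) := by gcongr
    _ = l.slope * (8 + 2 * K₀) / n := by field_simp
    _ ≤ γ := by
      rw [div_le_iff₀ hn0]
      rw [div_le_iff₀ hγ] at hn
      linarith

lemma largeDesign_error_le {n p τ M' η : ℝ} (hn1 : 1 ≤ n) (hτ : 0 < τ) (hp0 : 0 ≤ p)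
    (hp : p ≤ n / τ) (hη : 0 < η) (hn : M' ^ 2 / τ ^ 2 / η ≤ n) :
    (p * M') ^ 2 / n ^ 3 ≤ η := by
  have hn0 : 0 < n := by linarith
  rw [div_le_iff₀ hη] at hn
  calc (p * M') ^ 2 / n ^ 3 = p ^ 2 * M' ^ 2 / n ^ 3 := by rw [mul_pow]
    _ ≤ (n / τ) ^ 2 * M' ^ 2 / n ^ 3 := by gcongr
    _ = M' ^ 2 / τ ^ 2 / n := by field_simp
    _ ≤ η := by
      rw [div_le_iff₀ hn0]
      linarith

lemma mul_div_add_one_le {c η : ℝ} (hc : 0 ≤ c) (hη : 0 ≤ η) : c * (η / (c + 1)) ≤ η := by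
  rw [mul_div_assoc', div_le_iff₀ (by positivity)]
  nlinarith

end Asymptotics

end BlockUniversality

end

open BlockUniversality

theorem corollary2
    -- the loss, the dimensions `p = p(n)` and the proportional regime
    (l : BlockUniversality.RegressionLoss)
    (p : ℕ → ℕ) (τ : ℝ) (hτ : τ ∈ Set.Ioo (0 : ℝ) 1)
    (hp : ∀ n, 1 ≤ n → τ ≤ (p n : ℝ) / n ∧ (p n : ℝ) / n ≤ 1 / τ)
    -- probability spaces, covariance, design, Gaussian design, noise
    {Ω : ℕ → Type*} [∀ n, MeasurableSpace (Ω n)]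
    (P : ∀ n, MeasureTheory.Measure (Ω n)) [∀ n, MeasureTheory.IsProbabilityMeasure (P n)]
    (Sig : ∀ n, Matrix (Fin (p n)) (Fin (p n)) ℝ) (hSig : ∀ n, 1 ≤ n → (Sig n).PosDef)
    (X G : ∀ n, Ω n → Fin n → Fin (p n) → ℝ)
    (hX : ∀ n, 1 ≤ n → BlockUniversality.IsDesign (P n) (X n) (Sig n))
    (hG : ∀ n, 1 ≤ n → BlockUniversality.IsGaussianDesign (P n) (G n) (Sig n))
    (ξ : ∀ n, Ω n → Fin n → ℝ) (hξ : ∀ n, 1 ≤ n → Measurable (ξ n))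
    (hξX : ∀ n, 1 ≤ n → ProbabilityTheory.IndepFun (X n) (ξ n) (P n))
    (hξG : ∀ n, 1 ≤ n → ProbabilityTheory.IndepFun (G n) (ξ n) (P n))
    -- moments of the rescaled covariates `√n Xᵢ`, and the largest eigenvalue of `Σ`
    (M : ℝ)
    (hM : ∀ n : ℕ, 1 ≤ n → ∀ i j,
      MeasureTheory.eLpNorm (fun ω => √(n : ℝ) * X n ω i j) (ENNReal.ofReal l.qStar) (P n)
        ≤ ENNReal.ofReal M)
    (hSigM : ∀ n, 1 ≤ n → BlockUniversality.lambdaMax (Sig n) ≤ M)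
    -- block dependence
    (d : ℕ → ℕ)
    (hd : ∀ n, 1 ≤ n → ∀ i, BlockUniversality.BlockDependent (P n) (fun ω => X n ω i) (d n))
    -- growth constants `L_{ℓᵢ}` of the losses `ℓᵢ(x) = ℓ(x - ξᵢ)`, with `Av({L_{ℓᵢ}^𝐪}) = O(1)`
    (Lloss : ∀ n, Ω n → Fin n → ℝ)
    (hLloss_one : ∀ n, 1 ≤ n → ∀ ω i, 1 ≤ Lloss n ω i)
    (hLloss : ∀ n, 1 ≤ n → ∀ ω i, ∀ x : ℝ,
      |l.fn (x - ξ n ω i)| / (1 + |x| ^ l.qZero) ≤ Lloss n ω i)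
    (hAv : BlockUniversality.BoundedInProbability P
      (fun n ω => (1 / (n : ℝ)) * ∑ i, Lloss n ω i ^ l.qBold))
    -- convex regularizer, and the estimators
    (R : ∀ n, (Fin (p n) → ℝ) → ℝ) (hR : ∀ n, 1 ≤ n → ConvexOn ℝ Set.univ (R n))
    (wX wG : ∀ n, Ω n → Fin (p n) → ℝ)
    (hwX_meas : ∀ n, 1 ≤ n → Measurable (wX n)) (hwG_meas : ∀ n, 1 ≤ n → Measurable (wG n))
    (hwX : ∀ n, 1 ≤ n → ∀ᵐ ω ∂(P n),
      IsMinOn (BlockUniversality.risk l (R n) (X n ω) (ξ n ω)) Set.univ (wX n ω))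
    (hwG : ∀ n, 1 ≤ n → ∀ᵐ ω ∂(P n),
      IsMinOn (BlockUniversality.risk l (R n) (G n ω) (ξ n ω)) Set.univ (wG n ω))
    -- the sets `Sₙ` and conditions (i), (ii); `‖·‖` is the sup norm on `Fin (p n) → ℝ`
    (S : ∀ n, Set (Fin (p n) → ℝ)) (hS : ∀ n, 1 ≤ n → MeasurableSet (S n))
    (ε : ℕ → ℝ) (hε : ∀ n, 1 ≤ n → ε n ∈ Set.Ico (0 : ℝ) (1 / 4))
    (z : ℕ → ℝ) (ρ₀ : ℝ) (hρ₀ : 0 < ρ₀)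
    (L : ℕ → ℝ) (hL : ∀ n, 1 ≤ n → 1 ≤ L n)
    (h_i : ∀ n, 1 ≤ n →
      max ((P n).real {ω | L n < ‖wG n ω‖}) ((P n).real {ω | L n < ‖wX n ω‖}) ≤ ε n)
    (h_ii : ∀ n, 1 ≤ n →
      max
        ((P n).real {ω | ((z n + ρ₀ : ℝ) : EReal) ≤
          BlockUniversality.minRisk l (R n) (G n ω) (ξ n ω) Set.univ})
        ((P n).real {ω | BlockUniversality.minRisk l (R n) (G n ω) (ξ n ω) (S n) ≤
          ((z n + 2 * ρ₀ : ℝ) : EReal)}) ≤ ε n)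
    -- the orders of `Lₙ` and `d`
    (α κ : ℝ) (hα : α ∈ Set.Icc (0 : ℝ) (1 / (2 * l.qBar + 6))) (hκ : 0 ≤ κ)
    (hL_order : L =O[Filter.atTop] fun n => (n : ℝ) ^ α * Real.log n ^ κ)
    (hd_order : (fun n => (d n : ℝ)) =o[Filter.atTop] fun n =>
      (n : ℝ) ^ (1 / 4 - (l.qBar + 3) * α / 2) / Real.log n ^ (6 + (2 * l.qBar + 6) * κ)) :
    ∃ r : ℕ → ℝ, Filter.Tendsto r Filter.atTop (nhds 0) ∧
      ∀ n, 1 ≤ n →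
        |(P n).real {ω | wX n ω ∈ S n} - (P n).real {ω | wG n ω ∈ S n}| ≤ 4 * ε n + r n := by
  set q := ENNReal.ofReal l.qStar with hq
  set M' := max M (√M * gaussianNorm q) with hM'
  obtain ⟨hτ0, hτ1⟩ := hτ
  have hp1 : ∀ n, 1 ≤ n → 1 ≤ p n := fun n hn => by
    have hn0 : (0 : ℝ) < n := by exact_mod_cast hn
    have h := (le_div_iff₀ hn0).1 (hp n hn).1
    have : (0 : ℝ) < p n := (mul_pos hτ0 hn0).trans_le h
    exact_mod_cast this
  have hpτ : ∀ n, 1 ≤ n → (p n : ℝ) ≤ n / τ := fun n hn => by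
    have hn0 : (0 : ℝ) < n := by exact_mod_cast hn
    have h := (div_le_iff₀ hn0).1 (hp n hn).2
    rwa [one_div_mul_eq_div] at h
  have hd1 : ∀ n, 1 ≤ n → (1 : ℝ) ≤ d n := fun n hn => by
    exact_mod_cast (hd n hn ⟨0, hn⟩).one_le (hp1 n hn)
  -- A diagonal entry of Σ₁ is nonnegative and at most λ_max(Σ₁); such an entry exists because p₁ ≥
  -- 1.
  have hM0 : 0 ≤ M := (hSig 1 le_rfl).posSemidef.diag_nonneg.trans
    ((diag_le_lambdaMax (hSig 1 le_rfl).posSemidef ⟨0, hp1 1 le_rfl⟩).trans (hSigM 1 le_rfl))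
  have hM'0 : 0 ≤ M' := hM0.trans (le_max_left _ _)
  -- The remainder is taken to be the positive part of the excess over 4ε, so it is enough to bound
  -- the excess eventually by each η.
  suffices key : ∀ η : ℝ, 0 < η → ∀ᶠ n in Filter.atTop,
      |(P n).real {ω | wX n ω ∈ S n} - (P n).real {ω | wG n ω ∈ S n}| ≤ 4 * ε n + η by
    refine ⟨fun n => max 0 (|(P n).real {ω | wX n ω ∈ S n} - (P n).real {ω | wG n ω ∈ S n}| -
      4 * ε n), ?_, fun n _ => ?_⟩
    · rw [Metric.tendsto_atTop']
      intro η hη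
      obtain ⟨N, hN⟩ := Filter.eventually_atTop.1 (key (η / 2) (half_pos hη))
      refine ⟨N, fun n hn => ?_⟩
      rw [Real.dist_eq, sub_zero, abs_of_nonneg (le_max_left _ _)]
      exact max_lt hη (by linarith [hN n hn.le])
    · linarith [le_max_right 0
        (|(P n).real {ω | wX n ω ∈ S n} - (P n).real {ω | wG n ω ∈ S n}| - 4 * ε n)]
  intro η hη
  -- Smoothing scale, slope K and noise level K₁ are chosen in this order, each independent of n.
  -- The constants C, K, K₀ and Θ are therefore fixed when n tends to infinity.
  obtain ⟨g, g₁, g₂, g₃, V, C, hg, hgl⟩ := l.exists_isTame (show 0 < ρ₀ / 20 by positivity)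
  have hC := hg.one_le
  obtain ⟨K, hK0, hK⟩ := exists_sigmoid_neg_mul_le (show 0 < ρ₀ / 10 by positivity)
    (show 0 < η / 16 by positivity)
  obtain ⟨K₁, hK₁⟩ := hAv (η / 24) (by positivity)
  -- The level supplied by boundedness in probability may be negative.
  set K₀ := max K₁ 0 with hK₀
  set Θ := 7 / (τ * (ρ₀ / 20)) with hΘ
  have hΘ0 : 0 < Θ := by positivity
  set c := 46 * K * C ^ 4 * Θ ^ 2 * M' ^ 3 / τ *
    (5 + 16 * (1 + 3 * (M / τ) ^ 2 + M' ^ 4 / τ + K₀)) with hc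
  have hc0 : 0 ≤ c := by positivity
  have hnat := tendsto_natCast_atTop_atTop (R := ℝ)
  have hlog := Real.tendsto_log_atTop.comp hnat
  rw [RegressionLoss.qBar_eq] at hd_order
  have herr := tendsto_error l.growthExponent hκ hL_order hd_order
  filter_upwards [hK₁, hnat.eventually_ge_atTop (max 2 K), hlog.eventually_ge_atTop (max 1 (1 / Θ)),
    hnat.eventually_ge_atTop (l.slope * (8 + 2 * K₀) / (ρ₀ / 20)),
    hnat.eventually_ge_atTop (M' ^ 2 / τ ^ 2 / (η / 16)),
    herr.eventually_le_const (show 0 < min 1 (1 / (M' + 1)) by positivity),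
    herr.eventually_le_const (show 0 < η / 8 / (c + 1) by positivity)] with
    n hKn hn2 hlogn hslope hMn hu1 hu2
  obtain ⟨hn2, hnK⟩ := max_le_iff.1 hn2
  obtain ⟨hlog1, hlogΘ⟩ := max_le_iff.1 hlogn
  obtain ⟨hu1, hu3⟩ := le_min_iff.1 hu1
  simp only [Function.comp_apply] at hlog1 hlogΘ
  have hn : 1 ≤ n := by
    have : (1 : ℝ) ≤ n := by linarith
    exact_mod_cast this
  have hn0 : (0 : ℝ) < n := by linarith
  have hn1 : (1 : ℝ) ≤ n := by linarith
  have hL1 := hL n hn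
  have hd1 := hd1 n hn
  set t := Real.log n
  have hL0 : 0 < L n := one_pos.trans_le hL1
  obtain ⟨hLn, hd3, hr⟩ := size_bounds l hn1 hlog1 hd1 hL1 hM'0 hu1 hu3
  have hθ : 1 ≤ Θ * t := by
    rw [mul_comm]
    exact (div_le_iff₀ hΘ0).1 hlogΘ
  obtain ⟨hGL, hXL⟩ := max_le_iff.1 (h_i n hn)
  obtain ⟨hall, hSn⟩ := max_le_iff.1 (h_ii n hn)
  have hnoise : (P n).real (ξ n ⁻¹' largeNoise l n K₀) ≤ η / 24 := by
    refine (MeasureTheory.measureReal_mono (fun ω hω => ?_) (MeasureTheory.measure_ne_top _ _)).trans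
      hKn
    have h1 : K₀ * n < l.growthFlag * ∑ i, |ξ n ω i| ^ 3 := hω
    have h2 := l.growthFlag_mul_sum_le (hLloss_one n hn ω) (hLloss n hn ω)
    have h3 : K₁ * n ≤ K₀ * n := mul_le_mul_of_nonneg_right (le_max_left _ _) hn0.le
    show K₁ < |(1 / (n : ℝ)) * ∑ i, Lloss n ω i ^ l.qBold|
    refine lt_of_lt_of_le ?_ (le_abs_self _)
    rw [one_div_mul_eq_div, lt_div_iff₀ hn0]
    linarith
  have main := abs_measureReal_mem_sub_le_of_blockDependent (M' := M') (K₀ := K₀) l hn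
    (hSig n hn) (hX n hn) (hG n hn)
    (hξ n hn) (hξX n hn) (hξG n hn) hM0 (hSigM n hn) (le_max_left _ _) (le_max_right _ _) (hM n hn)
    (hd n hn) (hR n hn) (hwX n hn) (hwG n hn) hρ₀ hL0.le hXL hGL hall hSn hg hgl hK0 hθ
    (by
      rw [div_le_one (by positivity)]
      exact hnK.trans (le_mul_of_one_le_left hn0.le hθ))
    (show 0 < 1 / (n : ℝ) ^ 4 by positivity) (le_max_right _ _)
    (log_net_card_le hn2 hτ0 (by positivity) (hpτ n hn) hL0.le hLn)
    (net_error_le l hn1 hLn (le_max_right _ _) (by positivity) hslope) hr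
    (comparison_error_le (M' := M') (K₀ := K₀) l hn1 hτ0 (Nat.cast_nonneg _)
      (hpτ n hn) hd1 hd3 hL1 hM0 hM'0 hK0 hC hΘ0
      (le_max_right _ _) hlog1) hnoise
  have e1 := largeDesign_error_le (M' := M') hn1 hτ0 (Nat.cast_nonneg (p n)) (hpτ n hn)
    (show 0 < η / 16 by positivity) hMn
  have e2 : c * _ ≤ η / 8 := (mul_le_mul_of_nonneg_left hu2 hc0).trans
    (mul_div_add_one_le hc0 (show 0 ≤ η / 8 by positivity))
  rw [← hc] at main
  refine main.trans (add_le_add_right ?_ _)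
  -- The budget is 2(2·η/16 + 3·η/24 + η/8 + 2·η/16) = η, for large designs, noise, comparison and
  -- sigmoid tails.
  linarith only [e1, e2, hK]
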